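/- Let $V$ be an $n$-dimensional real affine space and let $\mathcal{P} = (P, d\mu, d\sigma)$ be a system: $P \subset V$ is a simple polytope (compact, with non-empty interior, a finite intersection of half spaces, each vertex lying on precisely $n$ facets), $d\mu$ is a flat measure on $P$ (the restriction to $P$ of a non-zero, locally finite translation invariant measure on $V$), and $d\sigma$ is a measure on $\partial P$ whose restriction to each facet is flat in the affine span of the facet. A state is a lower semicontinuous log convex function $u : P \to (0,\infty]$ with $\int_P u\,d\mu = \int_P d\mu$; let $\mathcal{M}$ be the set of states. For $u \in \mathcal{M}$ and $T \in \mathbb{R}$ put $$S(u) = -\frac{1}{\int_P d\mu}\int_P u\log u\,d\mu \in [-\infty,0], \qquad U(u) = \frac{1}{\int_P d\mu}\int_{\partial P} u\,d\sigma,$$ $F(T,u) = U(u) - T S(u)$ if $S(u) > -\infty$ and $F(T,u) = \infty$ if $S(u) = -\infty$, and let $$F^{\mathrm{can}}(T) = \min_{u \in \mathcal{M}} F(T,u).$$ For $E \in \mathbb{R}$ put $S^{\mathrm{eq}}(E) = \sup\{S(u) \mid u \in \mathcal{M},\ U(u) = E\}$ (with $\sup\emptyset = -\infty$), and let $\mathbb{T}^{\mathrm{eq}}(E)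 = [\beta^-(E)^{-1}, \beta^+(E)^{-1}]$, where $\beta^{-}(E)$ and $\beta^{+}(E)$ are the left and the right derivative of $S^{\mathrm{eq}}$ at $E$ (possibly $+\infty$, with inverse $0$). Call $\mathcal{P}$ K-unstable if some $d\mu$- and $d\sigma$-integrable convex function $q: P \to \mathbb{R}$ satisfies $$\frac{2\pi}{\int_P d\mu}\Big(\int_{\partial P} q\,d\sigma - \frac{\int_{\partial P} d\sigma}{\int_P d\mu}\int_P q\,d\mu\Big) < 0,$$ and K-semistable otherwise. For $T \ge 0$ let $U^{\mathrm{can}}(T)$ be the unique $E \in [\min_{\mathcal{M}} U,\, U(1_P))$ with $T \in \mathbb{T}^{\mathrm{eq}}(E)$ if $\mathcal{P}$ is K-unstable, and $U^{\mathrm{can}}(T) = U(1_P)$ if $\mathcal{P}$ is K-semistable; put $S^{\mathrm{can}}(T) = S^{\mathrm{eq}}(U^{\mathrm{can}}(T))$. Proposition. For every $T \in [0,\infty)$ these quantities are well defined and finite (the minimum $F^{\mathrm{can}}(T)$ is attained, and in the K-unstable case there is exactly one such $E$), and $$F^{\mathrm{can}}(T) = U^{\mathrm{can}}(T) - T\,S^{\mathrm{can}}(T).$$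 Moreover, $F^{\mathrm{can}}$ is continuously differentiable on $[0,\infty)$ (one-sidedly at $T = 0$), with $$\partial_T F^{\mathrm{can}}(T) = -S^{\mathrm{can}}(T).$$ -/

import Mathlib

open MeasureTheory Set Filter Topology
open scoped ENNReal

noncomputable section

/-! ### Polytopes and flat measures

The ambient `n`-dimensional affine space is a finite-dimensional real normed space `V`, regarded as
an affine space over itself; the norm is used only for its topology. -/

section Polytopes

variable {V : Type*} [NormedAddCommGroup V] [NormedSpace ℝ V]

/-- A polytope: a compact set with nonempty interior that is the intersection of finitely many
half spaces `{x | 0 ≤ ℓ x}`, where `ℓ` is a nonzero affine function. -/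
def IsPolytope (P : Set V) : Prop :=
  IsCompact P ∧ (interior P).Nonempty ∧
    ∃ L : Finset (V →ᵃ[ℝ] ℝ), (∀ ℓ ∈ L, ℓ ≠ 0) ∧ P = {x | ∀ ℓ ∈ L, 0 ≤ ℓ x}

/-- `F` is a face of `P`: the intersection of `P` with the bounding hyperplane of a half space
that contains `P`. -/
def IsPolytopeFace (P F : Set V) : Prop :=
  ∃ ℓ : V →ᵃ[ℝ] ℝ, ℓ ≠ 0 ∧ (∀ x ∈ P, 0 ≤ ℓ x) ∧ F = {x ∈ P | ℓ x = 0}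

/-- A facet: a nonempty face whose affine span has codimension one. -/
def IsFacet (P F : Set V) : Prop :=
  IsPolytopeFace P F ∧ F.Nonempty ∧
    Module.finrank ℝ (affineSpan ℝ F).direction + 1 = Module.finrank ℝ V

/-- A polytope is simple if each vertex (one-point face) lies on precisely `n = dim V` facets. -/
def IsSimplePolytope (P : Set V) : Prop :=
  IsPolytope P ∧
    ∀ v : V, IsPolytopeFace P {v} →
      {F : Set V | IsFacet P F ∧ v ∈ F}.encard = Module.finrank ℝ V

variable [MeasurableSpace V]

/-- `ν` is a flat measure on `F` (a polytope or a face of one): with `W` the affine span of `F`, it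
is the restriction to `F` of a translation invariant measure on `W`, finite on compact sets and
positive on nonempty open sets of `W`, that is, of a Haar measure of the direction of `W`
transported to `W` by the choice of a base point. -/
def IsFlatMeasure (F : Set V) (ν : Measure V) : Prop :=
  ∃ p ∈ affineSpan ℝ F, ∃ m : Measure (affineSpan ℝ F).direction,
    m.IsAddHaarMeasure ∧
      ν = (m.map fun w : (affineSpan ℝ F).direction => (w : V) + p).restrict F

/-- The topological boundary of a (closed) set, as a subset of it. -/
def polytopeBoundary (P : Set V) : Set V := P \ interior P

/-- A flat measure on the boundary `∂P`: a measure carried by `∂P` whose restriction to each facet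
is flat. -/
def IsFlatBoundaryMeasure (P : Set V) (σ : Measure V) : Prop :=
  σ (polytopeBoundary P)ᶜ = 0 ∧ ∀ F : Set V, IsFacet P F → IsFlatMeasure F (σ.restrict F)

end Polytopes

/-! ### Systems, states, entropy, energy -/

/-- A system `(P, dμ, dσ)`: a simple polytope, a flat measure on it and a flat measure on its
boundary. -/
structure SimpleSystem (V : Type*) [NormedAddCommGroup V] [NormedSpace ℝ V]
    [MeasurableSpace V] where
  /-- the polytope -/
  P : Set V
  /-- the flat measure on the polytope -/
  μ : Measure V
  /-- the flat measure on the boundary of the polytope -/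
  σ : Measure V
  simple : IsSimplePolytope P
  flat_μ : IsFlatMeasure P μ
  flat_σ : IsFlatBoundaryMeasure P σ

namespace SimpleSystem

variable {V : Type*} [NormedAddCommGroup V] [NormedSpace ℝ V] [MeasurableSpace V]
variable (S : SimpleSystem V)

/-- The boundary `∂P`. -/
def bdry : Set V := polytopeBoundary S.P

/-- The volume `∫_P dμ`. -/
def vol : ℝ≥0∞ := S.μ S.P

/-- A (nonequilibrium) state: a lower semicontinuous log convex function `u : P → (0, ∞]` with
`∫_P u dμ = ∫_P dμ`. Only the values of `u` on `P` matter. -/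
structure IsState (u : V → ℝ≥0∞) : Prop where
  lsc : LowerSemicontinuousOn u S.P
  pos : ∀ x ∈ S.P, 0 < u x
  logConvex : ∀ x ∈ S.P, ∀ y ∈ S.P, ∀ t : ℝ, 0 ≤ t → t ≤ 1 →
    u ((1 - t) • x + t • y) ≤ u x ^ (1 - t) * u y ^ t
  normalized : ∫⁻ x in S.P, u x ∂S.μ = S.vol

open Classical in
/-- The entropy `- (∫_P dμ)⁻¹ ∫_P u log u dμ ∈ [-∞, 0]` of a state. A state is finite almost
everywhere and `u log u` is bounded below, so the integral is `+∞` exactly when `u log u` is not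
integrable. -/
def entropy (u : V → ℝ≥0∞) : EReal :=
  if IntegrableOn (fun x => (u x).toReal * Real.log (u x).toReal) S.P S.μ then
    ((-((∫ x in S.P, (u x).toReal * Real.log (u x).toReal ∂S.μ) / S.vol.toReal) : ℝ) : EReal)
  else ⊥

/-- The internal energy `(∫_P dμ)⁻¹ ∫_{∂P} u dσ`. -/
def energy (u : V → ℝ≥0∞) : ℝ≥0∞ := (∫⁻ x in S.bdry, u x ∂S.σ) / S.vol

open Classical in
/-- The free energy `U(u) - T S(u)`, and `∞` if `S(u) = -∞`. -/
def freeEnergy (T : ℝ) (u : V → ℝ≥0∞) : EReal :=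
  if S.entropy u = ⊥ then ⊤ else (S.energy u : EReal) - (T : EReal) * S.entropy u

/-- The minimal free energy `F^can(T)`: the infimum of the free energy over all states. -/
def canFreeEnergy (T : ℝ) : EReal :=
  ⨅ (u : V → ℝ≥0∞) (_ : S.IsState u), S.freeEnergy T u

/-! ### Equilibrium entropy and temperature -/

/-- The equilibrium entropy `S^eq(U)`: the supremum of the entropy over the states of internal
energy `U` (which is `-∞` if there is none). -/
def eqEntropy (U : ℝ) : EReal :=
  ⨆ (u : V → ℝ≥0∞) (_ : S.IsState u ∧ (S.energy u : EReal) = (U : EReal)), S.entropy u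

/-- The difference quotient of `S^eq` between `U` and `U'`. -/
def eqEntropySlope (U U' : ℝ) : EReal :=
  (S.eqEntropy U' - S.eqEntropy U) / ((U' - U : ℝ) : EReal)

/-- The right derivative of `S^eq` at `U`. -/
def eqBetaRight (U : ℝ) : EReal := limUnder (𝓝[>] U) (S.eqEntropySlope U)

/-- The left derivative of `S^eq` at `U`; it is `+∞` at the minimal energy. -/
def eqBetaLeft (U : ℝ) : EReal := limUnder (𝓝[<] U) (S.eqEntropySlope U)

/-- The interval `𝕋^eq(U)` of temperatures between the inverses of the left and of the right
derivative of `S^eq` at `U`. It is used only for `U` in `energyRange`, where both derivatives are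
positive (possibly `+∞`, with inverse `0`). -/
def eqTemperatures (U : ℝ) : Set ℝ :=
  {T | (S.eqBetaLeft U)⁻¹ ≤ (T : EReal) ∧ (T : EReal) ≤ (S.eqBetaRight U)⁻¹}

/-- The half-open interval `[min U, U(1_P))` of energies. -/
def energyRange : Set ℝ :=
  {U | (⨅ (u : V → ℝ≥0∞) (_ : S.IsState u), (S.energy u : EReal)) ≤ (U : EReal) ∧
    (U : EReal) < (S.energy (fun _ => 1) : EReal)}

/-! ### K-stability -/

/-- The Donaldson--Futaki invariant of a function. -/
def donaldsonFutaki (q : V → ℝ) : ℝ :=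
  2 * Real.pi / S.vol.toReal *
    ((∫ x in S.bdry, q x ∂S.σ) -
      (S.σ S.bdry).toReal / S.vol.toReal * ∫ x in S.P, q x ∂S.μ)

/-- K-instability: some integrable convex function has negative Donaldson--Futaki invariant. The
system is K-semistable if it is not K-unstable. -/
def IsKUnstable : Prop :=
  ∃ q : V → ℝ, ConvexOn ℝ S.P q ∧ IntegrableOn q S.P S.μ ∧ IntegrableOn q S.bdry S.σ ∧
    S.donaldsonFutaki q < 0

/-! ### Canonical energy and entropy -/

open Classical in
/-- `U^can(T)`: the energy `U ∈ [min U, U(1_P))` with `T ∈ 𝕋^eq(U)` if the system is K-unstable,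
and `U(1_P)` if it is K-semistable. -/
def canEnergy (T : ℝ) : ℝ :=
  if S.IsKUnstable then
    Classical.epsilon fun U : ℝ => U ∈ S.energyRange ∧ T ∈ S.eqTemperatures U
  else (S.energy fun _ => 1).toReal

/-- `S^can(T) = S^eq(U^can(T))`. -/
def canEntropy (T : ℝ) : EReal := S.eqEntropy (S.canEnergy T)

end SimpleSystem

end

open MeasureTheory Set Filter Topology
open scoped ENNReal

noncomputable section

/-! ### Facets of polytopes and finiteness of flat measures. -/

section Geometry

variable {V : Type*} [NormedAddCommGroup V] [NormedSpace ℝ V]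

/-! For each `T ≥ 0` a minimizer `M T` of `U - T S` is chosen, and everything is read off from this
family. As a minimum of functions affine in `T`, the minimal free energy has increments squeezed
between `-(T' - T) S(M T')` and `-(T' - T) S(M T)`. So it is C¹ with derivative `-S(M T)` once `T ↦
S(M T)` is continuous. By Legendre duality `T ∈ 𝕋^eq(E)` says that the line of slope `1/T` supports
the concave function `S^eq` at `E`, and this happens exactly at `E = U(M T)`.

Existence and continuity rest on uniform concavity of the entropy. Embed states in `L²(μ)` by `u ↦
√u`. The entropy of a midpoint exceeds the mean of the entropies by a multiple of the squared
distance (`Real.mul_log_midpoint_le`), while the energy is affine, so almost minimizers at `T > 0`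
are close to each other and minimizing sequences are Cauchy. At `T = 0` this concavity is lost. The
minimizers at `T = 1/(j+1)` are still Cauchy, because their distances are controlled by the decrease
of a bounded monotone sequence of entropies; their limit has minimal energy and, among such states,
maximal entropy. This part is abstract and lives in `EnergyEntropySystem`.

Three analytic facts make states an instance. First, states of bounded energy are closed under `L²`
limits of square roots. An almost everywhere limit of log convex functions is a limit everywhere in
the interior (`LogConvexOn.exists_tendsto_of_ae`) and extends to the boundary as a supremum of
exponentials of affine functions. Second, energy is lower semicontinuous although `μ` does not see
the boundary: a lower semicontinuous state is bounded on all of `P` by the liminf of the sequence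
(`LogConvexOn.le_liminf`), and Fatou's lemma applies on `∂P`. Third, entropy is bounded below
linearly in the energy (`exists_lintegral_mul_log_le`). On rays from an interior point to a boundary
point `y` one has `u ≤ M v^s` with `v = max (u y) M`, and integrating `v^s log v` in `s` gives `v -
1`, so the logarithm disappears.

K-stability enters only through the uniform state. A state of energy below `U(1_P)` is a convex
function of negative Donaldson–Futaki invariant; conversely, normalizing `exp (ε q)` turns a
destabilizing `q` into such a state. In the unstable case moving a distance `t` from `1_P` towards
that state lowers the energy to first order at an entropy cost of order `t²`, so `U(M T) < U(1_P)`
for every `T`. -/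

theorem AffineMap.apply_add_smul_sub (ℓ : V →ᵃ[ℝ] ℝ) (x y : V) (s : ℝ) :
    ℓ (x + s • (y - x)) = ℓ x + s * (ℓ y - ℓ x) := by
  have := ℓ.apply_lineMap x y s
  rw [AffineMap.lineMap_apply, AffineMap.lineMap_apply] at this
  simp only [vsub_eq_sub, vadd_eq_add, smul_eq_mul] at this
  rw [add_comm x, this, add_comm]

theorem AffineMap.apply_add_smul (ℓ : V →ᵃ[ℝ] ℝ) (x v : V) (s : ℝ) :
    ℓ (x + s • v) = ℓ x + s * ℓ.linear v := by
  have := ℓ.map_vadd x (s • v)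
  rw [vadd_eq_add, vadd_eq_add, map_smul, smul_eq_mul] at this
  rw [add_comm x, this, add_comm]

theorem IsPolytope.convex {P : Set V} (hP : IsPolytope P) : Convex ℝ P := by
  obtain ⟨-, -, L, -, rfl⟩ := hP
  intro x hx y hy a b ha hb hab ℓ hℓ
  have h := Convex.combo_affine_apply (f := ℓ) (x := x) (y := y) hab
  rw [h, smul_eq_mul, smul_eq_mul]
  exact add_nonneg (mul_nonneg ha (hx ℓ hℓ)) (mul_nonneg hb (hy ℓ hℓ))

theorem AffineMap.pos_of_mem_interior {P : Set V} {ℓ : V →ᵃ[ℝ] ℝ} (hℓ : ℓ ≠ 0)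
    (hP : ∀ x ∈ P, 0 ≤ ℓ x) {x : V} (hx : x ∈ interior P) : 0 < ℓ x := by
  refine lt_of_le_of_ne (hP x (interior_subset hx)) fun h0 => hℓ ?_
  have hlin : ∀ v, 0 ≤ ℓ.linear v := by
    intro v
    have hc : Tendsto (fun s : ℝ => x + s • v) (𝓝[>] 0) (𝓝 x) := by
      have : Continuous fun s : ℝ => x + s • v := by fun_prop
      simpa using (this.tendsto 0).mono_left nhdsWithin_le_nhds
    obtain ⟨s, hs, hs0⟩ :=
      ((hc.eventually (mem_interior_iff_mem_nhds.1 hx)).and self_mem_nhdsWithin).exists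
    have := hP _ hs
    rw [ℓ.apply_add_smul, ← h0, zero_add] at this
    exact nonneg_of_mul_nonneg_right this hs0
  ext y
  have h1 := ℓ.apply_add_smul x (y - x) 1
  have h2 := hlin (y - x)
  have h3 := hlin (-(y - x))
  rw [map_neg] at h3
  simp only [one_smul, add_sub_cancel, one_mul, ← h0] at h1
  simp only [AffineMap.coe_zero, Pi.zero_apply]
  linarith

/-- The cones over the facets with apex at an interior point cover the polytope. -/
theorem exists_facet_ray {P : Set V} (hc : IsCompact P) {L : Finset (V →ᵃ[ℝ] ℝ)}
    (hPL : P = {x | ∀ ℓ ∈ L, 0 ≤ ℓ x}) {x₀ x : V} (hx₀ : ∀ ℓ ∈ L, 0 < ℓ x₀)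
    (hx : x ∈ P) (hne : x ≠ x₀) :
    ∃ ℓ ∈ L, ∃ y ∈ {x ∈ P | ℓ x = 0}, ∃ s ∈ Ioc (0 : ℝ) 1, x = x₀ + s • (y - x₀) := by
  have hx' := hx
  rw [hPL] at hx'
  have hex : ∃ ℓ ∈ L, ℓ x < ℓ x₀ := by
    -- If no `ℓ` decreases from `x₀` to `x`, the whole ray from `x₀` through `x` stays in `P`,
    -- against boundedness.
    by_contra! h
    have hray : ∀ s : ℝ, 0 ≤ s → x₀ + s • (x - x₀) ∈ P := by
      intro s hs
      rw [hPL]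
      intro ℓ hℓ
      rw [AffineMap.apply_add_smul_sub]
      nlinarith [hx₀ ℓ hℓ, h ℓ hℓ]
    obtain ⟨R, hR⟩ := hc.isBounded.exists_norm_le
    have hn : 0 < ‖x - x₀‖ := norm_pos_iff.2 (sub_ne_zero.2 hne)
    have hR0 : 0 ≤ R := (norm_nonneg _).trans (hR x hx)
    have h1 := hR _ (hray ((R + ‖x₀‖ + 1) / ‖x - x₀‖) (by positivity))
    have h2 := norm_sub_le (x₀ + ((R + ‖x₀‖ + 1) / ‖x - x₀‖) • (x - x₀)) x₀
    rw [add_sub_cancel_left, norm_smul, Real.norm_eq_abs, abs_of_nonneg (by positivity),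
      div_mul_cancel₀ _ hn.ne'] at h2
    linarith
  obtain ⟨ℓ₁, hℓ₁, hlt⟩ := hex
  obtain ⟨ℓ, hℓ, hmax⟩ := L.exists_max_image (fun ℓ => 1 - ℓ x / ℓ x₀) ⟨ℓ₁, hℓ₁⟩
  -- The ray leaves the half space of `ℓ` at parameter `(1 - ℓ x / ℓ x₀)⁻¹`, so the largest value of
  -- this expression belongs to the first constraint that is hit.
  set r := 1 - ℓ x / ℓ x₀ with hr
  have hr0 : 0 < r := by
    refine lt_of_lt_of_le ?_ (hmax ℓ₁ hℓ₁)
    have := (div_lt_one (hx₀ ℓ₁ hℓ₁)).2 hlt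
    linarith
  have hr1 : r ≤ 1 := by
    have := div_nonneg (hx' ℓ hℓ) (hx₀ ℓ hℓ).le
    linarith
  have hval : ∀ ℓ' ∈ L, ℓ' (x₀ + r⁻¹ • (x - x₀)) = ℓ' x₀ * (1 - r⁻¹ * (1 - ℓ' x / ℓ' x₀)) := by
    intro ℓ' hℓ'
    rw [AffineMap.apply_add_smul_sub]
    have := (hx₀ ℓ' hℓ').ne'
    field_simp
    ring
  refine ⟨ℓ, hℓ, x₀ + r⁻¹ • (x - x₀), ⟨?_, ?_⟩, r, ⟨hr0, hr1⟩, ?_⟩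
  · rw [hPL]
    intro ℓ' hℓ'
    rw [hval ℓ' hℓ']
    refine mul_nonneg (hx₀ ℓ' hℓ').le ?_
    rw [sub_nonneg, inv_mul_le_one₀ hr0]
    exact hmax ℓ' hℓ'
  · rw [hval ℓ hℓ, ← hr, inv_mul_cancel₀ hr0.ne']
    simp
  · rw [add_sub_cancel_left, smul_smul, mul_inv_cancel₀ hr0.ne', one_smul, add_sub_cancel]

variable [FiniteDimensional ℝ V]

theorem AffineMap.isOpen_pos (L : Finset (V →ᵃ[ℝ] ℝ)) : IsOpen {x : V | ∀ ℓ ∈ L, 0 < ℓ x} := by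
  have : {x : V | ∀ ℓ ∈ L, 0 < ℓ x} = ⋂ ℓ ∈ L, {x | 0 < ℓ x} := by ext; simp
  rw [this]
  exact isOpen_biInter_finset fun ℓ _ =>
    isOpen_lt continuous_const (AffineMap.continuous_of_finiteDimensional ℓ)

/-- An irredundant description of a polytope: each of the half spaces cuts out a facet. -/
theorem IsPolytope.exists_facets {P : Set V} (hP : IsPolytope P) :
    ∃ L : Finset (V →ᵃ[ℝ] ℝ), P = {x | ∀ ℓ ∈ L, 0 ≤ ℓ x} ∧
      (∀ ℓ ∈ L, ∀ x ∈ interior P, 0 < ℓ x) ∧ ∀ ℓ ∈ L, IsFacet P {x ∈ P | ℓ x = 0} := by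
  classical
  obtain ⟨hc, ⟨x₀, hx₀⟩, L₀, hL₀, hPL₀⟩ := hP
  obtain ⟨L, ⟨hL, hPL⟩, hmin⟩ := exists_minimal_of_wellFoundedLT
    (fun L : Finset (V →ᵃ[ℝ] ℝ) => (∀ ℓ ∈ L, ℓ ≠ 0) ∧ P = {x | ∀ ℓ ∈ L, 0 ≤ ℓ x}) ⟨L₀, hL₀, hPL₀⟩
  have hnn : ∀ ℓ ∈ L, ∀ x ∈ P, 0 ≤ ℓ x := fun ℓ hℓ x hx => by
    rw [hPL] at hx
    exact hx ℓ hℓ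
  have hpos : ∀ ℓ ∈ L, ∀ x ∈ interior P, 0 < ℓ x := fun ℓ hℓ x hx =>
    AffineMap.pos_of_mem_interior (hL ℓ hℓ) (hnn ℓ hℓ) hx
  refine ⟨L, hPL, hpos, fun ℓ hℓ => ?_⟩
  -- By minimality of `L` the constraint `ℓ` cannot be dropped, so some point violates it alone.
  obtain ⟨y, hy, hyℓ⟩ : ∃ y, (∀ ℓ' ∈ L.erase ℓ, 0 ≤ ℓ' y) ∧ ℓ y < 0 := by
    by_contra! hne
    have hP' : P = {x | ∀ ℓ' ∈ L.erase ℓ, 0 ≤ ℓ' x} := by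
      refine subset_antisymm (fun x hx ℓ' hℓ' => hnn ℓ' (Finset.mem_of_mem_erase hℓ') x hx) ?_
      intro x hx
      rw [hPL]
      intro ℓ' hℓ'
      by_cases h : ℓ' = ℓ
      · exact h ▸ hne x hx
      · exact hx ℓ' (Finset.mem_erase.2 ⟨h, hℓ'⟩)
    have := hmin (y := L.erase ℓ) ⟨fun ℓ' h => hL ℓ' (Finset.mem_of_mem_erase h), hP'⟩
      (Finset.erase_subset _ _) hℓ
    exact absurd rfl (Finset.mem_erase.1 this).1
  have h0 := hpos ℓ hℓ x₀ hx₀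
  set t : ℝ := ℓ x₀ / (ℓ x₀ - ℓ y) with ht
  have hd : 0 < ℓ x₀ - ℓ y := by linarith
  have ht0 : 0 < t := div_pos h0 hd
  have ht1 : t < 1 := by rw [ht, div_lt_one hd]; linarith
  -- The segment from `x₀` to `y` crosses `ℓ = 0` at `z`, where the other constraints are strict. A
  -- neighbourhood of `z` in the hyperplane therefore lies in the face, and the face spans the
  -- hyperplane.
  set z : V := x₀ + t • (y - x₀) with hz
  have hzℓ : ℓ z = 0 := by
    rw [hz, AffineMap.apply_add_smul_sub, ht]
    field_simp
    ring
  have hzpos : z ∈ {x : V | ∀ ℓ' ∈ L.erase ℓ, 0 < ℓ' x} := by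
    intro ℓ' hℓ'
    rw [hz, AffineMap.apply_add_smul_sub]
    nlinarith [hpos ℓ' (Finset.mem_of_mem_erase hℓ') x₀ hx₀, hy ℓ' hℓ']
  have hmem : ∀ x ∈ {x : V | ∀ ℓ' ∈ L.erase ℓ, 0 < ℓ' x}, ℓ x = 0 → x ∈ {x ∈ P | ℓ x = 0} := by
    intro x hx hxℓ
    refine ⟨?_, hxℓ⟩
    rw [hPL]
    intro ℓ' hℓ'
    by_cases h : ℓ' = ℓ
    · rw [h, hxℓ]
    · exact (hx ℓ' (Finset.mem_erase.2 ⟨h, hℓ'⟩)).le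
  have hzF := hmem z hzpos hzℓ
  refine ⟨⟨ℓ, hL ℓ hℓ, hnn ℓ hℓ, rfl⟩, ⟨z, hzF⟩, ?_⟩
  have hdir : (affineSpan ℝ {x ∈ P | ℓ x = 0}).direction = LinearMap.ker ℓ.linear := by
    refine le_antisymm ?_ fun v hv => ?_
    · rw [direction_affineSpan, vectorSpan_def, Submodule.span_le]
      rintro _ ⟨a, ha, b, hb, rfl⟩
      simp only [SetLike.mem_coe, LinearMap.mem_ker, AffineMap.linearMap_vsub, ha.2, hb.2,
        vsub_self]
    · have hcts : Tendsto (fun s : ℝ => z + s • v) (𝓝[>] 0) (𝓝 z) := by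
        have : Continuous fun s : ℝ => z + s • v := by fun_prop
        simpa using (this.tendsto 0).mono_left nhdsWithin_le_nhds
      obtain ⟨s, hs, hs0⟩ := ((hcts.eventually
        ((AffineMap.isOpen_pos _).mem_nhds hzpos)).and self_mem_nhdsWithin).exists
      have hsF := hmem _ hs (by
        rw [AffineMap.apply_add_smul, hzℓ, LinearMap.mem_ker.1 hv, mul_zero, add_zero])
      have h1 := AffineSubspace.vsub_mem_direction (subset_affineSpan ℝ _ hsF)
        (subset_affineSpan ℝ _ hzF)
      rw [vsub_eq_sub, add_sub_cancel_left] at h1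
      have := Submodule.smul_mem _ s⁻¹ h1
      rwa [smul_smul, inv_mul_cancel₀ (ne_of_gt hs0), one_smul] at this
  have hlin : ℓ.linear ≠ 0 := by
    intro h
    have := ℓ.apply_add_smul x₀ (y - x₀) 1
    rw [h] at this
    simp at this
    linarith
  rw [hdir, ← LinearMap.finrank_range_add_finrank_ker ℓ.linear,
    LinearMap.range_eq_top.2 (LinearMap.surjective hlin), finrank_top, Module.finrank_self, add_comm]

theorem polytopeBoundary_subset_iUnion {P : Set V} {L : Finset (V →ᵃ[ℝ] ℝ)}
    (hPL : P = {x | ∀ ℓ ∈ L, 0 ≤ ℓ x}) : polytopeBoundary P ⊆ ⋃ ℓ ∈ L, {x ∈ P | ℓ x = 0} := by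
  rintro x ⟨hxP, hxi⟩
  by_contra hne
  simp only [mem_iUnion, not_exists] at hne
  refine hxi (mem_interior.2 ⟨_, fun y hy => ?_, AffineMap.isOpen_pos L, fun ℓ hℓ => ?_⟩)
  · rw [hPL]
    exact fun ℓ hℓ => (hy ℓ hℓ).le
  · have hx := hxP
    rw [hPL] at hx
    exact lt_of_le_of_ne (hx ℓ hℓ) fun h => hne ℓ hℓ ⟨hxP, h.symm⟩

variable [MeasurableSpace V] [BorelSpace V]

theorem IsFlatMeasure.lt_top {F : Set V} {ν : Measure V} (hν : IsFlatMeasure F ν)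
    (hF : IsCompact F) : ν univ < ∞ := by
  obtain ⟨p, -, m, hm, rfl⟩ := hν
  have hemb : IsClosedEmbedding fun w : (affineSpan ℝ F).direction => (w : V) + p :=
    (Homeomorph.addRight p).isClosedEmbedding.comp
      (Submodule.closed_of_finiteDimensional _).isClosedEmbedding_subtypeVal
  rw [Measure.restrict_apply MeasurableSet.univ, univ_inter,
    hemb.measurableEmbedding.map_apply]
  exact (hemb.isCompact_preimage hF).measure_lt_top

theorem IsFlatMeasure.exists_isAddHaarMeasure {P : Set V} {μ : Measure V} (hμ : IsFlatMeasure P μ)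
    (hP : (interior P).Nonempty) : ∃ m : Measure V, m.IsAddHaarMeasure ∧ μ = m.restrict P := by
  obtain ⟨p, -, m, hm, rfl⟩ := hμ
  have htop : (affineSpan ℝ P).direction = ⊤ := by
    rw [affineSpan_eq_top_of_nonempty_interior
      (hP.mono (interior_mono (subset_convexHull ℝ P))), AffineSubspace.direction_top]
  generalize (affineSpan ℝ P).direction = D at m hm htop
  let e : D ≃L[ℝ] V := (LinearEquiv.ofTop D htop).toContinuousLinearEquiv
  refine ⟨m.map e, e.isAddHaarMeasure_map m, ?_⟩
  have h1 : (fun w : D => (w : V) + p) = (fun v => v + p) ∘ e := rfl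
  have h2 := e.isAddHaarMeasure_map m
  rw [h1, ← Measure.map_map (measurable_add_const p) e.continuous.measurable,
    map_add_right_eq_self]

/-- Flatness controls `σ` only on facets, so the boundary has to be covered by genuine facets; the
irredundant description supplies finitely many of them, each compact and hence of finite measure. -/
theorem IsFlatBoundaryMeasure.lt_top {P : Set V} {σ : Measure V} (hP : IsPolytope P)
    (hσ : IsFlatBoundaryMeasure P σ) : σ univ < ∞ := by
  obtain ⟨L, hPL, -, hL⟩ := hP.exists_facets
  have hcl : ∀ ℓ ∈ L, IsCompact {x ∈ P | ℓ x = 0} := fun ℓ _ =>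
    hP.1.inter_right (isClosed_eq (AffineMap.continuous_of_finiteDimensional ℓ) continuous_const)
  have hb : σ (polytopeBoundary P) < ∞ := by
    refine (measure_mono (polytopeBoundary_subset_iUnion hPL)).trans_lt ?_
    refine (measure_biUnion_finset_le L _).trans_lt (ENNReal.sum_lt_top.2 fun ℓ hℓ => ?_)
    have := (hσ.2 _ (hL ℓ hℓ)).lt_top (hcl ℓ hℓ)
    rwa [Measure.restrict_apply_univ] at this
  have := measure_union_le (μ := σ) (polytopeBoundary P) (polytopeBoundary P)ᶜ
  rw [union_compl_self, hσ.1, add_zero] at this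
  exact this.trans_lt hb

end Geometry

/-! ### An abstract energy-entropy system -/

/-- Energy and entropy functions on a set of states that is embedded in a complete metric space:
the energy is affine and lower semicontinuous, the entropy is uniformly concave, upper
semicontinuous and bounded below in terms of the energy. -/
structure EnergyEntropySystem {X Y : Type*} [MetricSpace Y] (U S : X → ℝ) (ι : X → Y) (e : X)
    (c C : ℝ) : Prop where
  energy_nonneg : ∀ x, 0 ≤ U x
  entropy_nonpos : ∀ x, S x ≤ 0
  entropy_top : S e = 0
  c_pos : 0 < c
  segment : ∀ x y t, 0 ≤ t → t ≤ 1 →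
    ∃ z, U z = (1 - t) * U x + t * U y ∧ (1 - t) * S x + t * S y ≤ S z
  midpoint : ∀ x y, ∃ z, U z = (U x + U y) / 2 ∧
    (S x + S y) / 2 + c * dist (ι x) (ι y) ^ 2 ≤ S z
  closed : ∀ (u : ℕ → X) (y : Y) (A : ℝ), (∀ j, U (u j) ≤ A) →
    Tendsto (fun j => ι (u j)) atTop (𝓝 y) → ∃ x, ι x = y
  energy_lsc : ∀ (u : ℕ → X) (x : X) (A : ℝ), (∀ j, U (u j) ≤ A) →
    Tendsto (fun j => ι (u j)) atTop (𝓝 (ι x)) → U x ≤ A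
  entropy_usc : ∀ (u : ℕ → X) (x : X) (A : ℝ), (∀ j, A ≤ S (u j)) →
    Tendsto (fun j => ι (u j)) atTop (𝓝 (ι x)) → A ≤ S x
  entropy_bound : ∀ x, -(C * (1 + U x)) ≤ S x

namespace EnergyEntropySystem

variable {X Y : Type*} [MetricSpace Y] {U S : X → ℝ} {ι : X → Y} {e : X} {c C : ℝ}

theorem energy_le_of_tendsto (h : EnergyEntropySystem U S ι e c C) {u : ℕ → X} {x : X} {a : ℝ}
    (hu : Tendsto (fun j => U (u j)) atTop (𝓝 a))
    (hι : Tendsto (fun j => ι (u j)) atTop (𝓝 (ι x))) : U x ≤ a := by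
  refine le_of_forall_pos_le_add fun ε hε => ?_
  obtain ⟨N, hN⟩ := eventually_atTop.1 (hu.eventually_le_const (lt_add_of_pos_right a hε))
  exact h.energy_lsc (fun j => u (j + N)) x _ (fun j => hN _ (by lia))
    (hι.comp (tendsto_add_atTop_nat N))

theorem le_entropy_of_tendsto (h : EnergyEntropySystem U S ι e c C) {u : ℕ → X} {x : X} {a : ℝ}
    (hu : Tendsto (fun j => S (u j)) atTop (𝓝 a))
    (hι : Tendsto (fun j => ι (u j)) atTop (𝓝 (ι x))) : a ≤ S x := by
  refine le_of_forall_pos_le_add fun ε hε => ?_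
  obtain ⟨N, hN⟩ := eventually_atTop.1 (hu.eventually_const_le (sub_lt_self a hε))
  have := h.entropy_usc (fun j => u (j + N)) x _ (fun j => hN _ (by lia))
    (hι.comp (tendsto_add_atTop_nat N))
  linarith

theorem entropy_eq_of_eq (h : EnergyEntropySystem U S ι e c C) {x y : X} (hxy : ι x = ι y) :
    S x = S y :=
  le_antisymm (h.le_entropy_of_tendsto (u := fun _ => x) tendsto_const_nhds (by simp [hxy]))
    (h.le_entropy_of_tendsto (u := fun _ => y) tendsto_const_nhds (by simp [hxy]))

theorem C_nonneg (h : EnergyEntropySystem U S ι e c C) : 0 ≤ C := by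
  have h1 := h.entropy_bound e
  rw [h.entropy_top] at h1
  have h2 := h.energy_nonneg e
  by_contra! hC
  nlinarith

/-- Bounded energy also bounds the entropy from below, so both numerical sequences have limits along
a subsequence; the semicontinuity axioms then compare these limits with the values at `x`. -/
theorem exists_subseq (h : EnergyEntropySystem U S ι e c C) {u : ℕ → X} {x : X} {A : ℝ}
    (hA : ∀ j, U (u j) ≤ A) (hι : Tendsto (fun j => ι (u j)) atTop (𝓝 (ι x))) :
    ∃ φ : ℕ → ℕ, StrictMono φ ∧ ∃ a b, Tendsto (fun j => U (u (φ j))) atTop (𝓝 a) ∧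
      Tendsto (fun j => S (u (φ j))) atTop (𝓝 b) ∧ U x ≤ a ∧ b ≤ S x := by
  have hb : ∀ j, (U (u j), S (u j)) ∈ Icc (0 : ℝ) A ×ˢ Icc (-(C * (1 + A))) 0 := fun j =>
    ⟨⟨h.energy_nonneg _, hA j⟩, ⟨by
      have := h.entropy_bound (u j)
      nlinarith [h.C_nonneg, hA j], h.entropy_nonpos _⟩⟩
  obtain ⟨⟨a, b⟩, -, φ, hφ, hlim⟩ := (isCompact_Icc.prod isCompact_Icc).tendsto_subseq hb
  have h1 : Tendsto (fun j => U (u (φ j))) atTop (𝓝 a) := (continuous_fst.tendsto _).comp hlim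
  have h2 : Tendsto (fun j => S (u (φ j))) atTop (𝓝 b) := (continuous_snd.tendsto _).comp hlim
  exact ⟨φ, hφ, a, b, h1, h2, h.energy_le_of_tendsto h1 (hι.comp hφ.tendsto_atTop),
    h.le_entropy_of_tendsto h2 (hι.comp hφ.tendsto_atTop)⟩

/-- The midpoint has free energy at least `m`, and uniform concavity turns the gap into a distance.
Two states whose free energies at `T > 0` are near the lower bound are therefore near each other. -/
theorem dist_sq_le (h : EnergyEntropySystem U S ι e c C) {T m : ℝ} (hT : 0 ≤ T)
    (hm : ∀ z, m ≤ U z - T * S z) (x y : X) :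
    T * (c * dist (ι x) (ι y) ^ 2) ≤ ((U x - T * S x - m) + (U y - T * S y - m)) / 2 := by
  obtain ⟨z, hz1, hz2⟩ := h.midpoint x y
  have := hm z
  nlinarith [mul_le_mul_of_nonneg_left hz2 hT]

theorem cauchySeq_of_dist_sq_le {f : ℕ → Y} {b : ℕ → ℝ} (hc : 0 < c)
    (hb : Tendsto b atTop (𝓝 0))
    (hf : ∀ j k, j ≤ k → c * dist (f j) (f k) ^ 2 ≤ b j) : CauchySeq f := by
  rw [Metric.cauchySeq_iff']
  intro ε hε
  obtain ⟨N, hN⟩ := (hb.eventually_lt_const (show (0 : ℝ) < c * ε ^ 2 by positivity)).exists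
  refine ⟨N, fun n hn => ?_⟩
  have := (hf N n hn).trans_lt hN
  rw [dist_comm]
  exact lt_of_pow_lt_pow_left₀ 2 hε.le (lt_of_mul_lt_mul_left this hc.le)

variable [CompleteSpace Y]

theorem exists_minimizer_of_pos (h : EnergyEntropySystem U S ι e c C) {T : ℝ} (hT : 0 < T) :
    ∃ x, ∀ y, U x - T * S x ≤ U y - T * S y := by
  set m := ⨅ x, (U x - T * S x) with hm
  have hbdd : BddBelow (range fun x => U x - T * S x) := ⟨0, by
    rintro _ ⟨x, rfl⟩
    nlinarith [h.energy_nonneg x, h.entropy_nonpos x]⟩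
  have hle : ∀ z, m ≤ U z - T * S z := fun z => ciInf_le hbdd z
  have : Nonempty X := ⟨e⟩
  have hex : ∀ j : ℕ, ∃ x, U x - T * S x < m + 1 / ((j : ℝ) + 1) := fun j =>
    exists_lt_of_ciInf_lt (lt_add_of_pos_right m (by positivity))
  choose u hu using hex
  have hlim : Tendsto (fun j : ℕ => 1 / ((j : ℝ) + 1)) atTop (𝓝 0) :=
    tendsto_one_div_add_atTop_nhds_zero_nat
  have hC : CauchySeq fun j => ι (u j) := by
    refine cauchySeq_of_dist_sq_le (c := T * c) (mul_pos hT h.c_pos) hlim fun j k hjk => ?_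
    have h1 := h.dist_sq_le hT.le hle (u j) (u k)
    have h2 : 1 / ((k : ℝ) + 1) ≤ 1 / ((j : ℝ) + 1) := by gcongr
    have := hu j
    have := hu k
    linarith
  -- Since `S ≤ 0` and `T > 0`, the free energy dominates the energy.
  have hA : ∀ j, U (u j) ≤ m + 1 := fun j => by
    have h2 : 1 / ((j : ℝ) + 1) ≤ 1 := by
      rw [div_le_one (by positivity)]; linarith [Nat.cast_nonneg (α := ℝ) j]
    nlinarith [hu j, h.entropy_nonpos (u j)]
  obtain ⟨y, hy⟩ := cauchySeq_tendsto_of_complete hC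
  obtain ⟨x, rfl⟩ := h.closed u y _ hA hy
  obtain ⟨φ, hφ, a, b, ha, hb, hxa, hxb⟩ := h.exists_subseq hA hy
  refine ⟨x, fun y => le_trans ?_ (hle y)⟩
  have hab : a - T * b ≤ m := by
    have h1 : Tendsto (fun j => U (u (φ j)) - T * S (u (φ j))) atTop (𝓝 (a - T * b)) :=
      ha.sub (hb.const_mul T)
    have h2 : Tendsto (fun j => m + 1 / ((φ j : ℝ) + 1)) atTop (𝓝 (m + 0)) :=
      (hlim.comp hφ.tendsto_atTop).const_add m
    simpa using le_of_tendsto_of_tendsto' h1 h2 fun j => (hu _).le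
  nlinarith

/-- At temperature zero nothing is strictly convex, so the minimizer is produced as a limit of
minimizers at positive temperatures. The second clause, stated for all minimizers at some small `T`,
later gives both the maximality of the entropy and right continuity at zero. -/
theorem exists_minimizer_zero (h : EnergyEntropySystem U S ι e c C) :
    ∃ x, (∀ y, U x ≤ U y) ∧ ∀ s : ℝ, s > S x → ∃ T > 0, ∀ z,
      (∀ y, U z - T * S z ≤ U y - T * S y) → S z < s := by
  have hpos : ∀ j : ℕ, (0 : ℝ) < 1 / ((j : ℝ) + 1) := fun j => by positivity
  choose u hu using fun j : ℕ => h.exists_minimizer_of_pos (hpos j)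
  have hlim : Tendsto (fun j : ℕ => 1 / ((j : ℝ) + 1)) atTop (𝓝 0) :=
    tendsto_one_div_add_atTop_nhds_zero_nat
  have hA : ∀ j, U (u j) ≤ U e := fun j => by
    have := hu j e
    rw [h.entropy_top] at this
    nlinarith [h.entropy_nonpos (u j), hpos j]
  -- Combine the distance estimate at the higher temperature `T` with minimality of `u k` at the
  -- lower temperature `T'`. The squared distance is then controlled by `(T - T') / T` times the
  -- entropy drop.
  have hdist : ∀ j k, j ≤ k → c * dist (ι (u j)) (ι (u k)) ^ 2 ≤ S (u j) - S (u k) := by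
    intro j k hjk
    rcases hjk.eq_or_lt with rfl | hjk
    · simp
    have hT : 1 / ((k : ℝ) + 1) < 1 / ((j : ℝ) + 1) := by gcongr
    set T := 1 / ((j : ℝ) + 1)
    set T' := 1 / ((k : ℝ) + 1)
    have hTp : 0 < T := hpos j
    have hTp' : 0 < T' := hpos k
    have h1 := h.dist_sq_le hTp.le (hu j) (u j) (u k)
    have h2 := hu k (u j)
    have hd : 0 ≤ c * dist (ι (u j)) (ι (u k)) ^ 2 := mul_nonneg h.c_pos.le (sq_nonneg _)
    have h3 : T * (c * dist (ι (u j)) (ι (u k)) ^ 2) ≤ (T - T') * (S (u j) - S (u k)) / 2 := by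
      nlinarith
    have h4 : 0 ≤ S (u j) - S (u k) := by
      by_contra! hlt
      nlinarith [mul_nonneg hTp.le hd]
    refine le_of_mul_le_mul_left (h3.trans ?_) hTp
    nlinarith
  have hanti : Antitone fun j => S (u j) := fun j k hjk => by
    have := hdist j k hjk
    have hd : 0 ≤ c * dist (ι (u j)) (ι (u k)) ^ 2 := mul_nonneg h.c_pos.le (sq_nonneg _)
    simp only
    linarith
  have hbdd : BddBelow (range fun j => S (u j)) := ⟨-(C * (1 + U e)), by
    rintro _ ⟨j, rfl⟩
    have := h.entropy_bound (u j)
    simp only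
    nlinarith [h.C_nonneg, hA j]⟩
  have hS := tendsto_atTop_ciInf hanti hbdd
  set b := ⨅ j, S (u j)
  have hC : CauchySeq fun j => ι (u j) := by
    refine cauchySeq_of_dist_sq_le (b := fun j => S (u j) - b) h.c_pos
      (by simpa using hS.sub_const b) fun j k hjk => ?_
    have := hdist j k hjk
    have : b ≤ S (u k) := ciInf_le hbdd k
    linarith
  obtain ⟨y, hy⟩ := cauchySeq_tendsto_of_complete hC
  obtain ⟨x, rfl⟩ := h.closed u y _ hA hy
  have hbx : b ≤ S x := h.le_entropy_of_tendsto hS hy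
  refine ⟨x, fun y => ?_, fun s hs => ?_⟩
  · obtain ⟨φ, hφ, a, -, ha, -, hxa, -⟩ := h.exists_subseq hA hy
    refine hxa.trans ?_
    have h2 : Tendsto (fun j => U y - 1 / ((φ j : ℝ) + 1) * S y) atTop (𝓝 (U y - 0 * S y)) :=
      ((hlim.comp hφ.tendsto_atTop).mul_const _).const_sub _
    have := le_of_tendsto_of_tendsto' ha h2 fun j => by
      have := hu (φ j) y
      nlinarith [h.entropy_nonpos (u (φ j)), hpos (φ j)]
    simpa using this
  · obtain ⟨j, hj⟩ := (hS.eventually_lt_const (hbx.trans_lt hs)).exists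
    refine ⟨_, hpos j, fun z hz => ?_⟩
    have h1 := h.dist_sq_le (hpos j).le (hu j) (u j) z
    have h2 := hz (u j)
    -- Two minimizers at the same positive temperature have the same image under `ι`, hence the same
    -- entropy, so the bound known for `u j` holds for every minimizer.
    have : dist (ι (u j)) (ι z) = 0 := by
      have : 1 / ((j : ℝ) + 1) * (c * dist (ι (u j)) (ι z) ^ 2) ≤ 0 := by linarith
      have h3 : c * dist (ι (u j)) (ι z) ^ 2 ≤ 0 := by
        by_contra! h4
        nlinarith [mul_pos (hpos j) h4]
      have h4 : dist (ι (u j)) (ι z) ^ 2 ≤ 0 := by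
        by_contra! h4
        nlinarith [mul_pos h.c_pos h4]
      exact pow_eq_zero_iff two_ne_zero |>.1 (le_antisymm h4 (sq_nonneg _))
    rw [← h.entropy_eq_of_eq (dist_eq_zero.1 this)]
    exact hj

/-- The minimizers of the free energy, of maximal entropy among those of minimal energy at
temperature `0`. -/
theorem exists_minimizers (h : EnergyEntropySystem U S ι e c C) :
    ∃ M : ℝ → X, (∀ T, 0 ≤ T → ∀ y, U (M T) - T * S (M T) ≤ U y - T * S y) ∧
      (∀ T, 0 ≤ T → ∀ y, U y ≤ U (M T) → S y ≤ S (M T)) ∧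
      ∀ s, S (M 0) < s → ∃ T > 0, S (M T) < s := by
  obtain ⟨x, hx1, hx2⟩ := h.exists_minimizer_zero
  have : Nonempty X := ⟨e⟩
  choose! m hm using fun (T : ℝ) (hT : 0 < T) => h.exists_minimizer_of_pos hT
  refine ⟨fun T => if 0 < T then m T else x, fun T hT y => ?_, fun T hT y hy => ?_, fun s hs => ?_⟩
  · rcases hT.eq_or_lt with rfl | hT
    · simpa using hx1 y
    · simpa [hT] using hm T hT y
  · rcases hT.eq_or_lt with rfl | hT
    · simp only [lt_irrefl, if_false] at hy ⊢
      -- A state `y` of minimal energy with more entropy than `x` would, at a small `T > 0`, have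
      -- smaller free energy than the minimizer there.
      by_contra! hlt
      obtain ⟨T, hT, hz⟩ := hx2 _ hlt
      have h1 := hz (m T) (hm T hT)
      have h2 := hm T hT y
      have h3 := hx1 (m T)
      nlinarith
    · simp only [hT, if_true] at hy ⊢
      have h2 := hm T hT y
      by_contra! hlt
      nlinarith
  · simp only [lt_irrefl, if_false] at hs
    obtain ⟨T, hT, hz⟩ := hx2 _ hs
    exact ⟨T, hT, by simpa [hT] using hz _ (hm T hT)⟩

end EnergyEntropySystem

/-! ### Families of minimizers and the derivative of the minimal free energy. -/

namespace EnergyEntropySystem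

variable {X Y : Type*} [MetricSpace Y] {U S : X → ℝ} {ι : X → Y} {e : X} {c C : ℝ}

/-- A choice of free energy minimizers, of maximal entropy among the states of at most their
energy, with entropy right continuous at temperature `0`. -/
structure IsMinimizerFamily (U S : X → ℝ) (M : ℝ → X) : Prop where
  le : ∀ T, 0 ≤ T → ∀ y, U (M T) - T * S (M T) ≤ U y - T * S y
  entropy_le : ∀ T, 0 ≤ T → ∀ y, U y ≤ U (M T) → S y ≤ S (M T)
  right_zero : ∀ s, S (M 0) < s → ∃ T > 0, S (M T) < s

variable {M : ℝ → X}

/-- Adding the minimality inequalities at `T` and `T'` leaves `(T' - T) (S (M T') - S (M T)) ≥ 0`.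
-/
theorem IsMinimizerFamily.monotoneOn (hM : IsMinimizerFamily U S M) :
    MonotoneOn (fun T => S (M T)) (Ici 0) := by
  intro T hT T' hT' hTT'
  rcases hTT'.eq_or_lt with rfl | hlt
  · exact le_rfl
  have h1 := hM.le T hT (M T')
  have h2 := hM.le T' hT' (M T)
  by_contra! h3
  nlinarith

theorem IsMinimizerFamily.energy_le (hM : IsMinimizerFamily U S M)
    (h : EnergyEntropySystem U S ι e c C) {T : ℝ} (hT : 0 ≤ T) : U (M T) ≤ U e := by
  have h1 := hM.le T hT e
  rw [h.entropy_top] at h1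
  nlinarith [h.entropy_nonpos (M T)]

/-- At zero, monotonicity and `right_zero` suffice. At `T₀ > 0`, minimizers at nearby temperatures
are almost minimizers at `T₀`, hence converge after embedding. Semicontinuity gives only one
inequality for the entropy; the limit of the minimality relation gives the other. -/
theorem IsMinimizerFamily.continuousOn_entropy (hM : IsMinimizerFamily U S M)
    (h : EnergyEntropySystem U S ι e c C) : ContinuousOn (fun T => S (M T)) (Ici 0) := by
  intro T₀ hT₀
  rcases (mem_Ici.1 hT₀).eq_or_lt with rfl | hpos
  · refine Metric.tendsto_nhds.2 fun ε hε => ?_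
    obtain ⟨T₁, hT₁, hs⟩ := hM.right_zero (S (M 0) + ε) (by linarith)
    filter_upwards [Ico_mem_nhdsGE hT₁] with T hT
    have h1 := hM.monotoneOn hT₀ (mem_Ici.2 hT.1) hT.1
    have h2 := hM.monotoneOn (mem_Ici.2 hT.1) (mem_Ici.2 hT₁.le) hT.2.le
    simp only at h1 h2
    rw [Real.dist_eq, abs_lt]
    constructor <;> linarith
  refine tendsto_iff_seq_tendsto.2 fun t ht => ?_
  have ht0 : Tendsto t atTop (𝓝 T₀) := ht.mono_right nhdsWithin_le_nhds
  have htm : ∀ᶠ j in atTop, t j ∈ Ici (0 : ℝ) := ht.eventually self_mem_nhdsWithin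
  refine tendsto_of_subseq_tendsto fun ns hns => ?_
  obtain ⟨N, hN⟩ := eventually_atTop.1 (hns.eventually htm)
  set r : ℕ → ℝ := fun j => t (ns (j + N)) with hr
  have hr0 : ∀ j, 0 ≤ r j := fun j => hN _ (by lia)
  have hrlim : Tendsto r atTop (𝓝 T₀) := ht0.comp (hns.comp (tendsto_add_atTop_nat N))
  have hA : ∀ j, U (M (r j)) ≤ U e := fun j => hM.energy_le h (hr0 j)
  have hS : ∀ x, U x ≤ U e → |S x| ≤ C * (1 + U e) := fun x hx => by
    rw [abs_le]
    have h1 := h.entropy_bound x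
    have h2 := h.entropy_nonpos x
    have h3 := h.C_nonneg
    constructor <;> nlinarith [h.energy_nonneg e]
  -- By minimality at `r j`, the excess free energy of `M (r j)` at `T₀` is at most `(r j - T₀) (S
  -- (M (r j)) - S (M T₀))`, and energies below `U e` keep the entropies bounded.
  have hle : ∀ j, T₀ * (c * dist (ι (M (r j))) (ι (M T₀)) ^ 2) ≤
      |r j - T₀| * (C * (1 + U e)) := by
    intro j
    have h1 := h.dist_sq_le hpos.le (hM.le T₀ hpos.le) (M (r j)) (M T₀)
    have h2 := hM.le (r j) (hr0 j) (M T₀)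
    have h3 : (r j - T₀) * (S (M (r j)) - S (M T₀)) ≤ |r j - T₀| * (2 * (C * (1 + U e))) := by
      refine (le_abs_self _).trans ?_
      rw [abs_mul]
      gcongr
      refine (abs_sub _ _).trans ?_
      linarith [hS _ (hA j), hS _ (hM.energy_le h hpos.le)]
    linarith
  have hd : Tendsto (fun j => ι (M (r j))) atTop (𝓝 (ι (M T₀))) := by
    rw [tendsto_iff_dist_tendsto_zero]
    have h0 : Tendsto (fun j => |r j - T₀| * (C * (1 + U e)) / (T₀ * c)) atTop (𝓝 0) := by
      have : Tendsto (fun j => |r j - T₀|) atTop (𝓝 0) := by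
        simpa using (hrlim.sub_const T₀).abs
      simpa using (this.mul_const (C * (1 + U e))).div_const (T₀ * c)
    have h1 : Tendsto (fun j => dist (ι (M (r j))) (ι (M T₀)) ^ 2) atTop (𝓝 0) :=
      squeeze_zero (fun _ => sq_nonneg _) (fun j => by
        rw [le_div_iff₀ (mul_pos hpos h.c_pos)]
        linarith [hle j]) h0
    simpa [Real.sqrt_sq dist_nonneg] using h1.sqrt
  obtain ⟨φ, hφ, a, b, ha, hb, hxa, hxb⟩ := h.exists_subseq hA hd
  refine ⟨fun j => φ j + N, ?_⟩
  have hF : a - T₀ * b ≤ U (M T₀) - T₀ * S (M T₀) :=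
    le_of_tendsto_of_tendsto' (ha.sub ((hrlim.comp hφ.tendsto_atTop).mul hb))
      ((((hrlim.comp hφ.tendsto_atTop).mul_const (S (M T₀)))).const_sub (U (M T₀)))
      fun j => hM.le _ (hr0 _) _
  -- From `U (M T₀) ≤ a` and `a - T₀ b ≤ U (M T₀) - T₀ S (M T₀)` one gets `S (M T₀) ≤ b`, since `T₀
  -- > 0`.
  have : S (M T₀) = b := by nlinarith
  rw [← this] at hb
  exact hb

/-- Envelope argument: testing each minimizer at the other temperature bounds the error of the
linear approximation by `|T' - T| |S (M T') - S (M T)|`, which is `o(T' - T)` by continuity of the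
entropy. -/
theorem IsMinimizerFamily.hasDerivWithinAt (hM : IsMinimizerFamily U S M)
    (h : EnergyEntropySystem U S ι e c C) {T : ℝ} (hT : 0 ≤ T) :
    HasDerivWithinAt (fun T => U (M T) - T * S (M T)) (-S (M T)) (Ici 0) T := by
  rw [hasDerivWithinAt_iff_isLittleO, Asymptotics.isLittleO_iff]
  intro ε hε
  filter_upwards [Metric.tendsto_nhds.1 (hM.continuousOn_entropy h T hT) ε hε,
    self_mem_nhdsWithin] with T' hT' hT0
  have h1 := hM.le T hT (M T')
  have h2 := hM.le T' hT0 (M T)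
  rw [Real.dist_eq] at hT'
  rw [smul_eq_mul, Real.norm_eq_abs, Real.norm_eq_abs]
  calc _ ≤ |(T' - T) * (S (M T') - S (M T))| := by
        have h3 : 0 ≤ (T' - T) * (S (M T') - S (M T)) := by nlinarith
        rw [abs_of_nonneg h3, abs_le]
        constructor <;> nlinarith
    _ ≤ ε * |T' - T| := by
        rw [abs_mul, mul_comm]
        gcongr

theorem IsMinimizerFamily.contDiffOn (hM : IsMinimizerFamily U S M)
    (h : EnergyEntropySystem U S ι e c C) :
    ContDiffOn ℝ 1 (fun T => U (M T) - T * S (M T)) (Ici 0) := by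
  rw [contDiffOn_one_iff_derivWithin (uniqueDiffOn_Ici 0)]
  refine ⟨fun T hT => (hM.hasDerivWithinAt h hT).differentiableWithinAt, ?_⟩
  refine (hM.continuousOn_entropy h).neg.congr fun T hT => ?_
  exact (hM.hasDerivWithinAt h hT).derivWithin (uniqueDiffOn_Ici 0 T hT)

/-! ### The equilibrium entropy -/

/-- The supremum of the entropy over the states of a given energy. -/
def supEntropy (U S : X → ℝ) (E : ℝ) : EReal := ⨆ (x : X) (_ : U x = E), (S x : EReal)

theorem le_supEntropy (x : X) : (S x : EReal) ≤ supEntropy U S (U x) :=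
  le_iSup₂ (f := fun y (_ : U y = U x) => (S y : EReal)) x rfl

theorem supEntropy_nonpos (h : EnergyEntropySystem U S ι e c C) (E : ℝ) :
    supEntropy U S E ≤ 0 :=
  iSup₂_le fun x _ => by exact_mod_cast h.entropy_nonpos x

theorem exists_energy_eq (h : EnergyEntropySystem U S ι e c C) {x y : X} {E : ℝ}
    (hE : E ∈ Icc (U x) (U y)) : ∃ z, U z = E := by
  rcases hE.1.eq_or_lt with heq | hlt
  · exact ⟨x, heq⟩
  have hpos : 0 < U y - U x := by linarith [hE.2]
  obtain ⟨z, hz, -⟩ := h.segment x y ((E - U x) / (U y - U x))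
    (div_nonneg (by linarith) hpos.le) ((div_le_one hpos).2 (by linarith [hE.2]))
  refine ⟨z, hz.trans ?_⟩
  field_simp
  ring

theorem coe_toReal_supEntropy (h : EnergyEntropySystem U S ι e c C) (x : X) :
    ((supEntropy U S (U x)).toReal : EReal) = supEntropy U S (U x) := by
  refine EReal.coe_toReal (fun htop => ?_) fun hbot => ?_
  · have := supEntropy_nonpos h (U x)
    rw [htop] at this
    exact absurd this (by simp)
  · have := le_supEntropy (U := U) (S := S) x
    rw [hbot] at this
    simp at this

theorem le_toReal_supEntropy (h : EnergyEntropySystem U S ι e c C) (x : X) :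
    S x ≤ (supEntropy U S (U x)).toReal := by
  rw [← EReal.coe_le_coe_iff, coe_toReal_supEntropy h]
  exact le_supEntropy x

theorem toReal_supEntropy_le (h : EnergyEntropySystem U S ι e c C) {x : X} {a : ℝ}
    (ha : ∀ y, U y = U x → S y ≤ a) : (supEntropy U S (U x)).toReal ≤ a := by
  rw [← EReal.coe_le_coe_iff, coe_toReal_supEntropy h]
  exact iSup₂_le fun y hy => by exact_mod_cast ha y hy

theorem exists_lt_entropy (h : EnergyEntropySystem U S ι e c C) {x : X} {a : ℝ}
    (ha : a < (supEntropy U S (U x)).toReal) : ∃ y, U y = U x ∧ a < S y := by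
  by_contra! hne
  exact absurd (toReal_supEntropy_le h hne) (not_le.2 ha)

/-- The supremum need not be attained, so states within `ε` of it are mixed; energy is affine along
the mixture and entropy concave. -/
theorem concave_supEntropy (h : EnergyEntropySystem U S ι e c C) (x y : X) {t : ℝ}
    (ht0 : 0 ≤ t) (ht1 : t ≤ 1) :
    (1 - t) * (supEntropy U S (U x)).toReal + t * (supEntropy U S (U y)).toReal ≤
      (supEntropy U S ((1 - t) * U x + t * U y)).toReal := by
  refine le_of_forall_pos_le_add fun ε hε => ?_
  obtain ⟨x', hx', hx⟩ := exists_lt_entropy h (sub_lt_self (supEntropy U S (U x)).toReal hε)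
  obtain ⟨y', hy', hy⟩ := exists_lt_entropy h (sub_lt_self (supEntropy U S (U y)).toReal hε)
  obtain ⟨z, hz, hz'⟩ := h.segment x' y' t ht0 ht1
  have := le_toReal_supEntropy h z
  rw [hz, hx', hy'] at this
  nlinarith

/-- Here the supremum is attained. At `T = 0` minimality of the free energy alone would not give
this; the choice of maximal entropy does. -/
theorem IsMinimizerFamily.supEntropy_eq (hM : IsMinimizerFamily U S M) {T : ℝ} (hT : 0 ≤ T) :
    supEntropy U S (U (M T)) = S (M T) :=
  le_antisymm (iSup₂_le fun y hy => by exact_mod_cast hM.entropy_le T hT y hy.le)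
    (le_supEntropy _)

theorem concaveOn_supEntropy (h : EnergyEntropySystem U S ι e c C) (x : X) :
    ConcaveOn ℝ (Icc (U x) (U e)) fun E => (supEntropy U S E).toReal := by
  refine ⟨convex_Icc _ _, fun E hE E' hE' a b ha hb hab => ?_⟩
  obtain ⟨y, rfl⟩ := h.exists_energy_eq hE
  obtain ⟨y', rfl⟩ := h.exists_energy_eq hE'
  obtain rfl : a = 1 - b := by linarith
  simpa using concave_supEntropy h y y' hb (by linarith)

/-- If the supremum were `0`, states of energy `U x` with entropy tending to `0` would converge to
`e`: otherwise the midpoint with `e` would have positive entropy. Lower semicontinuity then gives `U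
e ≤ U x`. This strictness makes the one-sided derivatives positive below `U e`. -/
theorem toReal_supEntropy_neg (h : EnergyEntropySystem U S ι e c C) {x : X} (hx : U x < U e) :
    (supEntropy U S (U x)).toReal < 0 := by
  by_contra! hge
  have hpos : ∀ j : ℕ, (0 : ℝ) < 1 / ((j : ℝ) + 1) := fun j => by positivity
  choose u hu1 hu2 using fun j : ℕ =>
    exists_lt_entropy h (x := x) (a := 0 - 1 / ((j : ℝ) + 1)) (by linarith [hpos j])
  have hlim : Tendsto (fun j : ℕ => 1 / ((j : ℝ) + 1)) atTop (𝓝 0) :=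
    tendsto_one_div_add_atTop_nhds_zero_nat
  have hd : Tendsto (fun j => ι (u j)) atTop (𝓝 (ι e)) := by
    rw [tendsto_iff_dist_tendsto_zero]
    have h1 : Tendsto (fun j => dist (ι (u j)) (ι e) ^ 2) atTop (𝓝 0) := by
      refine squeeze_zero (g := fun j : ℕ => 1 / ((j : ℝ) + 1) / c)
        (fun _ => sq_nonneg _) (fun j => ?_) (by simpa using hlim.div_const c)
      obtain ⟨z, -, hz⟩ := h.midpoint (u j) e
      rw [le_div_iff₀ h.c_pos]
      have := h.entropy_nonpos z
      rw [h.entropy_top] at hz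
      linarith [hu2 j, hpos j]
    simpa [Real.sqrt_sq dist_nonneg] using h1.sqrt
  linarith [h.energy_lsc u e (U x) (fun j => (hu1 j).le) hd]

end EnergyEntropySystem

/-! ### Temperatures and one-sided derivatives of the equilibrium entropy. -/

theorem EReal.le_inv_iff_le_inv {b : EReal} {T : ℝ} (hb : 0 < b) (hT : 0 < T) :
    (T : EReal) ≤ b⁻¹ ↔ b ≤ (T⁻¹ : ℝ) := by
  induction b with
  | bot => simp at hb
  | top =>
    simp only [EReal.inv_top, EReal.coe_nonpos, top_le_iff, EReal.coe_ne_top, iff_false, not_le]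
    exact hT
  | coe b =>
    rw [← EReal.coe_inv, EReal.coe_le_coe_iff, EReal.coe_le_coe_iff]
    exact le_inv_comm₀ hT (by exact_mod_cast hb)

theorem EReal.inv_le_iff_inv_le {b : EReal} {T : ℝ} (hb : 0 < b) (hT : 0 < T) :
    b⁻¹ ≤ (T : EReal) ↔ ((T⁻¹ : ℝ) : EReal) ≤ b := by
  induction b with
  | bot => simp at hb
  | top => simp [hT.le]
  | coe b =>
    rw [← EReal.coe_inv, EReal.coe_le_coe_iff, EReal.coe_le_coe_iff]
    exact inv_le_comm₀ (by exact_mod_cast hb) hT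

theorem EReal.inv_nonpos_iff_eq_top {b : EReal} (hb : 0 < b) : b⁻¹ ≤ 0 ↔ b = ⊤ := by
  induction b with
  | bot => simp at hb
  | top => simp
  | coe b =>
    have : (0 : ℝ) < b := by exact_mod_cast hb
    rw [← EReal.coe_inv, EReal.coe_nonpos]
    simp [this]

/-- The difference quotient of an extended real function. -/
def erealSlope (g : ℝ → EReal) (E E' : ℝ) : EReal := (g E' - g E) / ((E' - E : ℝ) : EReal)

namespace EnergyEntropySystem

variable {X Y : Type*} [MetricSpace Y] {U S : X → ℝ} {ι : X → Y} {e : X} {c C : ℝ}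
variable {M : ℝ → X}

theorem erealSlope_eq_coe (h : EnergyEntropySystem U S ι e c C) {x : X} {E E' : ℝ}
    (hE : E ∈ Icc (U x) (U e)) (hE' : E' ∈ Icc (U x) (U e)) :
    erealSlope (supEntropy U S) E E' =
      (slope (fun E => (supEntropy U S E).toReal) E E' : ℝ) := by
  obtain ⟨y, rfl⟩ := h.exists_energy_eq hE
  obtain ⟨y', rfl⟩ := h.exists_energy_eq hE'
  rw [erealSlope, ← coe_toReal_supEntropy h y, ← coe_toReal_supEntropy h y', slope_def_field]
  norm_cast

/-- Concavity makes difference quotients antitone, so the one-sided limit exists as a supremum in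
`EReal`, where it may be `⊤`. -/
theorem tendsto_slope_right (h : EnergyEntropySystem U S ι e c C) {x : X} {E : ℝ}
    (hE : E ∈ Ico (U x) (U e)) :
    Tendsto (erealSlope (supEntropy U S) E) (𝓝[>] E)
      (𝓝 (sSup (erealSlope (supEntropy U S) E '' Ioo E (U e)))) := by
  refine AntitoneOn.tendsto_nhdsWithin_Ioo_right (nonempty_Ioo.2 hE.2) (fun a ha b hb hab => ?_)
    (OrderTop.bddAbove _)
  have hmem : ∀ a ∈ Ioo E (U e), a ∈ Icc (U x) (U e) := fun a ha =>
    ⟨hE.1.trans ha.1.le, ha.2.le⟩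
  rw [erealSlope_eq_coe h (Ico_subset_Icc_self hE) (hmem a ha),
    erealSlope_eq_coe h (Ico_subset_Icc_self hE) (hmem b hb), EReal.coe_le_coe_iff]
  exact (concaveOn_supEntropy h x).slope_anti (Ico_subset_Icc_self hE)
    ⟨hmem a ha, ha.1.ne'⟩ ⟨hmem b hb, hb.1.ne'⟩ hab

theorem tendsto_slope_left (h : EnergyEntropySystem U S ι e c C) {x : X} {E : ℝ}
    (hE : E ∈ Ioo (U x) (U e)) :
    Tendsto (erealSlope (supEntropy U S) E) (𝓝[<] E)
      (𝓝 (sInf (erealSlope (supEntropy U S) E '' Ioo (U x) E))) := by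
  refine AntitoneOn.tendsto_nhdsWithin_Ioo_left (nonempty_Ioo.2 hE.1) (fun a ha b hb hab => ?_)
    (OrderBot.bddBelow _)
  have hmem : ∀ a ∈ Ioo (U x) E, a ∈ Icc (U x) (U e) := fun a ha =>
    ⟨ha.1.le, ha.2.le.trans hE.2.le⟩
  rw [erealSlope_eq_coe h (Ioo_subset_Icc_self hE) (hmem a ha),
    erealSlope_eq_coe h (Ioo_subset_Icc_self hE) (hmem b hb), EReal.coe_le_coe_iff]
  exact (concaveOn_supEntropy h x).slope_anti (Ioo_subset_Icc_self hE)
    ⟨hmem a ha, ha.2.ne⟩ ⟨hmem b hb, hb.2.ne⟩ hab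

/-- Below the minimal energy the supremum is over no states, so the quotient is `-∞` divided by a
negative number. -/
theorem tendsto_slope_left_min {x : X} (hx : ∀ y, U x ≤ U y) :
    Tendsto (erealSlope (supEntropy U S) (U x)) (𝓝[<] (U x)) (𝓝 ⊤) := by
  refine tendsto_const_nhds.congr' ?_
  filter_upwards [self_mem_nhdsWithin] with E hE
  have : supEntropy U S E = ⊥ := by
    rw [supEntropy, iSup₂_eq_bot]
    rintro y rfl
    exact absurd (hx y) (not_le.2 hE)
  rw [erealSlope, this, EReal.bot_sub, EReal.bot_div_of_neg_ne_bot]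
  · exact_mod_cast sub_neg.2 hE
  · exact EReal.coe_ne_bot _

/-- By concavity the slope is at least the slope to the endpoint `U e`, where the value rises from a
negative number to at least `S e = 0`. -/
theorem slope_pos (h : EnergyEntropySystem U S ι e c C) {x : X} {E E' : ℝ}
    (hE : E ∈ Ico (U x) (U e)) (hE' : E' ∈ Ioo E (U e)) :
    0 < slope (fun E => (supEntropy U S E).toReal) E E' := by
  obtain ⟨y, rfl⟩ := h.exists_energy_eq (Ico_subset_Icc_self hE)
  have h1 : slope (fun E => (supEntropy U S E).toReal) (U y) (U e) ≤
      slope (fun E => (supEntropy U S E).toReal) (U y) E' :=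
    (concaveOn_supEntropy h x).slope_anti (Ico_subset_Icc_self hE)
      ⟨⟨hE.1.trans hE'.1.le, hE'.2.le⟩, hE'.1.ne'⟩
      ⟨⟨hE.1.trans hE.2.le, le_rfl⟩, hE.2.ne'⟩ hE'.2.le
  refine lt_of_lt_of_le ?_ h1
  rw [slope_def_field]
  have h2 := toReal_supEntropy_neg h hE.2
  have h3 := le_toReal_supEntropy h e
  rw [h.entropy_top] at h3
  exact div_pos (by linarith) (by linarith [hE.2])

theorem betaRight_pos (h : EnergyEntropySystem U S ι e c C) {x : X} {E : ℝ}
    (hE : E ∈ Ico (U x) (U e)) :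
    0 < sSup (erealSlope (supEntropy U S) E '' Ioo E (U e)) := by
  obtain ⟨E', hE'⟩ := nonempty_Ioo.2 hE.2
  refine lt_of_lt_of_le ?_ (le_sSup (mem_image_of_mem _ hE'))
  rw [erealSlope_eq_coe h (Ico_subset_Icc_self hE) ⟨hE.1.trans hE'.1.le, hE'.2.le⟩]
  exact_mod_cast slope_pos h hE hE'

theorem betaLeft_pos (h : EnergyEntropySystem U S ι e c C) {x : X} {E : ℝ}
    (hE : E ∈ Ioo (U x) (U e)) :
    0 < sInf (erealSlope (supEntropy U S) E '' Ioo (U x) E) := by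
  obtain ⟨E', hE'⟩ := nonempty_Ioo.2 hE.2
  refine lt_of_lt_of_le (b := ((slope (fun E => (supEntropy U S E).toReal) E E' : ℝ) : EReal))
    (by exact_mod_cast slope_pos h (Ioo_subset_Ico_self hE) hE') (le_sInf ?_)
  rintro _ ⟨E'', hE'', rfl⟩
  rw [erealSlope_eq_coe h (Ioo_subset_Icc_self hE) ⟨hE''.1.le, hE''.2.le.trans hE.2.le⟩,
    EReal.coe_le_coe_iff]
  exact (concaveOn_supEntropy h x).slope_anti (Ioo_subset_Icc_self hE)
    ⟨⟨hE''.1.le, hE''.2.le.trans hE.2.le⟩, hE''.2.ne⟩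
    ⟨⟨hE.1.le.trans hE'.1.le, hE'.2.le⟩, hE'.1.ne'⟩ (hE''.2.le.trans hE'.1.le)

/-- The temperatures between the inverses of the left and of the right derivative. -/
def temperatures (g : ℝ → EReal) (E : ℝ) : Set ℝ :=
  {T | (limUnder (𝓝[<] E) (erealSlope g E))⁻¹ ≤ (T : EReal) ∧
    (T : EReal) ≤ (limUnder (𝓝[>] E) (erealSlope g E))⁻¹}

/-- Minimality of `M T` says that the line of slope `T⁻¹` through its energy and entropy lies above
the graph of `supEntropy`, so `T⁻¹` separates left from right slopes. At the minimal energy, in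
particular for `T = 0`, the left derivative is `⊤`. -/
theorem IsMinimizerFamily.mem_temperatures (hM : IsMinimizerFamily U S M)
    (h : EnergyEntropySystem U S ι e c C) {T : ℝ} (hT : 0 ≤ T) (hlt : U (M T) < U e) :
    T ∈ temperatures (supEntropy U S) (U (M T)) := by
  have hmin : ∀ y, U (M 0) ≤ U y := fun y => by simpa using hM.le 0 le_rfl y
  have hE : U (M T) ∈ Ico (U (M 0)) (U e) := ⟨hmin _, hlt⟩
  have hR := betaRight_pos h hE
  rw [temperatures, mem_ofPred_eq, (tendsto_slope_right h hE).limUnder_eq]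
  rcases hT.eq_or_lt with rfl | hT'
  · rw [(tendsto_slope_left_min hmin).limUnder_eq]
    exact ⟨by simp, EReal.inv_nonneg_of_nonneg hR.le⟩
  have key : ∀ E' ∈ Icc (U (M 0)) (U e), (supEntropy U S E').toReal ≤
      (supEntropy U S (U (M T))).toReal + T⁻¹ * (E' - U (M T)) := by
    intro E' hE'
    obtain ⟨y, rfl⟩ := h.exists_energy_eq hE'
    refine toReal_supEntropy_le h fun z hz => ?_
    rw [hM.supEntropy_eq hT, EReal.toReal_coe, ← hz]
    have := hM.le T hT z
    rw [inv_mul_eq_div, ← sub_le_iff_le_add', le_div_iff₀ hT']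
    linarith
  constructor
  · rcases (hmin (M T)).eq_or_lt with heq | hlt'
    · rw [(tendsto_slope_left_min (x := M T) fun y => heq ▸ hmin y).limUnder_eq]
      simp [hT]
    · have hE' : U (M T) ∈ Ioo (U (M 0)) (U e) := ⟨hlt', hlt⟩
      rw [(tendsto_slope_left h hE').limUnder_eq,
        EReal.inv_le_iff_inv_le (betaLeft_pos h hE') hT']
      refine le_sInf ?_
      rintro _ ⟨E', hE'', rfl⟩
      have hmem : E' ∈ Icc (U (M 0)) (U e) := ⟨hE''.1.le, hE''.2.le.trans hlt.le⟩
      rw [erealSlope_eq_coe h (Ico_subset_Icc_self hE) hmem, EReal.coe_le_coe_iff,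
        slope_def_field, le_div_iff_of_neg (sub_neg.2 hE''.2)]
      linarith [key E' hmem]
  · rw [EReal.le_inv_iff_le_inv hR hT']
    refine sSup_le ?_
    rintro _ ⟨E', hE'', rfl⟩
    have hmem : E' ∈ Icc (U (M 0)) (U e) := ⟨hE.1.trans hE''.1.le, hE''.2.le⟩
    rw [erealSlope_eq_coe h (Ico_subset_Icc_self hE) hmem, EReal.coe_le_coe_iff,
      slope_def_field, div_le_iff₀ (sub_pos.2 hE''.1)]
    linarith [key E' hmem]

/-- The supremum at energy `U x` need not be attained, so uniqueness of minimizers cannot be used.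
Instead the affine function `T' ↦ U x - T' G` lies above the minimal free energy and touches it at
`T`. Differentiability forces equal slopes `G = S (M T)`, hence equal energies. -/
theorem IsMinimizerFamily.eq_of_isMin (hM : IsMinimizerFamily U S M)
    (h : EnergyEntropySystem U S ι e c C) {T : ℝ} (hT : 0 < T) {x : X}
    (hE : U x - T * (supEntropy U S (U x)).toReal ≤ U (M T) - T * S (M T)) : U x = U (M T) := by
  set G := (supEntropy U S (U x)).toReal with hG
  have hle : ∀ T', 0 ≤ T' → U (M T') - T' * S (M T') ≤ U x - T' * G := by
    intro T' hT'
    rcases hT'.eq_or_lt with rfl | hpos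
    · simpa using hM.le 0 le_rfl x
    have : G ≤ (U x - (U (M T') - T' * S (M T'))) / T' := toReal_supEntropy_le h fun y hy => by
      rw [le_div_iff₀ hpos, ← hy]
      linarith [hM.le T' hT' y]
    rw [le_div_iff₀ hpos] at this
    linarith
  have hmin : IsLocalMin (fun T' => (U x - T' * G) - (U (M T') - T' * S (M T'))) T := by
    filter_upwards [Ici_mem_nhds hT] with T' hT'
    linarith [hle T' hT', hle T hT.le]
  have hd : HasDerivAt (fun T' => (U x - T' * G) - (U (M T') - T' * S (M T')))
      (-(1 * G) - -S (M T)) T :=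
    (((hasDerivAt_id T).mul_const G).const_sub (U x)).sub
      ((hM.hasDerivWithinAt h hT.le).hasDerivAt (Ici_mem_nhds hT))
  have := hmin.hasDerivAt_eq_zero hd
  have hGS : G = S (M T) := by linarith
  rw [hGS] at hE hle
  linarith [hle T hT.le]

/-- For `T > 0`, concavity upgrades the two derivative bounds to a global supporting line of slope
`T⁻¹` at `E`, so `E` minimizes `E - T S^eq(E)` and `eq_of_isMin` applies. -/
theorem IsMinimizerFamily.eq_of_mem_temperatures (hM : IsMinimizerFamily U S M)
    (h : EnergyEntropySystem U S ι e c C) {T E : ℝ} (hT : 0 ≤ T) (hE : E ∈ Ico (U (M 0)) (U e))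
    (hTE : T ∈ temperatures (supEntropy U S) E) : E = U (M T) := by
  have hmin : ∀ y, U (M 0) ≤ U y := fun y => by simpa using hM.le 0 le_rfl y
  have hR := betaRight_pos h hE
  rw [temperatures, mem_ofPred_eq, (tendsto_slope_right h hE).limUnder_eq] at hTE
  obtain ⟨hL', hR'⟩ := hTE
  have hEc := Ico_subset_Icc_self hE
  have hanti := (concaveOn_supEntropy h (M 0)).slope_anti hEc
  rcases hT.eq_or_lt with rfl | hpos
  -- For `T = 0` the left derivative would be infinite, but above the minimal energy it is bounded
  -- by any difference quotient to the left, which is finite.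
  · by_contra hne
    have hE' : E ∈ Ioo (U (M 0)) (U e) := ⟨lt_of_le_of_ne hE.1 (Ne.symm hne), hE.2⟩
    rw [(tendsto_slope_left h hE').limUnder_eq, EReal.coe_zero,
      EReal.inv_nonpos_iff_eq_top (betaLeft_pos h hE')] at hL'
    obtain ⟨E', hE''⟩ := nonempty_Ioo.2 hE'.1
    have hle : sInf (erealSlope (supEntropy U S) E '' Ioo (U (M 0)) E) ≤
      erealSlope (supEntropy U S) E E' := sInf_le (mem_image_of_mem _ hE'')
    rw [hL', erealSlope_eq_coe h hEc ⟨hE''.1.le, hE''.2.le.trans hE.2.le⟩] at hle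
    exact EReal.coe_ne_top _ (top_le_iff.1 hle)
  have key : ∀ E' ∈ Icc (U (M 0)) (U e), (supEntropy U S E').toReal ≤
      (supEntropy U S E).toReal + T⁻¹ * (E' - E) := by
    intro E' hE'
    rcases lt_trichotomy E' E with hlt | rfl | hgt
    · have hE0 : E ∈ Ioo (U (M 0)) (U e) := ⟨hE'.1.trans_lt hlt, hE.2⟩
      rw [(tendsto_slope_left h hE0).limUnder_eq,
        EReal.inv_le_iff_inv_le (betaLeft_pos h hE0) hpos] at hL'
      obtain ⟨E₁, hE₁⟩ := nonempty_Ioo.2 hlt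
      have hmem : E₁ ∈ Icc (U (M 0)) (U e) := ⟨hE'.1.trans hE₁.1.le, hE₁.2.le.trans hE.2.le⟩
      have h1 := hL'.trans (sInf_le (mem_image_of_mem _ ⟨hE'.1.trans_lt hE₁.1, hE₁.2⟩))
      rw [erealSlope_eq_coe h hEc hmem, EReal.coe_le_coe_iff] at h1
      have h2 := h1.trans (hanti ⟨hE', hlt.ne⟩ ⟨hmem, hE₁.2.ne⟩ hE₁.1.le)
      rw [slope_def_field, le_div_iff_of_neg (sub_neg.2 hlt)] at h2
      linarith
    · simp
    · rw [EReal.le_inv_iff_le_inv hR hpos] at hR'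
      obtain ⟨E₁, hE₁⟩ := nonempty_Ioo.2 hgt
      have hmem : E₁ ∈ Icc (U (M 0)) (U e) := ⟨hE.1.trans hE₁.1.le, hE₁.2.le.trans hE'.2⟩
      have h1 := (le_sSup (mem_image_of_mem (erealSlope (supEntropy U S) E)
        (show E₁ ∈ Ioo E (U e) from ⟨hE₁.1, hE₁.2.trans_le hE'.2⟩))).trans hR'
      rw [erealSlope_eq_coe h hEc hmem, EReal.coe_le_coe_iff] at h1
      have h2 := (hanti ⟨hmem, hE₁.1.ne'⟩ ⟨hE', hgt.ne'⟩ hE₁.2.le).trans h1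
      rw [slope_def_field, div_le_iff₀ (sub_pos.2 hgt)] at h2
      linarith
  obtain ⟨x, rfl⟩ := h.exists_energy_eq hEc
  refine hM.eq_of_isMin h hpos ?_
  have := key (U (M T)) ⟨hmin _, hM.energy_le h hT⟩
  rw [hM.supEntropy_eq hT, EReal.toReal_coe, inv_mul_eq_div, ← sub_le_iff_le_add',
    le_div_iff₀ hpos] at this
  linarith

end EnergyEntropySystem

section LogConvex

/-! ### Log convex functions with values in `[0, ∞]` -/

theorem ENNReal.rpow_mul_rpow_le_weighted (a b : ℝ≥0∞) {t : ℝ} (ht0 : 0 ≤ t) (ht1 : t ≤ 1) :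
    a ^ (1 - t) * b ^ t ≤ ENNReal.ofReal (1 - t) * a + ENNReal.ofReal t * b := by
  rcases ht0.eq_or_lt with rfl | ht0
  · simp
  rcases ht1.eq_or_lt with rfl | ht1
  · simp
  have h1 : 0 < 1 - t := by linarith
  have h := ENNReal.young_inequality (a ^ (1 - t)) (b ^ t)
    (Real.HolderConjugate.inv_inv h1 ht0 (by ring))
  rwa [← ENNReal.rpow_mul, ← ENNReal.rpow_mul, mul_inv_cancel₀ h1.ne', mul_inv_cancel₀ ht0.ne',
    ENNReal.rpow_one, ENNReal.rpow_one, ENNReal.ofReal_inv_of_pos h1, ENNReal.ofReal_inv_of_pos ht0,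
    div_eq_mul_inv, div_eq_mul_inv, inv_inv, inv_inv, mul_comm a, mul_comm b] at h

/-- Hölder's inequality for sums of two terms; it is what makes log convexity stable under addition.
-/
theorem ENNReal.rpow_mul_rpow_add_le (a b a' b' : ℝ≥0∞) {t : ℝ} (ht0 : 0 ≤ t) (ht1 : t ≤ 1) :
    a ^ (1 - t) * b ^ t + a' ^ (1 - t) * b' ^ t ≤ (a + a') ^ (1 - t) * (b + b') ^ t := by
  rcases ht0.eq_or_lt with rfl | ht0
  · simp
  rcases ht1.eq_or_lt with rfl | ht1
  · simp
  have h1 : 0 < 1 - t := by linarith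
  have h := ENNReal.inner_le_Lp_mul_Lq Finset.univ ![a ^ (1 - t), a' ^ (1 - t)] ![b ^ t, b' ^ t]
    (Real.HolderConjugate.inv_inv h1 ht0 (by ring))
  simpa [Fin.sum_univ_two, ← ENNReal.rpow_mul, mul_inv_cancel₀ h1.ne', mul_inv_cancel₀ ht0.ne']
    using h

variable {V : Type*} [NormedAddCommGroup V] [NormedSpace ℝ V]

/-- Log convexity on a set of a function with values in `[0, ∞]`. -/
def LogConvexOn (A : Set V) (u : V → ℝ≥0∞) : Prop :=
  ∀ x ∈ A, ∀ y ∈ A, ∀ t : ℝ, 0 ≤ t → t ≤ 1 →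
    u ((1 - t) • x + t • y) ≤ u x ^ (1 - t) * u y ^ t

variable {A : Set V} {u v : V → ℝ≥0∞}

theorem LogConvexOn.mono {B : Set V} (hu : LogConvexOn A u) (h : B ⊆ A) : LogConvexOn B u :=
  fun x hx y hy => hu x (h hx) y (h hy)

theorem LogConvexOn.add (hu : LogConvexOn A u) (hv : LogConvexOn A v) :
    LogConvexOn A fun x => u x + v x := fun x hx y hy t ht0 ht1 =>
  (add_le_add (hu x hx y hy t ht0 ht1) (hv x hx y hy t ht0 ht1)).trans
    (ENNReal.rpow_mul_rpow_add_le _ _ _ _ ht0 ht1)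

theorem LogConvexOn.const_mul (hu : LogConvexOn A u) {a : ℝ≥0∞} (ha0 : a ≠ 0) (ha : a ≠ ∞) :
    LogConvexOn A fun x => a * u x := fun x hx y hy t ht0 ht1 => by
  refine (mul_le_mul_right (hu x hx y hy t ht0 ht1) a).trans_eq ?_
  rw [ENNReal.mul_rpow_of_nonneg _ _ (by linarith), ENNReal.mul_rpow_of_nonneg _ _ ht0]
  calc a * (u x ^ (1 - t) * u y ^ t) = (a ^ (1 - t) * a ^ t) * (u x ^ (1 - t) * u y ^ t) := by
        rw [← ENNReal.rpow_add _ _ ha0 ha, sub_add_cancel, ENNReal.rpow_one]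
    _ = _ := by ring

theorem LogConvexOn.le_weighted (hu : LogConvexOn A u) {x y : V} (hx : x ∈ A) (hy : y ∈ A) {t : ℝ}
    (ht0 : 0 ≤ t) (ht1 : t ≤ 1) :
    u ((1 - t) • x + t • y) ≤ ENNReal.ofReal (1 - t) * u x + ENNReal.ofReal t * u y :=
  (hu x hx y hy t ht0 ht1).trans (ENNReal.rpow_mul_rpow_le_weighted _ _ ht0 ht1)

theorem LogConvexOn.sq_le (hu : LogConvexOn A u) {x y z : V} (hx : x ∈ A) (hy : y ∈ A)
    (hz : z = midpoint ℝ x y) : u z ^ 2 ≤ u x * u y := by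
  have h := hu x hx y hy (1 / 2) (by norm_num) (by norm_num)
  have hz' : (1 - 1 / 2 : ℝ) • x + (1 / 2 : ℝ) • y = z := by
    rw [hz, midpoint_eq_smul_add, smul_add]
    norm_num
  rw [hz'] at h
  calc u z ^ 2 ≤ (u x ^ (1 - 1 / 2 : ℝ) * u y ^ (1 / 2 : ℝ)) ^ 2 := by gcongr
    _ = u x * u y := by
      rw [mul_pow, ← ENNReal.rpow_natCast, ← ENNReal.rpow_natCast, ← ENNReal.rpow_mul,
        ← ENNReal.rpow_mul]
      norm_num

theorem LogConvexOn.le_add (hu : LogConvexOn A u) {x y z : V} (hx : x ∈ A) (hy : y ∈ A)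
    (hz : z = midpoint ℝ x y) : u z ≤ u x + u y := by
  have h := hu.sq_le hx hy hz
  refine le_of_not_gt fun hlt => absurd h (not_le.2 ?_)
  calc u x * u y ≤ (u x + u y) ^ 2 := by
        rw [sq]
        gcongr
        · exact le_self_add
        · exact le_add_self
    _ < u z ^ 2 := by gcongr

theorem LogConvexOn.convexOn_log (hA : Convex ℝ A) (hu : LogConvexOn A u)
    (hpos : ∀ x ∈ A, 0 < u x) (hfin : ∀ x ∈ A, u x ≠ ∞) :
    ConvexOn ℝ A fun x => Real.log (u x).toReal := by
  refine ⟨hA, fun x hx y hy a b ha hb hab => ?_⟩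
  obtain rfl : a = 1 - b := by linarith
  have h := hu x hx y hy b hb (by linarith)
  have hz := hA hx hy ha hb hab
  have hp : ∀ x ∈ A, 0 < (u x).toReal := fun x hx => ENNReal.toReal_pos (hpos x hx).ne' (hfin x hx)
  have h' := ENNReal.toReal_mono (ENNReal.mul_ne_top
    (ENNReal.rpow_ne_top_of_nonneg ha (hfin x hx)) (ENNReal.rpow_ne_top_of_nonneg hb (hfin y hy))) h
  rw [ENNReal.toReal_mul, ← ENNReal.toReal_rpow, ← ENNReal.toReal_rpow] at h'
  refine (Real.log_le_log (hp _ hz) h').trans_eq ?_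
  rw [Real.log_mul (Real.rpow_pos_of_pos (hp x hx) _).ne' (Real.rpow_pos_of_pos (hp y hy) _).ne',
    Real.log_rpow (hp x hx), Real.log_rpow (hp y hy), smul_eq_mul, smul_eq_mul]

/-- Positive powers are order isomorphisms of `[0, ∞]` and commute with the limsup. Finiteness of
the limsups excludes `0 · ∞` when the limsup of a product is bounded by the product. -/
theorem logConvexOn_limsup {u : ℕ → V → ℝ≥0∞} (hu : ∀ j, LogConvexOn A (u j))
    (hfin : ∀ x ∈ A, limsup (fun j => u j x) atTop ≠ ∞) :
    LogConvexOn A fun x => limsup (fun j => u j x) atTop := by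
  intro x hx y hy t ht0 ht1
  rcases ht0.eq_or_lt with rfl | ht0
  · simp
  rcases ht1.eq_or_lt with rfl | ht1
  · simp
  have hrpow : ∀ z (s : ℝ), 0 < s → limsup (fun j => u j z) atTop ^ s =
      limsup (fun j => u j z ^ s) atTop := fun z s hs =>
    (ENNReal.orderIsoRpow s hs).limsup_apply
  have ht1' : 0 < 1 - t := by linarith
  rw [hrpow x _ ht1', hrpow y _ ht0]
  refine (limsup_le_limsup (Eventually.of_forall fun j => hu j x hx y hy t ht0.le ht1.le)).trans
    (ENNReal.limsup_mul_le' (Or.inr ?_) (Or.inl ?_))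
  · rw [← hrpow y _ ht0]
    exact ENNReal.rpow_ne_top_of_nonneg ht0.le (hfin y hy)
  · rw [← hrpow x _ ht1']
    exact ENNReal.rpow_ne_top_of_nonneg ht1'.le (hfin x hx)

/-! ### Almost everywhere convergence of log convex functions. -/

theorem exists_small_of_ae {V : Type*} [NormedAddCommGroup V] [MeasurableSpace V] {m : Measure V}
    [m.IsOpenPosMeasure] {p : V → Prop} (hp : ∀ᵐ h ∂m, p h) {W : Set V} (hW : W ∈ 𝓝 (0 : V)) :
    ∃ h ∈ W, p h := by
  obtain ⟨h, hh, hph⟩ := (Measure.dense_of_ae hp).exists_mem_open isOpen_interior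
    ⟨0, mem_interior_iff_mem_nhds.2 hW⟩
  exact ⟨h, interior_subset hph, hh⟩

theorem eventually_add_smul_mem (hA : IsOpen A) {x : V} (hx : x ∈ A) (a : ℝ) :
    ∀ᶠ h in 𝓝 (0 : V), x + a • h ∈ A := by
  have : Continuous fun h : V => x + a • h := by fun_prop
  have h0 : Tendsto (fun h : V => x + a • h) (𝓝 0) (𝓝 x) := by simpa using this.tendsto 0
  exact h0.eventually (hA.mem_nhds hx)

variable [FiniteDimensional ℝ V]

theorem LogConvexOn.continuousOn (hA : IsOpen A) (hc : Convex ℝ A) (hu : LogConvexOn A u)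
    (hpos : ∀ x ∈ A, 0 < u x) (hfin : ∀ x ∈ A, u x ≠ ∞) : ContinuousOn u A := by
  have h1 := (hu.convexOn_log hc hpos hfin).continuousOn hA
  have h2 : ContinuousOn (fun x => ENNReal.ofReal (Real.exp (Real.log (u x).toReal))) A :=
    ENNReal.continuous_ofReal.comp_continuousOn (Real.continuous_exp.comp_continuousOn h1)
  refine h2.congr fun x hx => ?_
  simp only
  rw [Real.exp_log (ENNReal.toReal_pos (hpos x hx).ne' (hfin x hx)),
    ENNReal.ofReal_toReal (hfin x hx)]

variable [MeasurableSpace V] [BorelSpace V] {m : Measure V} [m.IsAddHaarMeasure]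

theorem ae_add_smul {p : V → Prop} (hp : ∀ᵐ y ∂m, p y) (x : V) {a : ℝ} (ha : a ≠ 0) :
    ∀ᵐ h ∂m, p (x + a • h) := by
  rw [ae_iff] at hp ⊢
  have h1 : {h | ¬ p (x + a • h)} = (fun h => a • h) ⁻¹' ((fun h => x + h) ⁻¹' {y | ¬ p y}) := rfl
  rw [h1, Measure.addHaar_preimage_smul m ha, measure_preimage_add, hp, mul_zero]

/-- A sequence of log convex functions that converges almost everywhere on an open convex set to a
finite function that is not almost everywhere `0` converges everywhere on it, to a log convex
function with values in `(0, ∞)`. -/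
theorem LogConvexOn.exists_tendsto_of_ae (hA : IsOpen A) (hc : Convex ℝ A) {u : ℕ → V → ℝ≥0∞}
    (hu : ∀ j, LogConvexOn A (u j)) {f : V → ℝ≥0∞} (hf : ∀ᵐ x ∂m, x ∈ A → f x ≠ ∞)
    (hlim : ∀ᵐ x ∂m, x ∈ A → Tendsto (fun j => u j x) atTop (𝓝 (f x)))
    (hne : ¬ ∀ᵐ x ∂m, x ∈ A → f x = 0) :
    ∃ w : V → ℝ≥0∞, LogConvexOn A w ∧ (∀ x ∈ A, 0 < w x) ∧ (∀ x ∈ A, w x ≠ ∞) ∧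
      ContinuousOn w A ∧ ∀ x ∈ A, Tendsto (fun j => u j x) atTop (𝓝 (w x)) := by
  set w : V → ℝ≥0∞ := fun x => limsup (fun j => u j x) atTop with hw
  have hae : ∀ᵐ x ∂m, x ∈ A → f x ≠ ∞ ∧ Tendsto (fun j => u j x) atTop (𝓝 (f x)) := by
    filter_upwards [hf, hlim] with x h1 h2 hx using ⟨h1 hx, h2 hx⟩
  -- Every `x` is the midpoint of `x + h` and `x - h` for some small `h` at which the sequence
  -- converges at both points to finite limits.
  have hfin : ∀ x ∈ A, w x ≠ ∞ := by
    intro x hx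
    obtain ⟨h, ⟨hp1, hp2⟩, hq1, hq2⟩ := exists_small_of_ae
      ((ae_add_smul hae x one_ne_zero).and (ae_add_smul hae x (neg_ne_zero.2 one_ne_zero)))
      ((eventually_add_smul_mem hA hx 1).and (eventually_add_smul_mem hA hx (-1)))
    obtain ⟨hf1, hl1⟩ := hq1 hp1
    obtain ⟨hf2, hl2⟩ := hq2 hp2
    refine ne_top_of_le_ne_top (ENNReal.add_ne_top.2 ⟨hf1, hf2⟩) ?_
    rw [← (hl1.add hl2).limsup_eq]
    refine limsup_le_limsup (Eventually.of_forall fun j => (hu j).le_add hp1 hp2 ?_)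
    rw [midpoint_eq_smul_add]
    simp only [one_smul, neg_smul]
    rw [show x + h + (x + -h) = (2 : ℝ) • x by rw [two_smul]; abel, smul_smul]
    norm_num
  have hlc : LogConvexOn A w := logConvexOn_limsup hu hfin
  have hwf : ∀ᵐ x ∂m, x ∈ A → w x = f x := by
    filter_upwards [hlim] with x h hx using (h hx).limsup_eq
  have hpos : ∀ x ∈ A, 0 < w x := by
    intro x hx
    rw [pos_iff_ne_zero]
    intro h0
    refine hne ?_
    filter_upwards [hwf] with y hy hyA
    rw [← hy hyA]
    -- Suppose `w x = 0` and extend the segment from `x` slightly beyond `y` inside `A`; log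
    -- convexity along it forces `w y = 0`.
    obtain ⟨s, hs, hs0⟩ : ∃ s : ℝ, y + s • (y - x) ∈ A ∧ 0 < s := by
      have hcts : Tendsto (fun s : ℝ => y + s • (y - x)) (𝓝[>] 0) (𝓝 y) := by
        have : Continuous fun s : ℝ => y + s • (y - x) := by fun_prop
        simpa using (this.tendsto 0).mono_left nhdsWithin_le_nhds
      exact ((hcts.eventually (hA.mem_nhds hyA)).and self_mem_nhdsWithin).exists
    have h1 := hlc x hx _ hs (1 / (1 + s)) (by positivity)
      (by rw [div_le_one (by positivity)]; linarith)
    have h2 : 0 < 1 - 1 / (1 + s) := by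
      rw [sub_pos, div_lt_one (by positivity)]; linarith
    rw [h0, ENNReal.zero_rpow_of_pos h2, zero_mul] at h1
    have h3 : (1 - 1 / (1 + s)) • x + (1 / (1 + s)) • (y + s • (y - x)) = y := by
      have h4 : 1 + s ≠ 0 := by positivity
      match_scalars
      · field_simp; ring
      · field_simp
    rw [h3] at h1
    exact le_antisymm h1 zero_le
  have hcont := hlc.continuousOn hA hc hpos hfin
  refine ⟨w, hlc, hpos, hfin, hcont, fun x hx => ?_⟩
  refine tendsto_of_le_liminf_of_limsup_le ?_ le_rfl
  have hexp : Continuous fun h : V => (x + (1 : ℝ) • h, x + (2 : ℝ) • h) := by fun_prop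
  have hwcont : ∀ a : ℝ, Tendsto (fun h : V => w (x + a • h)) (𝓝 0) (𝓝 (w x)) := fun a => by
    have h1 : Continuous fun h : V => x + a • h := by fun_prop
    have h2 : Tendsto (fun h : V => x + a • h) (𝓝 0) (𝓝 x) := by simpa using h1.tendsto 0
    exact (hcont.continuousAt (hA.mem_nhds hx)).tendsto.comp h2
  -- The limsup is `w` by definition, so the liminf has to be bounded below. Since `x + h` is the
  -- midpoint of `x` and `x + 2h`, one has `u j x ≥ u j (x + h)² / u j (x + 2h)`. Choose `h` with
  -- convergence at both points, then let `h → 0` using continuity of `w`.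
  have hgood : ∀ W ∈ 𝓝 (0 : V), ∃ h ∈ W,
      w (x + (1 : ℝ) • h) ^ 2 ≤ liminf (fun j => u j x) atTop * w (x + (2 : ℝ) • h) := by
    intro W hW
    have hboth : ∀ᵐ x ∂m, x ∈ A → f x ≠ ∞ ∧ Tendsto (fun j => u j x) atTop (𝓝 (w x)) := by
      filter_upwards [hae, hwf] with x h1 h2 hx
      rw [h2 hx]
      exact h1 hx
    obtain ⟨h, ⟨hhW, hp1, hp2⟩, hq1, hq2⟩ := exists_small_of_ae
      ((ae_add_smul hboth x one_ne_zero).and (ae_add_smul hboth x (two_ne_zero)))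
      (inter_mem hW ((eventually_add_smul_mem hA hx 1).and (eventually_add_smul_mem hA hx 2)))
    refine ⟨h, hhW, ?_⟩
    have hl1 := (hq1 hp1).2
    have hl2 := (hq2 hp2).2
    have hsq : ∀ j, u j (x + (1 : ℝ) • h) ^ 2 ≤ u j x * u j (x + (2 : ℝ) • h) := fun j => by
      refine (hu j).sq_le hx hp2 ?_
      rw [midpoint_eq_smul_add]
      match_scalars <;> norm_num
    have hl3 : Tendsto (fun j => u j (x + (1 : ℝ) • h) ^ 2 / u j (x + (2 : ℝ) • h)) atTop
        (𝓝 (w (x + (1 : ℝ) • h) ^ 2 / w (x + (2 : ℝ) • h))) :=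
      ENNReal.Tendsto.div (ENNReal.Tendsto.pow hl1)
        (Or.inl (pow_ne_zero 2 (hpos _ hp1).ne')) hl2 (Or.inl (hfin _ hp2))
    have hev : ∀ᶠ j in atTop, u j (x + (1 : ℝ) • h) ^ 2 / u j (x + (2 : ℝ) • h) ≤ u j x := by
      have e1 := hl2.eventually_ne (hpos _ hp2).ne'
      have e2 := hl2.eventually_ne (hfin _ hp2)
      filter_upwards [e1, e2] with j h1 h2
      rw [ENNReal.div_le_iff h1 h2]
      exact hsq j
    have := liminf_le_liminf hev
    rw [hl3.liminf_eq] at this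
    rwa [ENNReal.div_le_iff (hpos _ hp2).ne' (hfin _ hp2)] at this
  have hsqle : w x ^ 2 ≤ liminf (fun j => u j x) atTop * w x := by
    by_contra! hlt
    have hl1 : Tendsto (fun h : V => w (x + (1 : ℝ) • h) ^ 2) (𝓝 0) (𝓝 (w x ^ 2)) :=
      ENNReal.Tendsto.pow (hwcont 1)
    have hliminf : liminf (fun j => u j x) atTop ≠ ∞ :=
      ne_top_of_le_ne_top (hfin x hx) (liminf_le_limsup)
    have hl2 : Tendsto (fun h : V => liminf (fun j => u j x) atTop * w (x + (2 : ℝ) • h)) (𝓝 0)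
        (𝓝 (liminf (fun j => u j x) atTop * w x)) :=
      ENNReal.Tendsto.const_mul (hwcont 2) (Or.inr hliminf)
    obtain ⟨h, hlt', hge⟩ := hgood _ (hl2.eventually_lt hl1 hlt)
    exact absurd hge (not_le.2 hlt')
  rw [sq] at hsqle
  exact (ENNReal.mul_le_mul_iff_left (hpos x hx).ne' (hfin x hx)).1 hsqle

end LogConvex

/-! ### Lower semicontinuous extension to the boundary. -/

section Extension

variable {V : Type*} [NormedAddCommGroup V] [NormedSpace ℝ V]

/-- A convex function on an open convex set has a supporting affine function at each point. -/
theorem ConvexOn.exists_subgradient [FiniteDimensional ℝ V] {A : Set V} (hA : IsOpen A) {φ : V → ℝ}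
    (hφ : ConvexOn ℝ A φ) {x : V} (hx : x ∈ A) :
    ∃ g : V →L[ℝ] ℝ, ∀ y ∈ A, φ x + g (y - x) ≤ φ y := by
  have hopen : IsOpen {p : V × ℝ | p.1 ∈ A ∧ φ p.1 < p.2} := by
    have h1 : ContinuousOn (fun p : V × ℝ => p.2 - φ p.1) (Prod.fst ⁻¹' A) :=
      continuousOn_snd.sub ((hφ.continuousOn hA).comp continuousOn_fst fun p hp => hp)
    have h2 := h1.isOpen_inter_preimage (hA.preimage continuous_fst) isOpen_Ioi (t := Ioi 0)
    convert h2 using 1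
    ext p
    simp
  obtain ⟨f, hf⟩ := geometric_hahn_banach_open_point hφ.convex_strict_epigraph hopen
    (x := (x, φ x)) (by simp)
  have hsplit : ∀ v r, f (v, r) = f (v, 0) + r * f (0, 1) := fun v r => by
    have : ((v, r) : V × ℝ) = (v, 0) + r • (0, 1) := by simp
    rw [this, map_add, map_smul, smul_eq_mul]
  set c := f (0, 1) with hc
  -- The separating hyperplane is not vertical because the strict epigraph contains points directly
  -- above `(x, φ x)`.
  have hc0 : c < 0 := by
    have := hf (x, φ x + 1) ⟨hx, by simp⟩
    rw [hsplit, hsplit x (φ x)] at this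
    linarith
  refine ⟨(-c⁻¹) • f.comp (ContinuousLinearMap.inl ℝ V ℝ), fun y hy => ?_⟩
  have hle : f (y, 0) + φ y * c ≤ f (x, 0) + φ x * c := by
    refine le_of_forall_pos_le_add fun ε hε => ?_
    have := hf (y, φ y + ε / (-c)) ⟨hy, by
      have : 0 < ε / (-c) := div_pos hε (by linarith)
      simpa using this⟩
    rw [hsplit, hsplit x (φ x)] at this
    have h2 : (φ y + ε / -c) * c = φ y * c - ε := by
      rw [add_mul, div_neg, neg_mul, div_mul_cancel₀ _ hc0.ne]
      ring
    linarith
  have hsub : f (y - x, 0) = f (y, 0) - f (x, 0) := by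
    rw [← map_sub]
    simp
  simp only [smul_apply, ContinuousLinearMap.comp_apply,
    ContinuousLinearMap.inl_apply, smul_eq_mul]
  rw [hsub]
  have hc1 : c * c⁻¹ = 1 := mul_inv_cancel₀ hc0.ne
  have hci : c⁻¹ < 0 := inv_neg''.2 hc0
  have h3 := mul_le_mul_of_nonpos_right hle hci.le
  rw [add_mul, add_mul, mul_assoc, mul_assoc, hc1] at h3
  linarith

/-- The supremum of the exponentials of the affine functions that are dominated by `w` on `A`
after exponentiation. -/
def logConvexHull (A : Set V) (w : V → ℝ≥0∞) (x : V) : ℝ≥0∞ :=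
  ⨆ (p : (V →L[ℝ] ℝ) × ℝ) (_ : ∀ y ∈ A, ENNReal.ofReal (Real.exp (p.1 y + p.2)) ≤ w y),
    ENNReal.ofReal (Real.exp (p.1 x + p.2))

variable {A : Set V} {w : V → ℝ≥0∞}

theorem lowerSemicontinuous_logConvexHull : LowerSemicontinuous (logConvexHull A w) :=
  lowerSemicontinuous_biSup fun p _ => Continuous.lowerSemicontinuous
    (ENNReal.continuous_ofReal.comp (by fun_prop))

theorem logConvexOn_logConvexHull : LogConvexOn univ (logConvexHull A w) := by
  intro x _ y _ t ht0 ht1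
  refine iSup₂_le fun p hp => ?_
  have hle : ∀ z, ENNReal.ofReal (Real.exp (p.1 z + p.2)) ≤ logConvexHull A w z := fun z =>
    le_iSup₂ (f := fun (p : (V →L[ℝ] ℝ) × ℝ)
      (_ : ∀ y ∈ A, ENNReal.ofReal (Real.exp (p.1 y + p.2)) ≤ w y) =>
      ENNReal.ofReal (Real.exp (p.1 z + p.2))) p hp
  refine le_trans (le_of_eq ?_) (mul_le_mul' (ENNReal.rpow_le_rpow (hle x) (by linarith))
    (ENNReal.rpow_le_rpow (hle y) ht0))
  rw [ENNReal.ofReal_rpow_of_pos (Real.exp_pos _), ENNReal.ofReal_rpow_of_pos (Real.exp_pos _),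
    ← ENNReal.ofReal_mul (by positivity), ← Real.exp_mul, ← Real.exp_mul, ← Real.exp_add]
  congr 2
  simp only [map_add, map_smul, smul_eq_mul]
  ring

theorem tendsto_rpow_mul_rpow_zero {b c : ℝ≥0∞} (hb0 : b ≠ 0) (hb : b ≠ ∞) (hc0 : c ≠ 0)
    (hc : c ≠ ∞) : Tendsto (fun t : ℝ => b ^ (1 - t) * c ^ t) (𝓝[>] 0) (𝓝 b) := by
  have h1 : 0 < b.toReal := ENNReal.toReal_pos hb0 hb
  have h2 : 0 < c.toReal := ENNReal.toReal_pos hc0 hc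
  have h3 : ∀ t : ℝ, b ^ (1 - t) * c ^ t =
      ENNReal.ofReal (b.toReal ^ (1 - t) * c.toReal ^ t) := fun t => by
    rw [ENNReal.ofReal_mul (by positivity), ← ENNReal.ofReal_rpow_of_pos h1,
      ← ENNReal.ofReal_rpow_of_pos h2, ENNReal.ofReal_toReal hb, ENNReal.ofReal_toReal hc]
  simp only [h3]
  have h4 : Continuous fun t : ℝ => b.toReal ^ (1 - t) * c.toReal ^ t :=
    ((Real.continuous_const_rpow h1.ne').comp (by fun_prop)).mul
      (Real.continuous_const_rpow h2.ne')
  have h5 := (ENNReal.continuous_ofReal.comp h4).tendsto 0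
  simp only [Function.comp_def, sub_zero, Real.rpow_one, Real.rpow_zero, mul_one,
    ENNReal.ofReal_toReal hb] at h5
  exact h5.mono_left nhdsWithin_le_nhds

/-- The pointwise limit on the interior controls a lower semicontinuous extension to the boundary
through the liminf along the sequence. -/
theorem LogConvexOn.le_liminf {P : Set V} (hP : Convex ℝ P) {u : ℕ → V → ℝ≥0∞}
    (hu : ∀ j, LogConvexOn P (u j)) {v : V → ℝ≥0∞} (hv : LowerSemicontinuousOn v P)
    (hlim : ∀ y ∈ interior P, Tendsto (fun j => u j y) atTop (𝓝 (v y))) {x₀ : V}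
    (hx₀ : x₀ ∈ interior P) (h0 : v x₀ ≠ 0) (htop : v x₀ ≠ ∞) {x : V} (hx : x ∈ P) :
    v x ≤ liminf (fun j => u j x) atTop := by
  refine le_of_forall_gt_imp_ge_of_dense fun b hb => ?_
  rcases eq_or_ne b ∞ with rfl | hbtop
  · exact le_top
  have hb0 : b ≠ 0 := (zero_le.trans_lt hb).ne'
  by_contra! hlt
  obtain ⟨b', hbb', hb'v⟩ := exists_between hlt
  have hcts : Tendsto (fun t : ℝ => (1 - t) • x + t • x₀) (𝓝[>] 0) (𝓝 x) := by
    have : Continuous fun t : ℝ => (1 - t) • x + t • x₀ := by fun_prop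
    simpa using (this.tendsto 0).mono_left nhdsWithin_le_nhds
  have hmem : ∀ t ∈ Ioc (0 : ℝ) 1, (1 - t) • x + t • x₀ ∈ interior P := fun t ht =>
    hP.combo_self_interior_mem_interior hx hx₀ (by linarith [ht.2]) ht.1 (by ring)
  have hIoc : ∀ᶠ t in 𝓝[>] (0 : ℝ), t ∈ Ioc (0 : ℝ) 1 := Ioc_mem_nhdsGT one_pos
  have hcts' : Tendsto (fun t : ℝ => (1 - t) • x + t • x₀) (𝓝[>] 0) (𝓝[P] x) :=
    tendsto_nhdsWithin_iff.2 ⟨hcts, hIoc.mono fun t ht => interior_subset (hmem t ht)⟩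
  have h1 := hcts'.eventually (hv x hx b' hb'v)
  have h2 := (tendsto_rpow_mul_rpow_zero hb0 hbtop h0 htop).eventually_lt_const hbb'
  obtain ⟨t, ⟨h1, h2⟩, ht⟩ := ((h1.and h2).and hIoc).exists
  -- For infinitely many `j`, log convexity on the segment from `x` to `x₀` gives the bound with `b`
  -- in place of `u j x`. In the limit `v ≤ b^(1-t) v(x₀)^t` along the segment; as `t → 0` this
  -- contradicts lower semicontinuity of `v` at `x`.
  have hfreq : ∃ᶠ j in atTop, u j x < b := frequently_lt_of_liminf_lt (by isBoundedDefault) hb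
  have hlx₀ := hlim x₀ hx₀
  have hle : v ((1 - t) • x + t • x₀) ≤ b ^ (1 - t) * v x₀ ^ t := by
    have hR : Tendsto (fun j => b ^ (1 - t) * u j x₀ ^ t) atTop (𝓝 (b ^ (1 - t) * v x₀ ^ t)) :=
      ENNReal.Tendsto.const_mul
        ((ENNReal.continuous_rpow_const.tendsto _).comp hlx₀)
        (Or.inr (ENNReal.rpow_ne_top_of_nonneg (by linarith [ht.2]) hbtop))
    refine le_of_tendsto_of_tendsto_of_frequently (hlim _ (hmem t ht)) hR
      (hfreq.mono fun j hj => ?_)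
    refine (hu j x hx x₀ (interior_subset hx₀) t ht.1.le ht.2).trans ?_
    gcongr
    linarith [ht.2]
  exact absurd h1 (not_lt.2 (hle.trans h2.le))

variable [FiniteDimensional ℝ V]

/-- Exponentiate a supporting affine function of `log w`. That it touches `w` at `x` makes the hull
agree with `w` on `A`. -/
theorem LogConvexOn.exists_exp_le (hA : IsOpen A) (hc : Convex ℝ A) (hw : LogConvexOn A w)
    (hpos : ∀ x ∈ A, 0 < w x) (hfin : ∀ x ∈ A, w x ≠ ∞) {x : V} (hx : x ∈ A) :
    ∃ p : (V →L[ℝ] ℝ) × ℝ, (∀ y ∈ A, ENNReal.ofReal (Real.exp (p.1 y + p.2)) ≤ w y) ∧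
      ENNReal.ofReal (Real.exp (p.1 x + p.2)) = w x := by
  have hp : ∀ x ∈ A, 0 < (w x).toReal := fun x hx => ENNReal.toReal_pos (hpos x hx).ne' (hfin x hx)
  obtain ⟨g, hg⟩ := (hw.convexOn_log hc hpos hfin).exists_subgradient hA hx
  refine ⟨(g, Real.log (w x).toReal - g x), fun y hy => ?_, ?_⟩
  · rw [← ENNReal.ofReal_toReal (hfin y hy)]
    refine ENNReal.ofReal_le_ofReal ?_
    rw [← Real.le_log_iff_exp_le (hp y hy)]
    have := hg y hy
    rw [map_sub] at this
    simp only at this ⊢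
    linarith
  · simp only [add_sub_cancel]
    rw [Real.exp_log (hp x hx), ENNReal.ofReal_toReal (hfin x hx)]

theorem logConvexHull_pos (hA : IsOpen A) (hc : Convex ℝ A) (hw : LogConvexOn A w)
    (hpos : ∀ x ∈ A, 0 < w x) (hfin : ∀ x ∈ A, w x ≠ ∞) (hne : A.Nonempty) (x : V) :
    0 < logConvexHull A w x := by
  obtain ⟨y, hy⟩ := hne
  obtain ⟨p, hp, -⟩ := hw.exists_exp_le hA hc hpos hfin hy
  refine lt_of_lt_of_le (ENNReal.ofReal_pos.2 (Real.exp_pos _)) (le_iSup₂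
    (f := fun (p : (V →L[ℝ] ℝ) × ℝ)
      (_ : ∀ y ∈ A, ENNReal.ofReal (Real.exp (p.1 y + p.2)) ≤ w y) =>
      ENNReal.ofReal (Real.exp (p.1 x + p.2))) p hp)

theorem logConvexHull_eqOn (hA : IsOpen A) (hc : Convex ℝ A) (hw : LogConvexOn A w)
    (hpos : ∀ x ∈ A, 0 < w x) (hfin : ∀ x ∈ A, w x ≠ ∞) : EqOn (logConvexHull A w) w A := by
  intro x hx
  refine le_antisymm (iSup₂_le fun p hp => hp x hx) ?_
  obtain ⟨p, hp, hpx⟩ := hw.exists_exp_le hA hc hpos hfin hx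
  rw [← hpx]
  exact le_iSup₂ (f := fun (p : (V →L[ℝ] ℝ) × ℝ)
      (_ : ∀ y ∈ A, ENNReal.ofReal (Real.exp (p.1 y + p.2)) ≤ w y) =>
      ENNReal.ofReal (Real.exp (p.1 x + p.2))) p hp

end Extension

open Classical in
-- For closed `P`, extension by the largest value `∞` preserves lower semicontinuity, hence gives a
-- Borel function.
theorem LowerSemicontinuousOn.measurable_piecewise {V : Type*} [TopologicalSpace V]
    [MeasurableSpace V] [BorelSpace V] {P : Set V} (hP : IsClosed P) {u : V → ℝ≥0∞}
    (hu : LowerSemicontinuousOn u P) : Measurable (P.piecewise u fun _ => ∞) := by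
  refine LowerSemicontinuous.measurable fun x a (hax : a < _) => ?_
  by_cases hx : x ∈ P
  · rw [piecewise_eq_of_mem _ _ _ hx] at hax
    filter_upwards [eventually_nhdsWithin_iff.1 (hu x hx a hax)] with y hy
    by_cases hyP : y ∈ P
    · rw [piecewise_eq_of_mem _ _ _ hyP]
      exact hy hyP
    · rw [piecewise_eq_of_notMem _ _ _ hyP]
      exact hax.trans_le le_top
  · rw [piecewise_eq_of_notMem _ _ _ hx] at hax
    filter_upwards [hP.isOpen_compl.mem_nhds hx] with y hy
    rw [piecewise_eq_of_notMem _ _ _ hy]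
    exact hax

theorem LowerSemicontinuousOn.aemeasurable_restrict {V : Type*} [TopologicalSpace V]
    [MeasurableSpace V] [BorelSpace V] {P : Set V} (hP : IsClosed P) {u : V → ℝ≥0∞}
    (hu : LowerSemicontinuousOn u P) (ν : Measure V) : AEMeasurable u (ν.restrict P) := by
  classical
  refine ⟨_, hu.measurable_piecewise hP, ?_⟩
  filter_upwards [ae_restrict_mem hP.measurableSet] with x hx
  rw [piecewise_eq_of_mem _ _ _ hx]

/-! ### Measures of a system and limits of states. -/

namespace SimpleSystem

variable {V : Type*} [NormedAddCommGroup V] [NormedSpace ℝ V] [MeasurableSpace V]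
  (S : SimpleSystem V)

theorem isCompact : IsCompact S.P := S.simple.1.1

theorem isClosed : IsClosed S.P := S.simple.1.1.isClosed

theorem convex : Convex ℝ S.P := S.simple.1.convex

theorem interior_nonempty : (interior S.P).Nonempty := S.simple.1.2.1

theorem bdry_subset : S.bdry ⊆ S.P := sdiff_subset

theorem IsState.logConvexOn {S : SimpleSystem V} {u : V → ℝ≥0∞} (hu : S.IsState u) :
    LogConvexOn S.P u := hu.logConvex

variable [BorelSpace V]

theorem measurableSet : MeasurableSet S.P := S.isClosed.measurableSet

theorem measurableSet_bdry : MeasurableSet S.bdry :=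
  S.measurableSet.diff isOpen_interior.measurableSet

theorem IsState.aemeasurable_bdry {S : SimpleSystem V} {u : V → ℝ≥0∞} (hu : S.IsState u) :
    AEMeasurable u (S.σ.restrict S.bdry) :=
  (hu.lsc.aemeasurable_restrict S.isClosed S.σ).mono_set S.bdry_subset

variable [FiniteDimensional ℝ V]

theorem exists_haar : ∃ m : Measure V, m.IsAddHaarMeasure ∧ S.μ = m.restrict S.P :=
  S.flat_μ.exists_isAddHaarMeasure S.interior_nonempty

theorem restrict_μ : S.μ.restrict S.P = S.μ := by
  obtain ⟨m, -, hm⟩ := S.exists_haar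
  rw [hm, Measure.restrict_restrict S.measurableSet, inter_self]

instance : IsFiniteMeasure S.μ := by
  obtain ⟨m, _, hm⟩ := S.exists_haar
  refine ⟨?_⟩
  rw [hm, Measure.restrict_apply_univ]
  exact S.isCompact.measure_lt_top

instance : IsFiniteMeasure S.σ := ⟨S.flat_σ.lt_top S.simple.1⟩

theorem vol_ne_top : S.vol ≠ ∞ := measure_ne_top _ _

theorem vol_ne_zero : S.vol ≠ 0 := by
  obtain ⟨m, _, hm⟩ := S.exists_haar
  rw [vol, hm, Measure.restrict_apply_self]
  exact ((isOpen_interior.measure_pos m S.interior_nonempty).trans_le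
    (measure_mono interior_subset)).ne'

theorem vol_toReal_pos : 0 < S.vol.toReal := ENNReal.toReal_pos S.vol_ne_zero S.vol_ne_top

theorem real_univ : S.μ.real univ = S.vol.toReal := by
  rw [vol, ← Measure.restrict_apply_univ, restrict_μ]
  rfl

/-- The frontier of a convex set is Haar null. -/
theorem ae_mem_interior : ∀ᵐ x ∂S.μ, x ∈ interior S.P := by
  obtain ⟨m, _, hm⟩ := S.exists_haar
  rw [hm, ae_restrict_iff' S.measurableSet]
  have h0 := S.convex.addHaar_frontier m
  filter_upwards [measure_eq_zero_iff_ae_notMem.1 h0] with x hx hxP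
  by_contra hxi
  exact hx ⟨subset_closure hxP, hxi⟩

theorem ae_iff_haar {m : Measure V} [m.IsAddHaarMeasure] (hm : S.μ = m.restrict S.P)
    {p : V → Prop} : (∀ᵐ x ∂S.μ, p x) ↔ ∀ᵐ x ∂m, x ∈ interior S.P → p x := by
  have h0 := measure_eq_zero_iff_ae_notMem.1 (S.convex.addHaar_frontier m)
  rw [hm, ae_restrict_iff' S.measurableSet]
  refine ⟨fun h => h.mono fun x hx hxi => hx (interior_subset hxi), fun h => ?_⟩
  filter_upwards [h, h0] with x hx hx0 hxP
  by_contra hp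
  exact hx0 ⟨subset_closure hxP, fun hxi => hp (hx hxi)⟩

variable {S} {u : V → ℝ≥0∞}

theorem IsState.aemeasurable (hu : S.IsState u) : AEMeasurable u S.μ := by
  rw [← S.restrict_μ]
  exact hu.lsc.aemeasurable_restrict S.isClosed _

theorem IsState.lintegral_eq (hu : S.IsState u) : ∫⁻ x, u x ∂S.μ = S.vol := by
  rw [← hu.normalized, restrict_μ]

theorem IsState.ae_ne_top (hu : S.IsState u) : ∀ᵐ x ∂S.μ, u x ≠ ∞ := by
  filter_upwards [ae_lt_top' hu.aemeasurable (by rw [hu.lintegral_eq]; exact S.vol_ne_top)]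
    with x hx using hx.ne

theorem not_ae_eq_zero {f : V → ℝ≥0∞} (hf : ∫⁻ x, f x ∂S.μ = S.vol) : ¬ ∀ᵐ x ∂S.μ, f x = 0 := by
  intro h
  rw [lintegral_congr_ae h] at hf
  simp at hf
  exact S.vol_ne_zero hf.symm

theorem IsState.exists_tendsto_interior {u : ℕ → V → ℝ≥0∞} (hu : ∀ j, S.IsState (u j))
    {f : V → ℝ≥0∞} (hf : ∀ᵐ x ∂S.μ, f x ≠ ∞) (hfint : ∫⁻ x, f x ∂S.μ = S.vol)
    (hlim : ∀ᵐ x ∂S.μ, Tendsto (fun j => u j x) atTop (𝓝 (f x))) :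
    ∃ w : V → ℝ≥0∞, LogConvexOn (interior S.P) w ∧ (∀ x ∈ interior S.P, 0 < w x) ∧
      (∀ x ∈ interior S.P, w x ≠ ∞) ∧ ContinuousOn w (interior S.P) ∧
      ∀ x ∈ interior S.P, Tendsto (fun j => u j x) atTop (𝓝 (w x)) := by
  obtain ⟨m, _, hm⟩ := S.exists_haar
  exact LogConvexOn.exists_tendsto_of_ae (m := m) isOpen_interior S.convex.interior
    (fun j => (hu j).logConvexOn.mono interior_subset)
    ((S.ae_iff_haar hm).1 hf) ((S.ae_iff_haar hm).1 hlim)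
    fun h => not_ae_eq_zero hfint ((S.ae_iff_haar hm).2 h)

/-- Normalization gives finiteness only almost everywhere; the convergence theorem applied to the
constant sequence improves it to every interior point. -/
theorem IsState.ne_top (hu : S.IsState u) : ∀ x ∈ interior S.P, u x ≠ ∞ := by
  obtain ⟨w, -, -, hfin, -, hlim⟩ := IsState.exists_tendsto_interior (fun _ => hu)
    hu.ae_ne_top hu.lintegral_eq (ae_of_all _ fun x => tendsto_const_nhds)
  intro x hx
  rw [tendsto_nhds_unique tendsto_const_nhds (hlim x hx)]
  exact hfin x hx

theorem IsState.continuousOn (hu : S.IsState u) : ContinuousOn u (interior S.P) :=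
  (hu.logConvexOn.mono interior_subset).continuousOn isOpen_interior S.convex.interior
    (fun x hx => hu.pos x (interior_subset hx)) hu.ne_top

/-- States are closed under almost everywhere convergence without loss of mass. -/
theorem IsState.exists_of_ae_tendsto {u : ℕ → V → ℝ≥0∞} (hu : ∀ j, S.IsState (u j))
    {f : V → ℝ≥0∞} (hf : ∀ᵐ x ∂S.μ, f x ≠ ∞) (hfint : ∫⁻ x, f x ∂S.μ = S.vol)
    (hlim : ∀ᵐ x ∂S.μ, Tendsto (fun j => u j x) atTop (𝓝 (f x))) :
    ∃ v, S.IsState v ∧ v =ᵐ[S.μ] f := by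
  obtain ⟨w, hw, hpos, hfin, -, hwlim⟩ := IsState.exists_tendsto_interior hu hf hfint hlim
  -- The limit `w` is controlled only in the interior; the hull supplies lower semicontinuous log
  -- convex boundary values without changing it there.
  have heq := logConvexHull_eqOn isOpen_interior S.convex.interior hw hpos hfin
  have hae : logConvexHull (interior S.P) w =ᵐ[S.μ] f := by
    filter_upwards [S.ae_mem_interior, hlim] with x hx hxl
    rw [heq hx]
    exact tendsto_nhds_unique (hwlim x hx) hxl
  refine ⟨logConvexHull (interior S.P) w, ⟨lowerSemicontinuous_logConvexHull.lowerSemicontinuousOn _,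
    fun x _ => logConvexHull_pos isOpen_interior S.convex.interior hw hpos hfin
      S.interior_nonempty x, logConvexOn_logConvexHull.mono (subset_univ _), ?_⟩, hae⟩
  rw [restrict_μ, lintegral_congr_ae hae, hfint]

/-- In the interior, `v` and the pointwise limit are continuous and agree almost everywhere, hence
everywhere. The boundary, which `μ` does not see, follows from the one-sided estimate for log convex
functions. -/
theorem IsState.le_liminf {u : ℕ → V → ℝ≥0∞} (hu : ∀ j, S.IsState (u j)) {v : V → ℝ≥0∞}
    (hv : S.IsState v) (hlim : ∀ᵐ x ∂S.μ, Tendsto (fun j => u j x) atTop (𝓝 (v x))) {x : V}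
    (hx : x ∈ S.P) : v x ≤ liminf (fun j => u j x) atTop := by
  obtain ⟨w, hw, hpos, hfin, hcont, hwlim⟩ :=
    IsState.exists_tendsto_interior hu hv.ae_ne_top hv.lintegral_eq hlim
  obtain ⟨m, _, hm⟩ := S.exists_haar
  have heq : EqOn v w (interior S.P) := by
    refine Measure.eqOn_open_of_ae_eq (μ := m) ?_ isOpen_interior hv.continuousOn hcont
    rw [EventuallyEq, ae_restrict_iff' isOpen_interior.measurableSet]
    filter_upwards [(S.ae_iff_haar hm).1 hlim] with y hy hyi
    exact tendsto_nhds_unique (hy hyi) (hwlim y hyi)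
  obtain ⟨x₀, hx₀⟩ := S.interior_nonempty
  exact LogConvexOn.le_liminf S.convex (fun j => (hu j).logConvexOn) hv.lsc
    (fun y hy => by rw [heq hy]; exact hwlim y hy) hx₀ (hv.pos x₀ (interior_subset hx₀)).ne'
    (hv.ne_top x₀ hx₀) hx

theorem IsState.lintegral_bdry_le {u : ℕ → V → ℝ≥0∞} (hu : ∀ j, S.IsState (u j)) {v : V → ℝ≥0∞}
    (hv : S.IsState v) (hlim : ∀ᵐ x ∂S.μ, Tendsto (fun j => u j x) atTop (𝓝 (v x)))
    {A : ℝ≥0∞} (hA : ∀ j, ∫⁻ x in S.bdry, u j x ∂S.σ ≤ A) : ∫⁻ x in S.bdry, v x ∂S.σ ≤ A := by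
  calc ∫⁻ x in S.bdry, v x ∂S.σ ≤ ∫⁻ x in S.bdry, liminf (fun j => u j x) atTop ∂S.σ :=
        setLIntegral_mono' S.measurableSet_bdry fun x hx =>
          IsState.le_liminf hu hv hlim (S.bdry_subset hx)
    _ ≤ liminf (fun j => ∫⁻ x in S.bdry, u j x ∂S.σ) atTop :=
        lintegral_liminf_le' fun j => (hu j).aemeasurable_bdry
    _ ≤ A := by
        refine (liminf_le_liminf (Eventually.of_forall hA)).trans_eq ?_
        simp

end SimpleSystem

/-! ### Integration over cones. -/

section Cone

variable {V : Type*} [NormedAddCommGroup V] [NormedSpace ℝ V]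

/-- The punctured cone with apex `x₀` over a subset `F` of the hyperplane `ℓ = 0`. -/
def coneOver (ℓ : V →ᵃ[ℝ] ℝ) (x₀ : V) (F : Set V) : Set V :=
  {x | 1 - ℓ x / ℓ x₀ ∈ Ioc (0 : ℝ) 1 ∧ x₀ + (1 - ℓ x / ℓ x₀)⁻¹ • (x - x₀) ∈ F}

/-- Since `ℓ` vanishes at `y`, the quantity `1 - ℓ x / ℓ x₀` recovers the ray parameter `s`. -/
theorem mem_coneOver {ℓ : V →ᵃ[ℝ] ℝ} {x₀ : V} (hx₀ : ℓ x₀ ≠ 0) {F : Set V}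
    {y : V} (hy : y ∈ F) (hℓy : ℓ y = 0) {s : ℝ} (hs : s ∈ Ioc (0 : ℝ) 1) :
    x₀ + s • (y - x₀) ∈ coneOver ℓ x₀ F := by
  have h1 : 1 - ℓ (x₀ + s • (y - x₀)) / ℓ x₀ = s := by
    rw [AffineMap.apply_add_smul_sub, hℓy]
    field_simp
    ring
  rw [coneOver, mem_ofPred_eq, h1, add_sub_cancel_left, smul_smul, inv_mul_cancel₀ hs.1.ne', one_smul,
    add_sub_cancel]
  exact ⟨hs, hy⟩

variable [FiniteDimensional ℝ V]

/-- The equivalence between a vector space and the product of a hyperplane with a transversal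
line. -/
theorem exists_hyperplane_prod_equiv {D : Submodule ℝ V} (hD : Module.finrank ℝ D + 1 = Module.finrank ℝ V)
    {f : V →ₗ[ℝ] ℝ} (hf : ∀ v ∈ D, f v = 0) {v : V} (hv : f v ≠ 0) :
    ∃ e : (D × ℝ) ≃L[ℝ] V, ∀ w : D, ∀ r : ℝ, e (w, r) = w + r • v := by
  let g : (D × ℝ) →ₗ[ℝ] V := D.subtype.coprod (LinearMap.toSpanSingleton ℝ V v)
  have hg : ∀ w r, g (w, r) = (w : V) + r • v := fun w r => by simp [g]
  have hinj : Function.Injective g := by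
    rw [← LinearMap.ker_eq_bot, LinearMap.ker_eq_bot']
    rintro ⟨w, r⟩ h0
    rw [hg] at h0
    have h1 := congrArg f h0
    rw [map_add, map_smul, hf w w.2, map_zero, zero_add, smul_eq_mul] at h1
    have hr : r = 0 := (mul_eq_zero.1 h1).resolve_right hv
    rw [hr, zero_smul, add_zero] at h0
    simp [hr, Submodule.coe_eq_zero.1 h0]
  have hfin : Module.finrank ℝ (D × ℝ) = Module.finrank ℝ V := by
    rw [Module.finrank_prod, Module.finrank_self, hD]
  exact ⟨(LinearEquiv.ofInjectiveOfFinrankEq g hinj hfin).toContinuousLinearEquiv, hg⟩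

variable [MeasurableSpace V] [BorelSpace V]

theorem measurableSet_coneOver {ℓ : V →ᵃ[ℝ] ℝ} {x₀ : V} {F : Set V} (hF : MeasurableSet F) :
    MeasurableSet (coneOver ℓ x₀ F) := by
  have h1 : Measurable fun x => 1 - ℓ x / ℓ x₀ :=
    ((AffineMap.continuous_of_finiteDimensional ℓ).measurable.div_const _).const_sub _
  have h2 : Measurable fun x => x₀ + (1 - ℓ x / ℓ x₀)⁻¹ • (x - x₀) :=
    (h1.inv.smul (measurable_id.sub_const x₀)).const_add x₀
  exact (h1 measurableSet_Ioc).inter (h2 hF)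

/-- The change of variables contributes `r` to the power `dim D`, at most `1`. The bound degenerates
nowhere as `r → 0`. -/
theorem lintegral_comp_inv_smul_le {D : Type*} [NormedAddCommGroup D] [NormedSpace ℝ D]
    [FiniteDimensional ℝ D] [MeasurableSpace D] [BorelSpace D] (m : Measure D) [m.IsAddHaarMeasure]
    {Φ : D → ℝ≥0∞} (hΦ : Measurable Φ) {r : ℝ} (hr : r ∈ Ioc (0 : ℝ) 1) :
    ∫⁻ w, Φ (r⁻¹ • w) ∂m ≤ ∫⁻ w, Φ w ∂m := by
  rw [← lintegral_map hΦ (measurable_const_smul r⁻¹),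
    Measure.map_addHaar_smul m (inv_ne_zero hr.1.ne'), lintegral_smul_measure]
  refine mul_le_of_le_one_left' ?_
  rw [ENNReal.ofReal_le_one, inv_pow, inv_inv, abs_of_nonneg (pow_nonneg hr.1.le _)]
  exact pow_le_one₀ hr.1.le hr.2

/-- Integration over a cone is dominated by integration over its base and along the rays. -/
theorem exists_lintegral_coneOver_le (m : Measure V) [m.IsAddHaarMeasure] {F : Set V}
    (hF : IsCompact F) {ℓ : V →ᵃ[ℝ] ℝ} (hFℓ : ∀ y ∈ F, ℓ y = 0) {x₀ : V} (hx₀ : 0 < ℓ x₀)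
    (hdim : Module.finrank ℝ (affineSpan ℝ F).direction + 1 = Module.finrank ℝ V)
    {ν : Measure V} (hν : IsFlatMeasure F ν) :
    ∃ C : ℝ≥0∞, C ≠ ∞ ∧ ∀ G : V → ℝ≥0∞, Measurable G →
      ∫⁻ x in coneOver ℓ x₀ F, G x ∂m ≤
        C * ∫⁻ y, (∫⁻ s in Ioc (0 : ℝ) 1, G (x₀ + s • (y - x₀))) ∂ν := by
  have hfin : IsFiniteMeasure ν := ⟨hν.lt_top hF⟩
  obtain ⟨p, hp, mD, hmD, hνeq⟩ := hν
  have hspan : ∀ y ∈ affineSpan ℝ F, ℓ y = 0 := by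
    have hmap : affineSpan ℝ F ≤ (AffineSubspace.comap ℓ (AffineSubspace.mk' 0 ⊥)) :=
      affineSpan_le.2 fun y hy => by
        simp only [AffineSubspace.coe_comap, mem_preimage, SetLike.mem_coe, hFℓ y hy]
        exact AffineSubspace.self_mem_mk' _ _
    intro y hy
    have := hmap hy
    rw [AffineSubspace.mem_comap, AffineSubspace.mem_mk'] at this
    simpa using this
  have hlin : ∀ v ∈ (affineSpan ℝ F).direction, ℓ.linear v = 0 := by
    intro v hv
    have h1 := hspan _ (AffineSubspace.vadd_mem_of_mem_direction hv hp)
    rw [ℓ.map_vadd, hspan p hp] at h1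
    simpa using h1
  have hpx : ℓ.linear (p - x₀) = -ℓ x₀ := by
    have := ℓ.linearMap_vsub p x₀
    rw [vsub_eq_sub, vsub_eq_sub, hspan p hp] at this
    rw [this, zero_sub]
  -- In the coordinates `x = x₀ + w + r (p - x₀)` the ray parameter of `x` is `r` and its projection
  -- to the base is `p + r⁻¹ w`. By uniqueness of Haar measure `m` is a multiple of the product
  -- measure.
  obtain ⟨e, he⟩ := exists_hyperplane_prod_equiv hdim hlin (v := p - x₀)
    (by rw [hpx]; exact neg_ne_zero.2 hx₀.ne')
  have hme : ((mD.prod volume).map e).IsAddHaarMeasure := e.isAddHaarMeasure_map _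
  obtain ⟨c, hc, hmc⟩ : ∃ c : ℝ≥0∞, c ≠ ∞ ∧ m = c • (mD.prod volume).map e :=
    ⟨_, ENNReal.coe_ne_top, Measure.isAddLeftInvariant_eq_smul m ((mD.prod volume).map e)⟩
  refine ⟨c, hc, fun G hG => ?_⟩
  have hcone : MeasurableSet (coneOver ℓ x₀ F) := measurableSet_coneOver hF.measurableSet
  have hK : Measurable ((coneOver ℓ x₀ F).indicator G) := hG.indicator hcone
  have hFm : Measurable (F.indicator (1 : V → ℝ≥0∞)) := measurable_one.indicator hF.measurableSet
  set Φ : ℝ → (affineSpan ℝ F).direction → ℝ≥0∞ := fun r w =>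
    F.indicator 1 ((w : V) + p) * G (x₀ + r • ((w : V) + p - x₀)) with hΦdef
  have hΦm : ∀ r, Measurable (Φ r) := fun r => by
    have h1 : Measurable fun w : (affineSpan ℝ F).direction => (w : V) + p :=
      measurable_subtype_coe.add_const p
    exact (hFm.comp h1).mul (hG.comp (((h1.sub_const x₀).const_smul r).const_add x₀))
  have hpt : ∀ w : (affineSpan ℝ F).direction, ∀ r : ℝ,
      (coneOver ℓ x₀ F).indicator G (e (w, r) + x₀) ≤
        (Ioc (0 : ℝ) 1).indicator (fun r => Φ r (r⁻¹ • w)) r := by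
    intro w r
    by_cases hmem : e (w, r) + x₀ ∈ coneOver ℓ x₀ F
    · have hs : 1 - ℓ (e (w, r) + x₀) / ℓ x₀ = r := by
        have h1 := ℓ.apply_add_smul x₀ (e (w, r)) 1
        have h2 : ℓ.linear (e (w, r)) = -(r * ℓ x₀) := by
          rw [he, map_add, map_smul, hlin w w.2, hpx, smul_eq_mul]
          ring
        rw [one_smul, h2] at h1
        rw [add_comm, h1]
        field_simp
        ring
      rw [indicator_of_mem hmem]
      rw [coneOver, mem_ofPred_eq, hs, add_sub_cancel_right] at hmem
      obtain ⟨hr, hy⟩ := hmem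
      have hy' : x₀ + r⁻¹ • e (w, r) = ((r⁻¹ • w : (affineSpan ℝ F).direction) : V) + p := by
        rw [he, smul_add, smul_smul, inv_mul_cancel₀ hr.1.ne', one_smul, Submodule.coe_smul]
        abel
      rw [hy'] at hy
      rw [indicator_of_mem hr, hΦdef]
      simp only [indicator_of_mem hy, Pi.one_apply, one_mul]
      rw [← hy', add_sub_cancel_left, smul_smul, mul_inv_cancel₀ hr.1.ne', one_smul, add_comm]
    · rw [indicator_of_notMem hmem]
      exact zero_le
  have hmeasJ : Measurable fun q : (affineSpan ℝ F).direction × ℝ =>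
      (coneOver ℓ x₀ F).indicator G (e q + x₀) :=
    hK.comp (e.continuous.measurable.add_const x₀)
  have hinner : ∀ r : ℝ, ∫⁻ w, (coneOver ℓ x₀ F).indicator G (e (w, r) + x₀) ∂mD ≤
      (Ioc (0 : ℝ) 1).indicator (fun r => ∫⁻ y, G (x₀ + r • (y - x₀)) ∂ν) r := by
    intro r
    refine (lintegral_mono fun w => hpt w r).trans ?_
    by_cases hr : r ∈ Ioc (0 : ℝ) 1
    · simp only [indicator_of_mem hr]
      refine (lintegral_comp_inv_smul_le mD (hΦm r) hr).trans_eq ?_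
      have hGr : Measurable fun y => G (x₀ + r • (y - x₀)) :=
        hG.comp (((measurable_id.sub_const x₀).const_smul r).const_add x₀)
      rw [hνeq, ← lintegral_indicator hF.measurableSet, lintegral_map
        (hGr.indicator hF.measurableSet) (measurable_subtype_coe.add_const p)]
      refine lintegral_congr fun w => ?_
      by_cases hw : (w : V) + p ∈ F
      · simp [hΦdef, indicator_of_mem hw]
      · simp [hΦdef, indicator_of_notMem hw]
    · simp [indicator_of_notMem hr]
  calc ∫⁻ x in coneOver ℓ x₀ F, G x ∂m = ∫⁻ x, (coneOver ℓ x₀ F).indicator G (x + x₀) ∂m := by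
        rw [← lintegral_indicator hcone, lintegral_add_right_eq_self]
    _ = c * ∫⁻ q, (coneOver ℓ x₀ F).indicator G (e q + x₀) ∂(mD.prod volume) := by
        have hK' : Measurable fun x => (coneOver ℓ x₀ F).indicator G (x + x₀) :=
          hK.comp (measurable_add_const x₀)
        rw [hmc, lintegral_smul_measure, smul_eq_mul, lintegral_map hK' e.continuous.measurable]
    _ = c * ∫⁻ r, ∫⁻ w, (coneOver ℓ x₀ F).indicator G (e (w, r) + x₀) ∂mD := by
        rw [lintegral_prod_symm _ hmeasJ.aemeasurable]
    _ ≤ c * ∫⁻ r, (Ioc (0 : ℝ) 1).indicator (fun r => ∫⁻ y, G (x₀ + r • (y - x₀)) ∂ν) r := by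
        gcongr with r
        exact hinner r
    _ = c * ∫⁻ y, (∫⁻ s in Ioc (0 : ℝ) 1, G (x₀ + s • (y - x₀))) ∂ν := by
        rw [lintegral_indicator measurableSet_Ioc, lintegral_lintegral_swap]
        have : Measurable fun q : ℝ × V => G (x₀ + q.1 • (q.2 - x₀)) :=
          hG.comp ((measurable_fst.smul (measurable_snd.sub_const x₀)).const_add x₀)
        exact this.aemeasurable

end Cone

/-! ### The function `u log u` along a ray. -/

section Ray

theorem lintegral_biUnion_finset_le {α β : Type*} [MeasurableSpace α] {m : Measure α}
    (L : Finset β) (s : β → Set α) (f : α → ℝ≥0∞) :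
    ∫⁻ x in ⋃ i ∈ L, s i, f x ∂m ≤ ∑ i ∈ L, ∫⁻ x in s i, f x ∂m := by
  classical
  induction L using Finset.induction_on with
  | empty => simp
  | insert a L ha ih =>
    rw [Finset.set_biUnion_insert, Finset.sum_insert ha]
    exact (lintegral_union_le _ _ _).trans (add_le_add le_rfl ih)

/-- The integrand is the derivative of `v ^ s`. This removes the logarithm and is why the entropy
bound is linear in the energy. -/
theorem lintegral_rpow_mul_log {v : ℝ} (hv : 1 ≤ v) :
    ∫⁻ s in Ioc (0 : ℝ) 1, ENNReal.ofReal (v ^ s * Real.log v) = ENNReal.ofReal (v - 1) := by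
  have hv0 : 0 < v := by linarith
  have hcont : Continuous fun s : ℝ => v ^ s * Real.log v :=
    (Real.continuous_const_rpow hv0.ne').mul continuous_const
  rw [← ofReal_integral_eq_lintegral_ofReal
    (hcont.integrableOn_Icc.mono_set Ioc_subset_Icc_self)
    (ae_of_all _ fun s => mul_nonneg (Real.rpow_nonneg hv0.le _) (Real.log_nonneg hv)),
    ← intervalIntegral.integral_of_le zero_le_one,
    intervalIntegral.integral_eq_sub_of_hasDerivAt (f := fun s => v ^ s)
      (fun s _ => Real.hasStrictDerivAt_const_rpow hv0 s |>.hasDerivAt)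
      (hcont.intervalIntegrable 0 1)]
  simp

theorem mul_log_le_mul_log {z v : ℝ} (hz : 0 ≤ z) (hzv : z ≤ v) (hv : 1 ≤ v) :
    z * Real.log z ≤ v * Real.log v := by
  have h0 : 0 ≤ v * Real.log v := mul_nonneg (by linarith) (Real.log_nonneg hv)
  rcases le_total z 1 with h1 | h1
  · exact (mul_nonpos_of_nonneg_of_nonpos hz (Real.log_nonpos hz h1)).trans h0
  · have := Real.log_le_log (by linarith) hzv
    have := Real.log_nonneg h1
    gcongr

/-- Along a ray from an interior point the positive part of `u log u` of a log convex function `u`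
is integrable, with a bound that is linear in the value at the end. -/
theorem LogConvexOn.lintegral_ray_le {V : Type*} [NormedAddCommGroup V] [NormedSpace ℝ V]
    {P : Set V} {u : V → ℝ≥0∞} (hu : LogConvexOn P u) {x₀ y : V} (hx₀ : x₀ ∈ P) (hy : y ∈ P)
    (hyt : u y ≠ ∞) {M : ℝ} (hM : 1 ≤ M) (hux₀ : u x₀ ≤ ENNReal.ofReal M) :
    ∫⁻ s in Ioc (0 : ℝ) 1, ENNReal.ofReal ((u (x₀ + s • (y - x₀))).toReal *
        Real.log (u (x₀ + s • (y - x₀))).toReal) ≤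
      ENNReal.ofReal (M * (1 + Real.log M)) * (u y + ENNReal.ofReal M) := by
  -- Replacing `u y` by `v ≥ 1` keeps `log v` nonnegative. Log convexity then yields `u ≤ M v^s`
  -- along the ray.
  set v := max (u y).toReal M with hv
  have hv1 : 1 ≤ v := hM.trans (le_max_right _ _)
  have hv0 : 0 < v := by linarith
  have hM0 : 0 < M := by linarith
  have hlM : 0 ≤ Real.log M := Real.log_nonneg hM
  have hlv : 0 ≤ Real.log v := Real.log_nonneg hv1
  have hpt : ∀ s ∈ Ioc (0 : ℝ) 1, ENNReal.ofReal ((u (x₀ + s • (y - x₀))).toReal *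
        Real.log (u (x₀ + s • (y - x₀))).toReal) ≤
      ENNReal.ofReal (M * Real.log M * v) +
        ENNReal.ofReal M * ENNReal.ofReal (v ^ s * Real.log v) := by
    intro s hs
    have h1 := hu x₀ hx₀ y hy s hs.1.le hs.2
    have hxs : (1 - s) • x₀ + s • y = x₀ + s • (y - x₀) := by
      rw [smul_sub, sub_smul, one_smul]
      abel
    rw [hxs] at h1
    have h2 : (u (x₀ + s • (y - x₀))).toReal ≤ M * v ^ s := by
      refine ENNReal.toReal_le_of_le_ofReal (by positivity) (h1.trans ?_)
      rw [ENNReal.ofReal_mul hM0.le]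
      refine mul_le_mul' ?_ ?_
      · refine (ENNReal.rpow_le_rpow hux₀ (by linarith [hs.2])).trans ?_
        rw [ENNReal.ofReal_rpow_of_pos hM0]
        refine ENNReal.ofReal_le_ofReal ?_
        calc M ^ (1 - s) ≤ M ^ (1 : ℝ) :=
              Real.rpow_le_rpow_of_exponent_le hM (by linarith [hs.1])
          _ = M := Real.rpow_one M
      · rw [← ENNReal.ofReal_rpow_of_pos hv0]
        refine ENNReal.rpow_le_rpow ?_ hs.1.le
        rw [← ENNReal.ofReal_toReal hyt]
        exact ENNReal.ofReal_le_ofReal (le_max_left _ _)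
    have hvs : 1 ≤ v ^ s := Real.one_le_rpow hv1 hs.1.le
    have hvs' : v ^ s ≤ v := by
      calc v ^ s ≤ v ^ (1 : ℝ) := Real.rpow_le_rpow_of_exponent_le hv1 hs.2
        _ = v := Real.rpow_one v
    rw [← ENNReal.ofReal_mul hM0.le, ← ENNReal.ofReal_add (by positivity) (by positivity)]
    refine ENNReal.ofReal_le_ofReal ((mul_log_le_mul_log ENNReal.toReal_nonneg h2
      (by nlinarith)).trans ?_)
    rw [Real.log_mul hM0.ne' (by positivity), Real.log_rpow hv0]
    have h3 : M * Real.log M * v ^ s ≤ M * Real.log M * v := by gcongr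
    have h4 : M * v ^ s * (s * Real.log v) ≤ M * v ^ s * (1 * Real.log v) := by
      have := hs.2
      gcongr
    linarith
  have hmeas : Measurable fun s : ℝ => ENNReal.ofReal (v ^ s * Real.log v) :=
    ENNReal.measurable_ofReal.comp
      ((Real.continuous_const_rpow hv0.ne').measurable.mul_const _)
  calc _ ≤ ∫⁻ s in Ioc (0 : ℝ) 1, (ENNReal.ofReal (M * Real.log M * v) +
        ENNReal.ofReal M * ENNReal.ofReal (v ^ s * Real.log v)) :=
        setLIntegral_mono' measurableSet_Ioc hpt
    _ = ENNReal.ofReal (M * Real.log M * v) + ENNReal.ofReal M * ENNReal.ofReal (v - 1) := by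
        rw [lintegral_add_left measurable_const, lintegral_const_mul _ hmeas,
          lintegral_rpow_mul_log hv1]
        simp
    _ = ENNReal.ofReal (M * Real.log M * v + M * (v - 1)) := by
        rw [← ENNReal.ofReal_mul hM0.le, ← ENNReal.ofReal_add (by positivity)
          (mul_nonneg hM0.le (by linarith))]
    _ ≤ ENNReal.ofReal (M * (1 + Real.log M) * ((u y).toReal + M)) := by
        refine ENNReal.ofReal_le_ofReal ?_
        have hvle : v ≤ (u y).toReal + M :=
          max_le (by linarith) (by linarith [ENNReal.toReal_nonneg (a := u y)])
        have : M * (1 + Real.log M) * v ≤ M * (1 + Real.log M) * ((u y).toReal + M) := by gcongr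
        nlinarith
    _ = _ := by
        rw [ENNReal.ofReal_mul (by positivity), ENNReal.ofReal_add ENNReal.toReal_nonneg hM0.le,
          ENNReal.ofReal_toReal hyt]

end Ray

/-! ### Bounding the entropy by the energy. -/

namespace SimpleSystem

variable {V : Type*} [NormedAddCommGroup V] [NormedSpace ℝ V] [MeasurableSpace V]
  [FiniteDimensional ℝ V] [BorelSpace V] (S : SimpleSystem V)

/-- States are uniformly bounded at an interior point. -/
theorem exists_le_of_isState {x₀ : V} (hx₀ : x₀ ∈ interior S.P) :
    ∃ M : ℝ, 1 ≤ M ∧ ∀ u, S.IsState u → u x₀ ≤ ENNReal.ofReal M := by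
  obtain ⟨m, _, hm⟩ := S.exists_haar
  obtain ⟨r, hr, hball⟩ := Metric.isOpen_iff.1 isOpen_interior x₀ hx₀
  set B := Metric.ball x₀ r with hB
  have hBP : B ⊆ S.P := hball.trans interior_subset
  have hBm : MeasurableSet B := measurableSet_ball
  have hB0 : m B ≠ 0 := (Metric.measure_ball_pos m x₀ hr).ne'
  have hBt : m B ≠ ∞ := measure_ball_lt_top.ne
  have hrefl : ∀ x ∈ B, x₀ + x₀ - x ∈ B := fun x hx => by
    rw [hB, Metric.mem_ball, dist_eq_norm] at hx ⊢
    rwa [show x₀ + x₀ - x - x₀ = -(x - x₀) by abel, norm_neg]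
  refine ⟨max 1 (2 * S.vol / m B).toReal, le_max_left _ _, fun u hu => ?_⟩
  have hint : ∫⁻ x in B, u x ∂m ≤ S.vol := by
    refine (lintegral_mono_set hBP).trans_eq ?_
    rw [← hm, hu.lintegral_eq]
  -- Average `u x₀ ≤ u x + u (2 x₀ - x)` over a ball centred at `x₀`, which is symmetric under this
  -- reflection.
  have hle : u x₀ * m B ≤ 2 * S.vol := by
    calc u x₀ * m B = ∫⁻ _ in B, u x₀ ∂m := by simp
      _ ≤ ∫⁻ x in B, (u x + u (x₀ + x₀ - x)) ∂m := by
        refine setLIntegral_mono' hBm fun x hx => ?_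
        refine hu.logConvexOn.le_add (hBP hx) (hBP (hrefl x hx)) ?_
        rw [midpoint_eq_smul_add, add_sub_cancel, ← two_smul ℝ x₀, smul_smul]
        norm_num
      _ = ∫⁻ x in B, u x ∂m + ∫⁻ x in B, u (x₀ + x₀ - x) ∂m := by
        refine lintegral_add_left' ?_ _
        exact (hu.lsc.aemeasurable_restrict S.isClosed m).mono_set hBP
      _ = ∫⁻ x in B, u x ∂m + ∫⁻ x in B, u x ∂m := by
        congr 1
        rw [← lintegral_indicator hBm, ← lintegral_indicator hBm,
          ← lintegral_sub_left_eq_self _ (x₀ + x₀)]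
        refine lintegral_congr fun x => ?_
        by_cases hx : x ∈ B
        · rw [indicator_of_mem hx, indicator_of_mem (hrefl x hx), sub_sub_cancel]
        · rw [indicator_of_notMem hx, indicator_of_notMem fun h => hx ?_]
          simpa using hrefl _ h
      _ ≤ 2 * S.vol := by
        rw [two_mul]
        gcongr
  rw [← ENNReal.le_div_iff_mul_le (Or.inl hB0) (Or.inl hBt)] at hle
  have ht : 2 * S.vol / m B ≠ ∞ :=
    ENNReal.div_ne_top (ENNReal.mul_ne_top (by simp) S.vol_ne_top) hB0
  exact (hle.trans (ENNReal.ofReal_toReal ht).ge).trans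
    (ENNReal.ofReal_le_ofReal (le_max_right _ _))

/-- The positive part of `u log u` is integrable for a state `u` of finite energy, with a bound
that is linear in the energy. -/
theorem exists_lintegral_mul_log_le : ∃ C : ℝ≥0∞, C ≠ ∞ ∧ ∀ u, S.IsState u →
    ∫⁻ x, ENNReal.ofReal ((u x).toReal * Real.log (u x).toReal) ∂S.μ ≤
      C * (1 + ∫⁻ x in S.bdry, u x ∂S.σ) := by
  classical
  obtain ⟨x₀, hx₀⟩ := S.interior_nonempty
  obtain ⟨M, hM, hMu⟩ := S.exists_le_of_isState hx₀
  obtain ⟨m, _, hm⟩ := S.exists_haar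
  obtain ⟨L, hPL, hpos, hfacet⟩ := S.simple.1.exists_facets
  have hcpt : ∀ ℓ : V →ᵃ[ℝ] ℝ, IsCompact {x ∈ S.P | ℓ x = 0} := fun ℓ =>
    S.isCompact.inter_right
      (isClosed_eq (AffineMap.continuous_of_finiteDimensional ℓ) continuous_const)
  have hbd : ∀ ℓ ∈ L, {x ∈ S.P | ℓ x = 0} ⊆ S.bdry := fun ℓ hℓ x hx =>
    ⟨hx.1, fun hxi => (hpos ℓ hℓ x hxi).ne' hx.2⟩
  have hcone := fun ℓ (hℓ : ℓ ∈ L) => exists_lintegral_coneOver_le m (hcpt ℓ)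
    (fun y hy => hy.2) (hpos ℓ hℓ x₀ hx₀) (hfacet ℓ hℓ).2.2 (S.flat_σ.2 _ (hfacet ℓ hℓ))
  choose! c hc hcG using hcone
  set K := ENNReal.ofReal (M * (1 + Real.log M)) with hK
  set D : ℝ≥0∞ := 1 + ENNReal.ofReal M * S.σ univ with hD
  have hDt : D ≠ ∞ := ENNReal.add_ne_top.2
    ⟨ENNReal.one_ne_top, ENNReal.mul_ne_top ENNReal.ofReal_ne_top (measure_ne_top _ _)⟩
  refine ⟨K * m S.P + ∑ ℓ ∈ L, c ℓ * (K * D), ENNReal.add_ne_top.2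
    ⟨ENNReal.mul_ne_top ENNReal.ofReal_ne_top S.isCompact.measure_lt_top.ne,
      ENNReal.sum_ne_top.2 fun ℓ hℓ => ENNReal.mul_ne_top (hc ℓ hℓ)
        (ENNReal.mul_ne_top ENNReal.ofReal_ne_top hDt)⟩, fun u hu => ?_⟩
  set I := ∫⁻ x in S.bdry, u x ∂S.σ with hI
  -- For infinite energy the claim holds because the constant is positive, thanks to its term `K * m
  -- S.P`.
  rcases eq_or_ne I ∞ with hItop | hItop
  · rw [hItop, add_top, ENNReal.mul_top]
    · exact le_top
    · refine (add_pos_of_pos_of_nonneg ?_ zero_le).ne'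
      refine ENNReal.mul_pos ?_ ?_
      · rw [hK, Ne, ENNReal.ofReal_eq_zero, not_le]
        have := Real.log_nonneg hM
        positivity
      · rw [← Measure.restrict_apply_self, ← hm]
        exact S.vol_ne_zero
  set ũ := S.P.piecewise u fun _ => ∞ with hũ
  have hũP : ∀ x ∈ S.P, ũ x = u x := fun x hx => piecewise_eq_of_mem _ _ _ hx
  set G : V → ℝ≥0∞ := fun x => ENNReal.ofReal ((ũ x).toReal * Real.log (ũ x).toReal) with hG
  have hGm : Measurable G := by
    have h1 : Measurable fun x => (ũ x).toReal :=
      (hu.lsc.measurable_piecewise S.isClosed).ennreal_toReal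
    exact (h1.mul (Real.measurable_log.comp h1)).ennreal_ofReal
  -- The apex lies in none of the punctured cones, and in dimension `0` it is not a null set, so it
  -- is kept as a separate piece.
  have hPcov : S.P ⊆ {x₀} ∪ ⋃ ℓ ∈ L, coneOver ℓ x₀ {x ∈ S.P | ℓ x = 0} := by
    intro x hx
    by_cases hne : x = x₀
    · exact Or.inl hne
    obtain ⟨ℓ, hℓ, y, hy, s, hs, rfl⟩ := exists_facet_ray S.isCompact hPL
      (fun ℓ hℓ => hpos ℓ hℓ x₀ hx₀) hx hne
    exact Or.inr (mem_iUnion₂.2 ⟨ℓ, hℓ, mem_coneOver (hpos ℓ hℓ x₀ hx₀).ne' hy hy.2 hs⟩)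
  have hx₀P := interior_subset hx₀
  have hGx₀ : G x₀ ≤ K := by
    refine ENNReal.ofReal_le_ofReal ?_
    rw [hũP x₀ hx₀P]
    refine (mul_log_le_mul_log ENNReal.toReal_nonneg (ENNReal.toReal_le_of_le_ofReal
      (by linarith) (hMu u hu)) hM).trans ?_
    nlinarith [Real.log_nonneg hM]
  have hray : ∀ ℓ ∈ L, ∫⁻ x in coneOver ℓ x₀ {x ∈ S.P | ℓ x = 0}, G x ∂m ≤
      c ℓ * (K * D) * (1 + I) := by
    intro ℓ hℓ
    refine (hcG ℓ hℓ G hGm).trans ?_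
    rw [mul_assoc]
    gcongr
    set F := {x ∈ S.P | ℓ x = 0} with hF
    have hFm : MeasurableSet F := (hcpt ℓ).measurableSet
    have hFI : ∫⁻ y in F, u y ∂S.σ ≤ I := lintegral_mono_set (hbd ℓ hℓ)
    have haeF : AEMeasurable u (S.σ.restrict F) := hu.aemeasurable_bdry.mono_set (hbd ℓ hℓ)
    have hfin : ∀ᵐ y ∂S.σ.restrict F, u y ≠ ∞ := by
      filter_upwards [ae_lt_top' haeF (ne_top_of_le_ne_top hItop hFI)] with y hy using hy.ne
    calc _ ≤ ∫⁻ y in F, K * (u y + ENNReal.ofReal M) ∂S.σ := by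
          refine lintegral_mono_ae ?_
          filter_upwards [hfin, ae_restrict_mem hFm] with y hy hyF
          refine le_trans (le_of_eq ?_)
            (hu.logConvexOn.lintegral_ray_le hx₀P hyF.1 hy hM (hMu u hu))
          refine setLIntegral_congr_fun measurableSet_Ioc fun s hs => ?_
          have hmem : x₀ + s • (y - x₀) ∈ S.P :=
            S.convex.add_smul_sub_mem hx₀P hyF.1 ⟨hs.1.le, hs.2⟩
          simp only [hG, hũP _ hmem]
      _ = K * (∫⁻ y in F, u y ∂S.σ + ENNReal.ofReal M * S.σ F) := by
          rw [lintegral_const_mul'' _ (haeF.add_const _), lintegral_add_right' _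
            aemeasurable_const]
          simp
      _ ≤ K * (I + ENNReal.ofReal M * S.σ univ) := by
          gcongr
          exact subset_univ _
      _ ≤ K * D * (1 + I) := by
          rw [mul_assoc]
          gcongr
          rw [hD, add_mul, one_mul, mul_add, mul_one, add_assoc]
          exact le_trans (add_le_add le_rfl le_self_add) le_add_self
  calc ∫⁻ x, ENNReal.ofReal ((u x).toReal * Real.log (u x).toReal) ∂S.μ
      = ∫⁻ x in S.P, G x ∂m := by
        rw [← S.restrict_μ, hm, Measure.restrict_restrict S.measurableSet, inter_self]
        exact setLIntegral_congr_fun S.measurableSet fun x hx => by simp only [hG, hũP x hx]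
    _ ≤ ∫⁻ x in ({x₀} ∩ S.P) ∪ ⋃ ℓ ∈ L, coneOver ℓ x₀ {x ∈ S.P | ℓ x = 0}, G x ∂m := by
        refine lintegral_mono_set fun x hx => ?_
        rcases hPcov hx with h | h
        · exact Or.inl ⟨h, hx⟩
        · exact Or.inr h
    _ ≤ ∫⁻ x in {x₀} ∩ S.P, G x ∂m + ∑ ℓ ∈ L, ∫⁻ x in coneOver ℓ x₀ {x ∈ S.P | ℓ x = 0}, G x ∂m := by
        exact (lintegral_union_le _ _ _).trans
          (add_le_add le_rfl (lintegral_biUnion_finset_le _ _ _))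
    _ ≤ K * m S.P * (1 + I) + ∑ ℓ ∈ L, c ℓ * (K * D) * (1 + I) := by
        refine add_le_add ?_ (Finset.sum_le_sum hray)
        calc ∫⁻ x in {x₀} ∩ S.P, G x ∂m ≤ ∫⁻ _ in {x₀} ∩ S.P, K ∂m := by
              refine setLIntegral_mono' ((measurableSet_singleton _).inter S.measurableSet) ?_
              rintro x ⟨rfl, -⟩
              exact hGx₀
          _ ≤ K * m S.P := by
              rw [setLIntegral_const]
              gcongr
              exact inter_subset_right
          _ ≤ K * m S.P * (1 + I) := le_mul_of_one_le_right' le_self_add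
    _ = _ := by rw [add_mul, Finset.sum_mul]

end SimpleSystem

/-! ### Inequalities for `x log x`. -/

/-- The tangent line at `1`; integrated against the normalization of a state it gives `S ≤ 0`. -/
theorem Real.neg_one_le_mul_log {x : ℝ} (hx : 0 ≤ x) : x - 1 ≤ x * Real.log x := by
  rcases hx.eq_or_lt with rfl | hx
  · simp
  have := Real.one_sub_inv_le_log_of_pos hx
  have h2 := mul_le_mul_of_nonneg_left this hx.le
  rw [mul_sub, mul_inv_cancel₀ hx.ne', mul_one] at h2
  exact h2

/-- A quantitative form of the strict convexity of `x log x`. -/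
theorem Real.mul_log_midpoint_le {a b : ℝ} (ha : 0 ≤ a) (hb : 0 ≤ b) :
    (a + b) / 2 * Real.log ((a + b) / 2) + (√a - √b) ^ 2 / 4 ≤
      (a * Real.log a + b * Real.log b) / 2 := by
  set m := (a + b) / 2 with hm
  have hm0 : 0 ≤ m := by positivity
  rcases hm0.eq_or_lt with h0 | hmpos
  · have ha0 : a = 0 := by linarith
    have hb0 : b = 0 := by linarith
    simp [ha0, hb0, hm]
  -- This is `log y ≤ y - 1` at `y = √m / √c`. Using square roots makes the defect for `c = a, b`
  -- sum to a Hellinger type quantity.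
  have key : ∀ c, 0 ≤ c → 2 * (c - √m * √c) ≤ c * Real.log c - c * Real.log m := by
    intro c hc
    rcases hc.eq_or_lt with rfl | hc
    · simp
    have hsc : 0 < √c := Real.sqrt_pos.2 hc
    have hsm : 0 < √m := Real.sqrt_pos.2 hmpos
    have h1 := Real.log_le_sub_one_of_pos (div_pos hsm hsc)
    rw [Real.log_div hsm.ne' hsc.ne', Real.log_sqrt hmpos.le, Real.log_sqrt hc.le] at h1
    have h2 := mul_le_mul_of_nonneg_left h1 hc.le
    have h3 : c * (√m / √c - 1) = √m * √c - c := by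
      nth_rewrite 1 [← Real.mul_self_sqrt hc.le]
      field_simp
      linear_combination -Real.mul_self_sqrt hc.le
    rw [h3] at h2
    linarith
  have h1 := key a ha
  have h2 := key b hb
  have hsa := Real.sq_sqrt ha
  have hsb := Real.sq_sqrt hb
  have hsm := Real.sq_sqrt hm0
  have h4 : (√a - √b) ^ 2 / 4 ≤ 2 * m - √m * (√a + √b) := by
    have h5 : √a + √b ≤ 2 * √m := by
      refine abs_le_of_sq_le_sq' ?_ (by positivity) |>.2
      nlinarith [sq_nonneg (√a - √b)]
    have h6 : √m * (√a + √b) ≤ (4 * m + (√a + √b) ^ 2) / 4 := by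
      nlinarith [sq_nonneg (2 * √m - (√a + √b))]
    nlinarith
  have hab : a + b = 2 * m := by rw [hm]; ring
  have h5 : a * Real.log m + b * Real.log m = 2 * m * Real.log m := by rw [← add_mul, hab]
  linarith

/-! ### Mixtures of states and states of finite energy. -/

namespace SimpleSystem

variable {V : Type*} [NormedAddCommGroup V] [NormedSpace ℝ V] [MeasurableSpace V]
  {S : SimpleSystem V} {u v : V → ℝ≥0∞}

theorem isState_one : S.IsState fun _ => 1 where
  lsc := continuous_const.lowerSemicontinuous.lowerSemicontinuousOn _
  pos := by simp
  logConvex := by simp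
  normalized := by simp [vol]

variable [BorelSpace V]

theorem IsState.energy_add (hu : S.IsState u) (hv : S.IsState v) (t : ℝ) :
    S.energy (fun x => ENNReal.ofReal (1 - t) * u x + ENNReal.ofReal t * v x) =
      ENNReal.ofReal (1 - t) * S.energy u + ENNReal.ofReal t * S.energy v := by
  rw [energy, lintegral_add_left' (hu.aemeasurable_bdry.const_mul _),
    lintegral_const_mul'' _ hu.aemeasurable_bdry, lintegral_const_mul'' _ hv.aemeasurable_bdry,
    ENNReal.add_div, mul_div_assoc, mul_div_assoc, energy, energy]

variable [FiniteDimensional ℝ V]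

theorem energy_ne_top_iff : S.energy u ≠ ∞ ↔ ∫⁻ x in S.bdry, u x ∂S.σ ≠ ∞ := by
  rw [energy, Ne, ENNReal.div_eq_top]
  simp [S.vol_ne_zero, S.vol_ne_top]

theorem lintegral_bdry_eq : ∫⁻ x in S.bdry, u x ∂S.σ = S.energy u * S.vol := by
  rw [energy, ENNReal.div_mul_cancel S.vol_ne_zero S.vol_ne_top]

theorem energy_one_ne_top : S.energy (fun _ => 1) ≠ ∞ := by
  rw [energy_ne_top_iff]
  simp

theorem IsState.add (hu : S.IsState u) (hv : S.IsState v) {t : ℝ} (ht : t ∈ Ioo (0 : ℝ) 1) :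
    S.IsState fun x => ENNReal.ofReal (1 - t) * u x + ENNReal.ofReal t * v x where
  lsc := by
    have hmul : ∀ (c : ℝ≥0∞) {w : V → ℝ≥0∞}, c ≠ ∞ → LowerSemicontinuousOn w S.P →
        LowerSemicontinuousOn (fun x => c * w x) S.P := fun c w hc hw =>
      (ENNReal.continuous_const_mul hc).comp_lowerSemicontinuousOn hw
        fun a b hab => mul_le_mul_right hab c
    exact (hmul _ ENNReal.ofReal_ne_top hu.lsc).add (hmul _ ENNReal.ofReal_ne_top hv.lsc)
  pos x hx := by
    refine add_pos_of_pos_of_nonneg (ENNReal.mul_pos ?_ (hu.pos x hx).ne') zero_le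
    simpa using ht.2
  logConvex := (hu.logConvexOn.const_mul (by simpa using ht.2) ENNReal.ofReal_ne_top).add
    (hv.logConvexOn.const_mul (by simpa using ht.1) ENNReal.ofReal_ne_top)
  normalized := by
    rw [restrict_μ, lintegral_add_left' (hu.aemeasurable.const_mul _),
      lintegral_const_mul'' _ hu.aemeasurable, lintegral_const_mul'' _ hv.aemeasurable,
      hu.lintegral_eq, hv.lintegral_eq, ← add_mul,
      ← ENNReal.ofReal_add (by linarith [ht.2]) ht.1.le]
    simp

theorem IsState.integrable_toReal (hu : S.IsState u) : Integrable (fun x => (u x).toReal) S.μ :=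
  integrable_toReal_of_lintegral_ne_top hu.aemeasurable
    (by rw [hu.lintegral_eq]; exact S.vol_ne_top)

theorem IsState.integral_toReal (hu : S.IsState u) : ∫ x, (u x).toReal ∂S.μ = S.vol.toReal := by
  rw [MeasureTheory.integral_toReal hu.aemeasurable (hu.ae_ne_top.mono fun x hx => hx.lt_top),
    hu.lintegral_eq]

theorem IsState.aestronglyMeasurable_mul_log (hu : S.IsState u) :
    AEStronglyMeasurable (fun x => (u x).toReal * Real.log (u x).toReal) S.μ :=
  (hu.aemeasurable.ennreal_toReal.mul
    (Real.measurable_log.comp_aemeasurable hu.aemeasurable.ennreal_toReal)).aestronglyMeasurable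

/-- The negative part of `x log x` is at most `1`, and the positive part is controlled by the
energy. Finite energy thus implies finite entropy. -/
theorem IsState.integrable_mul_log (hu : S.IsState u) (hE : S.energy u ≠ ∞) :
    Integrable (fun x => (u x).toReal * Real.log (u x).toReal) S.μ := by
  obtain ⟨C, hC, hCu⟩ := S.exists_lintegral_mul_log_le
  refine ⟨hu.aestronglyMeasurable_mul_log, ?_⟩
  have hle : ∀ x, ‖(u x).toReal * Real.log (u x).toReal‖ₑ ≤
      ENNReal.ofReal ((u x).toReal * Real.log (u x).toReal) + 1 := by
    intro x
    have h1 := Real.neg_one_le_mul_log (ENNReal.toReal_nonneg (a := u x))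
    have h0 := ENNReal.toReal_nonneg (a := u x)
    set z := (u x).toReal * Real.log (u x).toReal
    rw [Real.enorm_eq_ofReal_abs]
    rcases le_total 0 z with hz | hz
    · rw [abs_of_nonneg hz]
      exact le_self_add
    · rw [abs_of_nonpos hz]
      refine le_trans ?_ le_add_self
      rw [ENNReal.ofReal_le_one]
      linarith
  refine (lintegral_mono hle).trans_lt ?_
  rw [lintegral_add_right _ measurable_const]
  refine ENNReal.add_lt_top.2 ⟨(hCu u hu).trans_lt ?_, by simp⟩
  exact (ENNReal.mul_ne_top hC (ENNReal.add_ne_top.2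
    ⟨ENNReal.one_ne_top, energy_ne_top_iff.1 hE⟩)).lt_top

/-- The entropy as a real number. -/
def entropyReal (S : SimpleSystem V) (u : V → ℝ≥0∞) : ℝ :=
  -((∫ x, (u x).toReal * Real.log (u x).toReal ∂S.μ) / S.vol.toReal)

theorem IsState.entropy_eq (hu : S.IsState u) (hE : S.energy u ≠ ∞) :
    S.entropy u = S.entropyReal u := by
  rw [entropy, IntegrableOn, restrict_μ, if_pos (hu.integrable_mul_log hE), entropyReal]

theorem IsState.entropyReal_nonpos (hu : S.IsState u) (hE : S.energy u ≠ ∞) :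
    S.entropyReal u ≤ 0 := by
  rw [entropyReal, neg_nonpos]
  refine div_nonneg ?_ ENNReal.toReal_nonneg
  have h : ∫ x, ((u x).toReal - 1) ∂S.μ ≤ ∫ x, (u x).toReal * Real.log (u x).toReal ∂S.μ :=
    integral_mono (hu.integrable_toReal.sub (integrable_const 1)) (hu.integrable_mul_log hE)
      fun x => Real.neg_one_le_mul_log ENNReal.toReal_nonneg
  rw [integral_sub hu.integrable_toReal (integrable_const 1), hu.integral_toReal] at h
  have hv : S.μ.real univ = S.vol.toReal := S.real_univ
  rw [integral_const, hv, smul_eq_mul, mul_one, sub_self] at h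
  exact h

variable (S) in
theorem exists_entropyReal_ge : ∃ C : ℝ, ∀ u, S.IsState u → S.energy u ≠ ∞ →
    -(C * (1 + (S.energy u).toReal)) ≤ S.entropyReal u := by
  obtain ⟨C, hC, hCu⟩ := S.exists_lintegral_mul_log_le
  refine ⟨C.toReal * (1 + S.vol.toReal) / S.vol.toReal, fun u hu hE => ?_⟩
  have hI : Integrable (fun x => (u x).toReal * Real.log (u x).toReal) S.μ :=
    hu.integrable_mul_log hE
  have hle : ∫ x, (u x).toReal * Real.log (u x).toReal ∂S.μ ≤
      C.toReal * (1 + S.vol.toReal * (S.energy u).toReal) := by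
    have h1 := integral_eq_lintegral_pos_part_sub_lintegral_neg_part hI
    rw [h1]
    refine (sub_le_self _ ENNReal.toReal_nonneg).trans ?_
    have h2 := hCu u hu
    rw [lintegral_bdry_eq] at h2
    refine (ENNReal.toReal_mono (ENNReal.mul_ne_top hC (ENNReal.add_ne_top.2
      ⟨ENNReal.one_ne_top, ENNReal.mul_ne_top hE S.vol_ne_top⟩)) h2).trans_eq ?_
    rw [ENNReal.toReal_mul, ENNReal.toReal_add ENNReal.one_ne_top
      (ENNReal.mul_ne_top hE S.vol_ne_top), ENNReal.toReal_mul, ENNReal.toReal_one]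
    ring
  rw [entropyReal, neg_le_neg_iff, div_mul_eq_mul_div]
  refine div_le_div_of_nonneg_right (hle.trans ?_) S.vol_toReal_pos.le
  rw [mul_assoc]
  refine mul_le_mul_of_nonneg_left ?_ ENNReal.toReal_nonneg
  nlinarith [S.vol_toReal_pos, ENNReal.toReal_nonneg (a := S.energy u)]

/-- The states of finite energy. -/
def FiniteState (S : SimpleSystem V) : Type _ := {u : V → ℝ≥0∞ // S.IsState u ∧ S.energy u ≠ ∞}

/-! ### The square root embedding into `L²`. -/

namespace FiniteState

/-- The energy of a state of finite energy. -/
def energy (x : S.FiniteState) : ℝ := (S.energy x.1).toReal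

/-- The entropy of a state of finite energy. -/
def entropy (x : S.FiniteState) : ℝ := S.entropyReal x.1

/-- The uniform state. -/
def one (S : SimpleSystem V) : S.FiniteState := ⟨fun _ => 1, isState_one, energy_one_ne_top⟩

theorem memLp_sqrt (x : S.FiniteState) : MemLp (fun y => √(x.1 y).toReal) 2 S.μ := by
  have hm : AEStronglyMeasurable (fun y => √(x.1 y).toReal) S.μ :=
    x.2.1.aemeasurable.ennreal_toReal.sqrt.aestronglyMeasurable
  rw [memLp_two_iff_integrable_sq hm]
  simpa only [Real.sq_sqrt ENNReal.toReal_nonneg] using x.2.1.integrable_toReal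

/-- The square root of a state, as an element of `L²`. -/
def sqrtLp (x : S.FiniteState) : Lp ℝ 2 S.μ := x.memLp_sqrt.toLp _

theorem coeFn_sqrtLp (x : S.FiniteState) : x.sqrtLp =ᵐ[S.μ] fun y => √(x.1 y).toReal :=
  x.memLp_sqrt.coeFn_toLp

theorem _root_.MeasureTheory.Lp.norm_sq_eq_integral {α : Type*} [MeasurableSpace α] {μ : Measure α}
    (f : Lp ℝ 2 μ) : ‖f‖ ^ 2 = ∫ x, f x ^ 2 ∂μ := by
  rw [← real_inner_self_eq_norm_sq, L2.inner_def]
  refine integral_congr_ae (ae_of_all _ fun x => ?_)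
  simp

theorem dist_sq (x y : S.FiniteState) :
    dist x.sqrtLp y.sqrtLp ^ 2 = ∫ z, (√(x.1 z).toReal - √(y.1 z).toReal) ^ 2 ∂S.μ := by
  rw [dist_eq_norm, Lp.norm_sq_eq_integral]
  refine integral_congr_ae ?_
  filter_upwards [Lp.coeFn_sub x.sqrtLp y.sqrtLp, x.coeFn_sqrtLp, y.coeFn_sqrtLp] with z h1 h2 h3
  rw [h1, Pi.sub_apply, h2, h3]

theorem exists_segment (x y : S.FiniteState) {t : ℝ} (ht : t ∈ Ioo (0 : ℝ) 1) :
    ∃ z : S.FiniteState, z.energy = (1 - t) * x.energy + t * y.energy ∧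
      ∀ᵐ a ∂S.μ, (z.1 a).toReal = (1 - t) * (x.1 a).toReal + t * (y.1 a).toReal := by
  have hE := x.2.1.energy_add y.2.1 t
  have h1 : 0 ≤ 1 - t := by linarith [ht.2]
  have hxt := ENNReal.mul_ne_top (ENNReal.ofReal_ne_top (r := 1 - t)) x.2.2
  have hyt := ENNReal.mul_ne_top (ENNReal.ofReal_ne_top (r := t)) y.2.2
  refine ⟨⟨_, x.2.1.add y.2.1 ht, ?_⟩, ?_, ?_⟩
  · rw [hE]
    exact ENNReal.add_ne_top.2 ⟨hxt, hyt⟩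
  · refine (congrArg ENNReal.toReal hE).trans ?_
    rw [ENNReal.toReal_add hxt hyt, ENNReal.toReal_mul, ENNReal.toReal_mul,
      ENNReal.toReal_ofReal h1, ENNReal.toReal_ofReal ht.1.le]
    rfl
  · filter_upwards [x.2.1.ae_ne_top, y.2.1.ae_ne_top] with a hxa hya
    rw [ENNReal.toReal_add (ENNReal.mul_ne_top ENNReal.ofReal_ne_top hxa)
      (ENNReal.mul_ne_top ENNReal.ofReal_ne_top hya), ENNReal.toReal_mul, ENNReal.toReal_mul,
      ENNReal.toReal_ofReal h1, ENNReal.toReal_ofReal ht.1.le]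

theorem integrable_mul_log (x : S.FiniteState) :
    Integrable (fun a => (x.1 a).toReal * Real.log (x.1 a).toReal) S.μ :=
  x.2.1.integrable_mul_log x.2.2

theorem segment_entropy (x y : S.FiniteState) (t : ℝ) (ht0 : 0 ≤ t) (ht1 : t ≤ 1) :
    ∃ z : S.FiniteState, z.energy = (1 - t) * x.energy + t * y.energy ∧
      (1 - t) * x.entropy + t * y.entropy ≤ z.entropy := by
  rcases ht0.eq_or_lt with rfl | ht0
  · exact ⟨x, by simp, by simp⟩
  rcases ht1.eq_or_lt with rfl | ht1
  · exact ⟨y, by simp, by simp⟩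
  obtain ⟨z, hzE, hz⟩ := x.exists_segment y ⟨ht0, ht1⟩
  refine ⟨z, hzE, ?_⟩
  have hle : ∫ a, (z.1 a).toReal * Real.log (z.1 a).toReal ∂S.μ ≤
      (1 - t) * ∫ a, (x.1 a).toReal * Real.log (x.1 a).toReal ∂S.μ +
        t * ∫ a, (y.1 a).toReal * Real.log (y.1 a).toReal ∂S.μ := by
    rw [← integral_const_mul, ← integral_const_mul,
      ← integral_add (x.integrable_mul_log.const_mul _) (y.integrable_mul_log.const_mul _)]
    refine integral_mono_ae z.integrable_mul_log
      ((x.integrable_mul_log.const_mul _).add (y.integrable_mul_log.const_mul _)) ?_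
    filter_upwards [hz] with a ha
    have := Real.convexOn_mul_log.2 (mem_Ici.2 (ENNReal.toReal_nonneg (a := x.1 a)))
      (mem_Ici.2 (ENNReal.toReal_nonneg (a := y.1 a))) (sub_nonneg.2 ht1.le) ht0.le (by ring)
    simpa only [smul_eq_mul, ha] using this
  rw [entropy, entropy, entropy, entropyReal, entropyReal, entropyReal, mul_neg, mul_neg, ← neg_add,
    neg_le_neg_iff, ← mul_div_assoc, ← mul_div_assoc, ← add_div]
  exact div_le_div_of_nonneg_right hle S.vol_toReal_pos.le

/-- Integrating `Real.mul_log_midpoint_le` turns the pointwise defect into the squared `L²` distance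
of the square roots. -/
theorem midpoint_entropy (x y : S.FiniteState) :
    ∃ z : S.FiniteState, z.energy = (x.energy + y.energy) / 2 ∧
      (x.entropy + y.entropy) / 2 + 1 / (4 * S.vol.toReal) * dist x.sqrtLp y.sqrtLp ^ 2 ≤
        z.entropy := by
  obtain ⟨z, hzE, hz⟩ := x.exists_segment y (t := 1 / 2) (by norm_num)
  refine ⟨z, by rw [hzE]; ring, ?_⟩
  have hsq : Integrable (fun a => (√(x.1 a).toReal - √(y.1 a).toReal) ^ 2) S.μ :=
    (x.memLp_sqrt.sub y.memLp_sqrt).integrable_sq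
  have hle : ∫ a, (z.1 a).toReal * Real.log (z.1 a).toReal ∂S.μ + dist x.sqrtLp y.sqrtLp ^ 2 / 4 ≤
      (∫ a, (x.1 a).toReal * Real.log (x.1 a).toReal ∂S.μ +
        ∫ a, (y.1 a).toReal * Real.log (y.1 a).toReal ∂S.μ) / 2 := by
    rw [dist_sq, ← integral_div, ← integral_add x.integrable_mul_log y.integrable_mul_log,
      ← integral_div, ← integral_add z.integrable_mul_log (hsq.div_const 4)]
    refine integral_mono_ae (z.integrable_mul_log.add (hsq.div_const 4))
      ((x.integrable_mul_log.add y.integrable_mul_log).div_const 2) ?_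
    filter_upwards [hz] with a ha
    have := Real.mul_log_midpoint_le (ENNReal.toReal_nonneg (a := x.1 a))
      (ENNReal.toReal_nonneg (a := y.1 a))
    have h2 : (z.1 a).toReal = ((x.1 a).toReal + (y.1 a).toReal) / 2 := by rw [ha]; ring
    simpa only [h2] using this
  have hv := S.vol_toReal_pos
  rw [entropy, entropy, entropy, entropyReal, entropyReal, entropyReal]
  have h1 := div_le_div_of_nonneg_right hle hv.le
  have h2 : ∀ a b c d : ℝ, (a + d / 4) / S.vol.toReal ≤ ((b + c) / 2) / S.vol.toReal →
      (-(b / S.vol.toReal) + -(c / S.vol.toReal)) / 2 + 1 / (4 * S.vol.toReal) * d ≤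
        -(a / S.vol.toReal) := by
    intro a b c d h
    have e1 : (a + d / 4) / S.vol.toReal = a / S.vol.toReal + 1 / (4 * S.vol.toReal) * d := by
      field_simp
    have e2 : ((b + c) / 2) / S.vol.toReal = (b / S.vol.toReal + c / S.vol.toReal) / 2 := by
      field_simp
    rw [e1, e2] at h
    linarith
  exact h2 _ _ _ _ h1

theorem exists_subseq_ae {x : ℕ → S.FiniteState} {y : Lp ℝ 2 S.μ}
    (h : Tendsto (fun j => (x j).sqrtLp) atTop (𝓝 y)) :
    ∃ ns : ℕ → ℕ, StrictMono ns ∧ ∀ᵐ a ∂S.μ,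
      Tendsto (fun j => (x (ns j)).1 a) atTop (𝓝 (ENNReal.ofReal (y a ^ 2))) := by
  obtain ⟨ns, hns, hlim⟩ := (tendstoInMeasure_of_tendsto_Lp h).exists_seq_tendsto_ae
  refine ⟨ns, hns, ?_⟩
  filter_upwards [hlim, ae_all_iff.2 fun j => (x (ns j)).coeFn_sqrtLp,
    ae_all_iff.2 fun j => (x (ns j)).2.1.ae_ne_top] with a ha hx hfin
  refine ((ENNReal.continuous_ofReal.tendsto _).comp (ha.pow 2)).congr fun j => ?_
  simp only [Function.comp_apply]
  rw [hx j, Real.sq_sqrt ENNReal.toReal_nonneg, ENNReal.ofReal_toReal (hfin j)]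

/-- All states lie on one sphere of `L²`, so no mass is lost in a strong limit. -/
theorem norm_sq_sqrtLp (x : S.FiniteState) : ‖x.sqrtLp‖ ^ 2 = S.vol.toReal := by
  rw [Lp.norm_sq_eq_integral, ← x.2.1.integral_toReal]
  refine integral_congr_ae ?_
  filter_upwards [x.coeFn_sqrtLp] with a ha
  rw [ha, Real.sq_sqrt ENNReal.toReal_nonneg]

theorem lintegral_bdry_le (x : S.FiniteState) {A : ℝ} (hA : x.energy ≤ A) :
    ∫⁻ a in S.bdry, x.1 a ∂S.σ ≤ ENNReal.ofReal A * S.vol := by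
  rw [lintegral_bdry_eq]
  gcongr
  rw [← ENNReal.ofReal_toReal x.2.2]
  exact ENNReal.ofReal_le_ofReal hA

theorem exists_limit (x : ℕ → S.FiniteState) (y : Lp ℝ 2 S.μ) (A : ℝ) (hA : ∀ j, (x j).energy ≤ A)
    (h : Tendsto (fun j => (x j).sqrtLp) atTop (𝓝 y)) : ∃ z : S.FiniteState, z.sqrtLp = y := by
  obtain ⟨ns, hns, hlim⟩ := exists_subseq_ae h
  have hint : ∫⁻ a, ENNReal.ofReal (y a ^ 2) ∂S.μ = S.vol := by
    rw [← ofReal_integral_eq_lintegral_ofReal (Lp.memLp y).integrable_sq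
      (ae_of_all _ fun a => sq_nonneg _), ← Lp.norm_sq_eq_integral]
    have h1 : Tendsto (fun j => ‖(x j).sqrtLp‖ ^ 2) atTop (𝓝 (‖y‖ ^ 2)) := h.norm.pow 2
    simp only [norm_sq_sqrtLp] at h1
    rw [tendsto_nhds_unique h1 tendsto_const_nhds, ENNReal.ofReal_toReal S.vol_ne_top]
  obtain ⟨v, hv, hvae⟩ := IsState.exists_of_ae_tendsto (fun j => (x (ns j)).2.1)
    (ae_of_all _ fun a => ENNReal.ofReal_ne_top) hint hlim
  have hE : ∫⁻ a in S.bdry, v a ∂S.σ ≤ ENNReal.ofReal A * S.vol :=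
    IsState.lintegral_bdry_le (fun j => (x (ns j)).2.1) hv
      (by filter_upwards [hlim, hvae] with a h1 h2; rwa [h2])
      fun j => (x (ns j)).lintegral_bdry_le (hA _)
  refine ⟨⟨v, hv, energy_ne_top_iff.2 (ne_top_of_le_ne_top
    (ENNReal.mul_ne_top ENNReal.ofReal_ne_top S.vol_ne_top) hE)⟩, ?_⟩
  refine Lp.ext ?_
  obtain ⟨ms, -, hlim'⟩ := (tendstoInMeasure_of_tendsto_Lp h).exists_seq_tendsto_ae
  filter_upwards [coeFn_sqrtLp (S := S) ⟨v, hv, energy_ne_top_iff.2 (ne_top_of_le_ne_top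
    (ENNReal.mul_ne_top ENNReal.ofReal_ne_top S.vol_ne_top) hE)⟩, hvae, hlim',
    ae_all_iff.2 fun j => (x (ms j)).coeFn_sqrtLp] with a h1 h2 h3 h4
  -- As a limit of square roots `y` is nonnegative, so it is the square root of its own square.
  have h5 : 0 ≤ y a := ge_of_tendsto' h3 fun j => by rw [h4 j]; exact Real.sqrt_nonneg _
  rw [h1]
  simp only [h2]
  rw [ENNReal.toReal_ofReal (sq_nonneg _), Real.sqrt_sq h5]

theorem exists_subseq_ae' {x : ℕ → S.FiniteState} {z : S.FiniteState}
    (h : Tendsto (fun j => (x j).sqrtLp) atTop (𝓝 z.sqrtLp)) :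
    ∃ ns : ℕ → ℕ, StrictMono ns ∧ ∀ᵐ a ∂S.μ,
      Tendsto (fun j => (x (ns j)).1 a) atTop (𝓝 (z.1 a)) := by
  obtain ⟨ns, hns, hlim⟩ := exists_subseq_ae h
  refine ⟨ns, hns, ?_⟩
  filter_upwards [hlim, z.coeFn_sqrtLp, z.2.1.ae_ne_top] with a h1 h2 h3
  rwa [h2, Real.sq_sqrt ENNReal.toReal_nonneg, ENNReal.ofReal_toReal h3] at h1

theorem energy_lsc (x : ℕ → S.FiniteState) (z : S.FiniteState) (A : ℝ)
    (hA : ∀ j, (x j).energy ≤ A) (h : Tendsto (fun j => (x j).sqrtLp) atTop (𝓝 z.sqrtLp)) :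
    z.energy ≤ A := by
  obtain ⟨ns, hns, hlim⟩ := exists_subseq_ae' h
  have hE : ∫⁻ a in S.bdry, z.1 a ∂S.σ ≤ ENNReal.ofReal A * S.vol :=
    IsState.lintegral_bdry_le (fun j => (x (ns j)).2.1) z.2.1 hlim
      fun j => (x (ns j)).lintegral_bdry_le (hA _)
  have hA0 : 0 ≤ A := ENNReal.toReal_nonneg.trans (hA 0)
  refine ENNReal.toReal_le_of_le_ofReal hA0 ?_
  rwa [lintegral_bdry_eq, ENNReal.mul_le_mul_iff_left S.vol_ne_zero S.vol_ne_top] at hE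

/-- Adding `1` makes `u log u` nonnegative, which prepares Fatou's lemma for the semicontinuity of
the entropy. -/
theorem ofReal_integral_add_vol (x : S.FiniteState) :
    ∫⁻ a, ENNReal.ofReal ((x.1 a).toReal * Real.log (x.1 a).toReal + 1) ∂S.μ =
      ENNReal.ofReal (S.vol.toReal * (1 - x.entropy)) := by
  have hint : Integrable (fun a => (x.1 a).toReal * Real.log (x.1 a).toReal + 1) S.μ :=
    x.integrable_mul_log.add (integrable_const 1)
  rw [← ofReal_integral_eq_lintegral_ofReal hint
    (ae_of_all _ fun a => ?_), integral_add x.integrable_mul_log (integrable_const 1)]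
  · have hv : S.μ.real univ = S.vol.toReal := S.real_univ
    congr 1
    rw [integral_const, hv, entropy, entropyReal]
    have := S.vol_toReal_pos
    simp only [smul_eq_mul, mul_one]
    field_simp
    ring
  · have := Real.neg_one_le_mul_log (ENNReal.toReal_nonneg (a := x.1 a))
    have := ENNReal.toReal_nonneg (a := x.1 a)
    simp only [Pi.zero_apply]
    linarith

theorem entropy_nonpos (x : S.FiniteState) : x.entropy ≤ 0 := x.2.1.entropyReal_nonpos x.2.2

theorem entropy_usc (x : ℕ → S.FiniteState) (z : S.FiniteState) (A : ℝ)
    (hA : ∀ j, A ≤ (x j).entropy) (h : Tendsto (fun j => (x j).sqrtLp) atTop (𝓝 z.sqrtLp)) :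
    A ≤ z.entropy := by
  obtain ⟨ns, hns, hlim⟩ := exists_subseq_ae' h
  have hA0 : A ≤ 0 := (hA 0).trans (x 0).entropy_nonpos
  have hv := S.vol_toReal_pos
  have hcont : Continuous fun r : ℝ => ENNReal.ofReal (r * Real.log r + 1) :=
    ENNReal.continuous_ofReal.comp (Real.continuous_mul_log.add continuous_const)
  have hle : ∫⁻ a, ENNReal.ofReal ((z.1 a).toReal * Real.log (z.1 a).toReal + 1) ∂S.μ ≤
      ENNReal.ofReal (S.vol.toReal * (1 - A)) := by
    calc _ ≤ ∫⁻ a, liminf (fun j => ENNReal.ofReal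
            (((x (ns j)).1 a).toReal * Real.log ((x (ns j)).1 a).toReal + 1)) atTop ∂S.μ := by
          refine lintegral_mono_ae ?_
          filter_upwards [hlim, z.2.1.ae_ne_top] with a h1 h2
          have h3 := (hcont.tendsto _).comp ((ENNReal.tendsto_toReal h2).comp h1)
          exact h3.liminf_eq.ge
      _ ≤ liminf (fun j => ∫⁻ a, ENNReal.ofReal
            (((x (ns j)).1 a).toReal * Real.log ((x (ns j)).1 a).toReal + 1) ∂S.μ) atTop :=
          lintegral_liminf_le' fun j =>
            ((x (ns j)).2.1.aestronglyMeasurable_mul_log.aemeasurable.add_const 1).ennreal_ofReal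
      _ ≤ ENNReal.ofReal (S.vol.toReal * (1 - A)) := by
          refine (liminf_le_liminf (v := fun _ => ENNReal.ofReal (S.vol.toReal * (1 - A)))
            (Eventually.of_forall fun j => ?_)).trans_eq (liminf_const _)
          rw [ofReal_integral_add_vol]
          have := hA (ns j)
          gcongr
  rw [ofReal_integral_add_vol, ENNReal.ofReal_le_ofReal_iff (by nlinarith)] at hle
  nlinarith

variable (S) in
theorem exists_energyEntropySystem : ∃ C : ℝ,
    EnergyEntropySystem (energy (S := S)) entropy sqrtLp (one S) (1 / (4 * S.vol.toReal)) C := by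
  obtain ⟨C, hC⟩ := S.exists_entropyReal_ge
  exact ⟨C, { energy_nonneg := fun x => ENNReal.toReal_nonneg
              entropy_nonpos := entropy_nonpos
              entropy_top := by simp [entropy, entropyReal, one]
              c_pos := by have := S.vol_toReal_pos; positivity
              segment := segment_entropy
              midpoint := midpoint_entropy
              closed := fun x y A => exists_limit x y A
              energy_lsc := energy_lsc
              entropy_usc := entropy_usc
              entropy_bound := fun x => hC x.1 x.2.1 x.2.2 }⟩

end FiniteState
end SimpleSystem

/-- A convex function on a compact convex set with interior is bounded below. -/
theorem ConvexOn.exists_le_of_isCompact {V : Type*} [NormedAddCommGroup V] [NormedSpace ℝ V]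
    [FiniteDimensional ℝ V] {P : Set V} {q : V → ℝ} (hq : ConvexOn ℝ P q) (hP : IsCompact P)
    (hi : (interior P).Nonempty) : ∃ K : ℝ, ∀ x ∈ P, K ≤ q x := by
  obtain ⟨x₀, hx₀⟩ := hi
  obtain ⟨g, hg⟩ := (hq.subset interior_subset hq.1.interior).exists_subgradient isOpen_interior hx₀
  obtain ⟨K, hK⟩ := hP.bddBelow_image (f := fun x => g (x - x₀)) (by fun_prop)
  refine ⟨q x₀ + K, fun x hx => ?_⟩
  have hgK : K ≤ g (x - x₀) := hK ⟨x, hx, rfl⟩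
  -- The supporting function at `x₀` is available only in the interior; evaluating it at the
  -- midpoint of `x` and `x₀` transfers the bound to boundary points.
  have hz := hq.1.combo_self_interior_mem_interior hx hx₀ (a := (1 / 2 : ℝ)) (b := 1 / 2) (by norm_num)
    (by norm_num) (by norm_num)
  have h1 := hg _ hz
  have h2 := hq.2 hx (interior_subset hx₀) (by norm_num : (0 : ℝ) ≤ 1 / 2)
    (by norm_num : (0 : ℝ) ≤ 1 / 2) (by norm_num)
  have h3 : (1 / 2 : ℝ) • x + (1 / 2 : ℝ) • x₀ - x₀ = (1 / 2 : ℝ) • (x - x₀) := by module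
  rw [h3, map_smul] at h1
  simp only [smul_eq_mul] at h1 h2
  linarith

theorem Real.mul_log_le_mul_sub_one {x : ℝ} (hx : 0 ≤ x) : x * Real.log x ≤ x * (x - 1) := by
  rcases hx.eq_or_lt with rfl | hx
  · simp
  · exact mul_le_mul_of_nonneg_left (Real.log_le_sub_one_of_pos hx) hx.le

/-! ### K-stability and the uniform state. -/

namespace SimpleSystem

variable {V : Type*} [NormedAddCommGroup V] [NormedSpace ℝ V] [MeasurableSpace V]
  [FiniteDimensional ℝ V] [BorelSpace V] {S : SimpleSystem V} {u : V → ℝ≥0∞} {q : V → ℝ}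

theorem donaldsonFutaki_neg_iff : S.donaldsonFutaki q < 0 ↔
    (∫ x in S.bdry, q x ∂S.σ) * S.vol.toReal < (S.σ S.bdry).toReal * ∫ x, q x ∂S.μ := by
  have hv := S.vol_toReal_pos
  have hc : 0 < 2 * Real.pi / S.vol.toReal := by positivity
  rw [donaldsonFutaki, restrict_μ, mul_neg_iff, and_iff_right hc,
    or_iff_left (fun h => hc.not_gt h.1), sub_neg, div_mul_eq_mul_div,
    lt_div_iff₀ hv]

theorem integrable_of_continuousOn (hq : ContinuousOn q S.P) : Integrable q S.μ := by
  rw [← S.restrict_μ]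
  exact hq.integrableOn_compact S.isCompact

theorem integrableOn_bdry_of_continuousOn (hq : ContinuousOn q S.P) : IntegrableOn q S.bdry S.σ :=
  (hq.integrableOn_compact S.isCompact).mono_set S.bdry_subset

theorem isKUnstable_of_continuousOn (hq : ContinuousOn q S.P) (hc : ConvexOn ℝ S.P q)
    (h : (∫ x in S.bdry, q x ∂S.σ) * S.vol.toReal < (S.σ S.bdry).toReal * ∫ x, q x ∂S.μ) :
    S.IsKUnstable :=
  ⟨q, hc, (integrable_of_continuousOn hq).integrableOn, integrableOn_bdry_of_continuousOn hq,
    donaldsonFutaki_neg_iff.2 h⟩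

/-- Contraction towards an interior point turns a convex function with negative Donaldson--Futaki
invariant into a continuous one. -/
theorem exists_continuousOn_of_lintegral_lt
    (hconv : ∀ x ∈ S.P, ∀ y ∈ S.P, ∀ t : ℝ, 0 ≤ t → t ≤ 1 →
      u ((1 - t) • x + t • y) ≤ ENNReal.ofReal (1 - t) * u x + ENNReal.ofReal t * u y)
    (hfin : ∀ x ∈ interior S.P, u x ≠ ∞)
    (hlt : (∫⁻ x in S.bdry, u x ∂S.σ) * S.vol < S.σ S.bdry * ∫⁻ x, u x ∂S.μ) :
    ∃ q : V → ℝ, ContinuousOn q S.P ∧ ConvexOn ℝ S.P q ∧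
      (∫ x in S.bdry, q x ∂S.σ) * S.vol.toReal < (S.σ S.bdry).toReal * ∫ x, q x ∂S.μ := by
  obtain ⟨x₀, hx₀⟩ := S.interior_nonempty
  have hconv' : ConvexOn ℝ (interior S.P) fun x => (u x).toReal := by
    refine ⟨S.convex.interior, fun x hx y hy a b ha hb hab => ?_⟩
    obtain rfl : a = 1 - b := by linarith
    have hxt := ENNReal.mul_ne_top (ENNReal.ofReal_ne_top (r := 1 - b)) (hfin x hx)
    have hyt := ENNReal.mul_ne_top (ENNReal.ofReal_ne_top (r := b)) (hfin y hy)
    refine (ENNReal.toReal_mono (ENNReal.add_ne_top.2 ⟨hxt, hyt⟩)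
      (hconv x (interior_subset hx) y (interior_subset hy) b hb (by linarith))).trans_eq ?_
    rw [ENNReal.toReal_add hxt hyt, ENNReal.toReal_mul, ENNReal.toReal_mul,
      ENNReal.toReal_ofReal ha, ENNReal.toReal_ofReal hb]
    rfl
  have hcont := hconv'.continuousOn isOpen_interior
  have hcontu : ContinuousOn u (interior S.P) :=
    (ENNReal.continuous_ofReal.comp_continuousOn hcont).congr fun x hx =>
      (ENNReal.ofReal_toReal (hfin x hx)).symm
  set δ : ℕ → ℝ := fun n => 1 / ((n : ℝ) + 1) with hδ
  have hδ0 : ∀ n, 0 < δ n := fun n => Nat.one_div_pos_of_nat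
  have hδ1 : ∀ n, δ n ≤ 1 := fun n => by
    rw [hδ]
    exact (div_le_one (by positivity)).2 (by simp)
  have hδlim : Tendsto δ atTop (𝓝 0) := tendsto_one_div_add_atTop_nhds_zero_nat
  -- These contractions map `P` into its interior, where `u` is continuous. Convexity bounds the
  -- boundary integrals from above, and Fatou's lemma bounds the integrals over `P` from below, so
  -- the strict inequality survives for some `n`.
  set κ : ℕ → V → V := fun n x => (1 - δ n) • x + δ n • x₀ with hκ
  have hκint : ∀ n, MapsTo (κ n) S.P (interior S.P) := fun n x hx =>
    S.convex.combo_self_interior_mem_interior hx hx₀ (by linarith [hδ1 n]) (hδ0 n) (by ring)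
  have hκcont : ∀ n, Continuous (κ n) := fun n => by fun_prop
  have hκlim : ∀ x, Tendsto (fun n => κ n x) atTop (𝓝 x) := fun x => by
    have : Tendsto (fun n => (1 - δ n) • x + δ n • x₀) atTop (𝓝 ((1 - 0 : ℝ) • x + (0 : ℝ) • x₀)) :=
      ((hδlim.const_sub 1).smul_const x).add (hδlim.smul_const x₀)
    simpa using this
  have hcontn : ∀ n, ContinuousOn (fun x => u (κ n x)) S.P := fun n =>
    hcontu.comp (hκcont n).continuousOn (hκint n)
  set s := S.σ S.bdry with hs
  have hs_top : s ≠ ∞ := measure_ne_top _ _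
  set B := ∫⁻ x in S.bdry, u x ∂S.σ with hB
  have hBtop : B ≠ ∞ := by
    rintro h
    rw [h, ENNReal.top_mul S.vol_ne_zero] at hlt
    exact absurd hlt (by simp)
  obtain ⟨c, hc1, hc2⟩ := exists_between hlt
  have hbdry : ∀ n, ∫⁻ x in S.bdry, u (κ n x) ∂S.σ ≤
      ENNReal.ofReal (1 - δ n) * B + ENNReal.ofReal (δ n) * (u x₀ * s) := fun n => by
    calc _ ≤ ∫⁻ x in S.bdry, (ENNReal.ofReal (1 - δ n) * u x + ENNReal.ofReal (δ n) * u x₀) ∂S.σ :=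
          setLIntegral_mono' S.measurableSet_bdry fun x hx =>
            hconv x (S.bdry_subset hx) x₀ (interior_subset hx₀) _ (hδ0 n).le (hδ1 n)
      _ = _ := by
        rw [lintegral_add_right _ measurable_const, lintegral_const_mul' _ _ ENNReal.ofReal_ne_top,
          lintegral_const, Measure.restrict_apply_univ, mul_assoc]
  have hev1 : ∀ᶠ n in atTop,
      (ENNReal.ofReal (1 - δ n) * B + ENNReal.ofReal (δ n) * (u x₀ * s)) * S.vol < c := by
    have h1 : Tendsto (fun n => (ENNReal.ofReal (1 - δ n) * B +
        ENNReal.ofReal (δ n) * (u x₀ * s)) * S.vol) atTop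
        (𝓝 ((ENNReal.ofReal (1 - 0) * B + ENNReal.ofReal 0 * (u x₀ * s)) * S.vol)) :=
      ENNReal.Tendsto.mul_const
        ((ENNReal.Tendsto.mul_const (ENNReal.tendsto_ofReal (hδlim.const_sub 1)) (Or.inr hBtop)).add
          (ENNReal.Tendsto.mul_const (ENNReal.tendsto_ofReal hδlim)
            (Or.inr (ENNReal.mul_ne_top (hfin x₀ hx₀) hs_top)))) (Or.inr S.vol_ne_top)
    refine h1.eventually (gt_mem_nhds ?_)
    simpa using hc1
  have hev2 : ∀ᶠ n in atTop, c < s * ∫⁻ x, u (κ n x) ∂S.μ := by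
    refine eventually_lt_of_lt_liminf (hc2.trans_le ?_)
    calc s * ∫⁻ x, u x ∂S.μ ≤ ∫⁻ x, liminf (fun n => s * u (κ n x)) atTop ∂S.μ := by
          rw [← lintegral_const_mul' _ _ hs_top]
          refine lintegral_mono_ae ?_
          filter_upwards [S.ae_mem_interior] with x hx
          exact (ENNReal.Tendsto.const_mul ((hcontu.continuousAt (isOpen_interior.mem_nhds hx)).tendsto.comp
            (hκlim x)) (Or.inr hs_top)).liminf_eq.ge
      _ ≤ liminf (fun n => ∫⁻ x, s * u (κ n x) ∂S.μ) atTop := by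
          refine lintegral_liminf_le' fun n => AEMeasurable.const_mul ?_ _
          rw [← S.restrict_μ]
          exact (hcontn n).aemeasurable S.measurableSet
      _ = liminf (fun n => s * ∫⁻ x, u (κ n x) ∂S.μ) atTop := by
          simp only [lintegral_const_mul' _ _ hs_top]
  obtain ⟨n, hn1, hn2⟩ := (hev1.and hev2).exists
  have hq : ContinuousOn (fun x => (u (κ n x)).toReal) S.P :=
    hcont.comp (hκcont n).continuousOn (hκint n)
  refine ⟨fun x => (u (κ n x)).toReal, hq, ⟨S.convex, fun x hx y hy a b ha hb hab => ?_⟩, ?_⟩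
  · have h := hconv'.2 (hκint n hx) (hκint n hy) ha hb hab
    have h2 : a • κ n x + b • κ n y = κ n (a • x + b • y) := by
      obtain rfl : a = 1 - b := by linarith
      simp only [hκ]
      module
    rwa [h2] at h
  · have hfin1 : ∀ x ∈ S.P, u (κ n x) < ∞ := fun x hx => (hfin _ (hκint n hx)).lt_top
    rw [integral_toReal ((hcontn n).mono S.bdry_subset |>.aemeasurable S.measurableSet_bdry)
      ((ae_restrict_mem S.measurableSet_bdry).mono fun x hx => hfin1 x (S.bdry_subset hx)),
      integral_toReal (by rw [← S.restrict_μ]; exact (hcontn n).aemeasurable S.measurableSet)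
        (S.ae_mem_interior.mono fun x hx => hfin1 x (interior_subset hx)),
      ← ENNReal.toReal_mul, ← ENNReal.toReal_mul]
    refine (ENNReal.toReal_lt_toReal ?_ ?_).2
      (((mul_le_mul_left (hbdry n) _).trans_lt hn1).trans hn2)
    · exact (((mul_le_mul_left (hbdry n) _).trans_lt hn1).trans hn2).ne_top
    · refine ENNReal.mul_ne_top hs_top ?_
      have hint := integrable_of_continuousOn hq
      have := hint.lintegral_lt_top
      rw [lintegral_congr_ae (g := fun x => u (κ n x)) (S.ae_mem_interior.mono fun x hx =>
        ENNReal.ofReal_toReal (hfin1 x (interior_subset hx)).ne)] at this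
      exact this.ne

theorem IsKUnstable.exists_continuousOn (h : S.IsKUnstable) :
    ∃ q : V → ℝ, ContinuousOn q S.P ∧ ConvexOn ℝ S.P q ∧
      (∫ x in S.bdry, q x ∂S.σ) * S.vol.toReal < (S.σ S.bdry).toReal * ∫ x, q x ∂S.μ := by
  obtain ⟨q, hq, hqμ, hqσ, hDF⟩ := h
  rw [donaldsonFutaki_neg_iff] at hDF
  rw [IntegrableOn, restrict_μ] at hqμ
  obtain ⟨K, hK⟩ := hq.exists_le_of_isCompact S.isCompact S.interior_nonempty
  -- Subtracting the lower bound `K` makes `q` nonnegative and leaves the Donaldson–Futaki invariant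
  -- unchanged.
  refine exists_continuousOn_of_lintegral_lt (u := fun x => ENNReal.ofReal (q x - K)) ?_
    (fun x _ => ENNReal.ofReal_ne_top) ?_
  · intro x hx y hy t ht0 ht1
    have h1 := hq.2 hx hy (sub_nonneg.2 ht1) ht0 (by ring)
    have hx' := sub_nonneg.2 (hK x hx)
    have hy' := sub_nonneg.2 (hK y hy)
    have h0 : 0 ≤ 1 - t := by linarith
    rw [← ENNReal.ofReal_mul h0, ← ENNReal.ofReal_mul ht0, ← ENNReal.ofReal_add (by positivity)
      (by positivity)]
    refine ENNReal.ofReal_le_ofReal ?_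
    simp only [smul_eq_mul] at h1
    linarith
  · have hint1 : Integrable (fun x => q x - K) S.μ := hqμ.sub (integrable_const K)
    have hint2 : IntegrableOn (fun x => q x - K) S.bdry S.σ := hqσ.sub (integrable_const K)
    have hμ : 0 ≤ᵐ[S.μ] fun x => q x - K :=
      S.ae_mem_interior.mono fun x hx => sub_nonneg.2 (hK x (interior_subset hx))
    have hσ : 0 ≤ᵐ[S.σ.restrict S.bdry] fun x => q x - K :=
      (ae_restrict_mem S.measurableSet_bdry).mono fun x hx => sub_nonneg.2 (hK x (S.bdry_subset hx))
    rw [← ofReal_integral_eq_lintegral_ofReal hint1 hμ, ← ofReal_integral_eq_lintegral_ofReal hint2 hσ,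
      ← ENNReal.ofReal_toReal S.vol_ne_top, ← ENNReal.ofReal_toReal (measure_ne_top S.σ S.bdry),
      ← ENNReal.ofReal_mul (integral_nonneg_of_ae hσ), ← ENNReal.ofReal_mul ENNReal.toReal_nonneg,
      ENNReal.ofReal_lt_ofReal_iff']
    have hv : S.μ.real univ = S.vol.toReal := S.real_univ
    have hlt : (∫ x in S.bdry, (q x - K) ∂S.σ) * S.vol.toReal <
        (S.σ S.bdry).toReal * ∫ x, (q x - K) ∂S.μ := by
      rw [integral_sub hqμ (integrable_const K), integral_sub hqσ (integrable_const K),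
        integral_const, integral_const, hv, measureReal_restrict_apply_univ, measureReal_def]
      simp only [smul_eq_mul]
      linarith
    exact ⟨hlt, (mul_nonneg (integral_nonneg_of_ae hσ) ENNReal.toReal_nonneg).trans_lt hlt⟩

theorem FiniteState.energy_one : (one S).energy = (S.σ S.bdry).toReal / S.vol.toReal := by
  rw [FiniteState.energy, one, SimpleSystem.energy]
  simp

/-- A state is convex by the weighted mean inequality and has the same total mass as `1`, so energy
below that of `1` is precisely a negative Donaldson–Futaki invariant. Contraction makes it a
continuous real function even if the state is infinite on the boundary. -/
theorem FiniteState.energy_one_le (h : ¬ S.IsKUnstable) (x : S.FiniteState) :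
    (one S).energy ≤ x.energy := by
  by_contra! hlt
  refine h ?_
  obtain ⟨q, hq, hc, hDF⟩ := exists_continuousOn_of_lintegral_lt (S := S) (u := x.1)
    (fun y hy z hz t ht0 ht1 => x.2.1.logConvexOn.le_weighted hy hz ht0 ht1) x.2.1.ne_top (by
      rw [x.2.1.lintegral_eq]
      refine ENNReal.mul_lt_mul_left S.vol_ne_zero S.vol_ne_top ?_
      rw [lintegral_bdry_eq, ← ENNReal.lt_div_iff_mul_lt (Or.inl S.vol_ne_zero)
        (Or.inl S.vol_ne_top), ← ENNReal.toReal_lt_toReal x.2.2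
        (ENNReal.div_ne_top (measure_ne_top _ _) S.vol_ne_zero), ENNReal.toReal_div,
        ← FiniteState.energy_one]
      exact hlt)
  exact isKUnstable_of_continuousOn hq hc hDF

theorem isState_exp (hq : ContinuousOn q S.P) (hc : ConvexOn ℝ S.P q)
    (hint : ∫ x, Real.exp (q x) ∂S.μ = S.vol.toReal) :
    S.IsState fun x => ENNReal.ofReal (Real.exp (q x)) where
  lsc := (ENNReal.continuous_ofReal.comp_continuousOn
    (Real.continuous_exp.comp_continuousOn hq)).lowerSemicontinuousOn
  pos x _ := by simp [Real.exp_pos]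
  logConvex x hx y hy t ht0 ht1 := by
    have h := hc.2 hx hy (sub_nonneg.2 ht1) ht0 (by ring)
    rw [ENNReal.ofReal_rpow_of_pos (Real.exp_pos _), ENNReal.ofReal_rpow_of_pos (Real.exp_pos _),
      ← ENNReal.ofReal_mul (by positivity), ← Real.exp_mul, ← Real.exp_mul, ← Real.exp_add]
    refine ENNReal.ofReal_le_ofReal (Real.exp_le_exp.2 (h.trans_eq ?_))
    simp only [smul_eq_mul]
    ring
  normalized := by
    have hexp : ContinuousOn (fun x => Real.exp (q x)) S.P := by fun_prop
    rw [restrict_μ, ← ofReal_integral_eq_lintegral_ofReal (integrable_of_continuousOn hexp)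
      (ae_of_all _ fun x => (Real.exp_pos _).le), hint, ENNReal.ofReal_toReal S.vol_ne_top]

/-- The normalized `exp (ε q)` is log convex, unlike `1 + ε q` in general, and to first order its
energy changes by a positive multiple of `ε` times the Donaldson–Futaki invariant of `q`. -/
theorem IsKUnstable.exists_energy_lt (h : S.IsKUnstable) :
    ∃ x : S.FiniteState, x.energy < (FiniteState.one S).energy ∧
      Integrable (fun a => ((x.1 a).toReal - 1) ^ 2) S.μ := by
  obtain ⟨q, hq, hc, hDF⟩ := h.exists_continuousOn
  obtain ⟨M, hM⟩ := S.isCompact.exists_bound_of_continuousOn hq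
  set s := (S.σ S.bdry).toReal with hs
  set v := S.vol.toReal with hv
  have hv0 : 0 < v := S.vol_toReal_pos
  have hμv : S.μ.real univ = v := S.real_univ
  -- The term `ε M² s v` absorbs the remainder in `exp y ≤ 1 + y + y²`, which is valid for `|y| ≤ ε
  -- M < 1`.
  obtain ⟨ε, hε1, hε2, hε0⟩ : ∃ ε : ℝ, (∫ x in S.bdry, q x ∂S.σ) * v - s * ∫ x, q x ∂S.μ +
      ε * (M ^ 2 * s * v) < 0 ∧ ε * M < 1 ∧ 0 < ε := by
    have h1 : ∀ᶠ ε in 𝓝 (0 : ℝ), (∫ x in S.bdry, q x ∂S.σ) * v - s * ∫ x, q x ∂S.μ +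
        ε * (M ^ 2 * s * v) < 0 :=
      ContinuousAt.eventually_lt (by fun_prop) continuousAt_const (by linarith)
    have h2 : ∀ᶠ ε in 𝓝 (0 : ℝ), ε * M < 1 :=
      ContinuousAt.eventually_lt (by fun_prop) continuousAt_const (by simp)
    obtain ⟨ε, h3, h4⟩ := (((h1.and h2).filter_mono nhdsWithin_le_nhds).and
      (self_mem_nhdsWithin (s := Ioi (0 : ℝ)))).exists
    exact ⟨ε, h3.1, h3.2, h4⟩
  have hεq : ContinuousOn (fun x => ε * q x) S.P := by fun_prop
  have hexp : ContinuousOn (fun x => Real.exp (ε * q x)) S.P := by fun_prop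
  have hB : ∫ x in S.bdry, Real.exp (ε * q x) ∂S.σ ≤
      s + ε * ∫ x in S.bdry, q x ∂S.σ + ε ^ 2 * M ^ 2 * s := by
    have hi : IntegrableOn (fun x => 1 + ε * q x + ε ^ 2 * M ^ 2) S.bdry S.σ :=
      integrableOn_bdry_of_continuousOn (by fun_prop)
    calc _ ≤ ∫ x in S.bdry, (1 + ε * q x + ε ^ 2 * M ^ 2) ∂S.σ := by
          refine setIntegral_mono_on (integrableOn_bdry_of_continuousOn hexp) hi
            S.measurableSet_bdry fun x hx => ?_
          have hxM : |q x| ≤ M := hM x (S.bdry_subset hx)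
          have h1 : |ε * q x| ≤ ε * M := by
            rw [abs_mul, abs_of_pos hε0]
            gcongr
          have h2 := (abs_le.1 (Real.abs_exp_sub_one_sub_id_le (h1.trans hε2.le))).2
          have h3 : (ε * q x) ^ 2 ≤ (ε * M) ^ 2 := sq_le_sq' (abs_le.1 h1).1 (abs_le.1 h1).2
          nlinarith
      _ = _ := by
          have hi1 : IntegrableOn (fun x => 1 + ε * q x) S.bdry S.σ :=
            integrableOn_bdry_of_continuousOn (by fun_prop)
          rw [integral_add hi1 (integrable_const _), integral_add (integrable_const _)
            (integrableOn_bdry_of_continuousOn hεq), integral_const, integral_const,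
            integral_const_mul, measureReal_restrict_apply_univ, measureReal_def]
          simp only [smul_eq_mul]
          ring
  have hA : v + ε * ∫ x, q x ∂S.μ ≤ ∫ x, Real.exp (ε * q x) ∂S.μ := by
    calc v + ε * ∫ x, q x ∂S.μ = ∫ x, (1 + ε * q x) ∂S.μ := by
          rw [integral_add (integrable_const _) (integrable_of_continuousOn hεq), integral_const,
            integral_const_mul, hμv]
          simp
      _ ≤ _ := by
          refine integral_mono (integrable_of_continuousOn (by fun_prop))
            (integrable_of_continuousOn hexp) fun x => ?_
          have := Real.add_one_le_exp (ε * q x)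
          simp only
          linarith
  have hApos : 0 < ∫ x, Real.exp (ε * q x) ∂S.μ := by
    have : NeZero S.μ := ⟨fun h => hv0.ne' (by rw [← hμv, h]; simp)⟩
    exact integral_exp_pos (integrable_of_continuousOn hexp)
  set N := (∫ x, Real.exp (ε * q x) ∂S.μ) / v with hN
  have hN0 : 0 < N := div_pos hApos hv0
  have hdiv : ∀ x, Real.exp (ε * q x - Real.log N) = Real.exp (ε * q x) / N := fun x => by
    rw [Real.exp_sub, Real.exp_log hN0]
  have hf : ContinuousOn (fun x => ε * q x - Real.log N) S.P := by fun_prop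
  have hstate := isState_exp (S := S) hf
    ((hc.smul hε0.le).sub (concaveOn_const (Real.log N) S.convex))
    (by
      simp only [hdiv]
      rw [integral_div, hN, div_div_cancel₀ hApos.ne'])
  have hexpf : ContinuousOn (fun x => Real.exp (ε * q x - Real.log N)) S.P := by fun_prop
  have hbdry : ∫⁻ x in S.bdry, ENNReal.ofReal (Real.exp (ε * q x - Real.log N)) ∂S.σ =
      ENNReal.ofReal ((∫ x in S.bdry, Real.exp (ε * q x) ∂S.σ) / N) := by
    rw [← ofReal_integral_eq_lintegral_ofReal (integrableOn_bdry_of_continuousOn hexpf)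
      (ae_of_all _ fun x => (Real.exp_pos _).le)]
    simp only [hdiv]
    rw [integral_div]
  refine ⟨⟨_, hstate, energy_ne_top_iff.2 (by rw [hbdry]; exact ENNReal.ofReal_ne_top)⟩, ?_, ?_⟩
  · rw [FiniteState.energy_one]
    change (_ / _ : ℝ≥0∞).toReal < _
    rw [hbdry, ENNReal.toReal_div,
      ENNReal.toReal_ofReal (div_nonneg (integral_nonneg fun x => (Real.exp_pos _).le) hN0.le)]
    refine div_lt_div_of_pos_right ?_ hv0
    rw [div_lt_iff₀ hN0, hN, mul_div_assoc', lt_div_iff₀ hv0]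
    have hs0 : 0 ≤ s := ENNReal.toReal_nonneg
    have h1 := mul_le_mul_of_nonneg_right hB hv0.le
    have h2 := mul_le_mul_of_nonneg_left hA hs0
    have h3 := mul_neg_of_pos_of_neg hε0 hε1
    nlinarith
  · simp only [ENNReal.toReal_ofReal (Real.exp_pos _).le]
    exact integrable_of_continuousOn (by fun_prop)

/-- For a K-unstable system the uniform state does not minimize the free energy. -/
theorem IsKUnstable.exists_free_energy_lt (h : S.IsKUnstable) {T : ℝ} (hT : 0 ≤ T) :
    ∃ x : S.FiniteState, x.energy - T * x.entropy < (FiniteState.one S).energy := by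
  obtain ⟨x, hx, hint⟩ := h.exists_energy_lt
  set D := (∫ a, ((x.1 a).toReal - 1) ^ 2 ∂S.μ) / S.vol.toReal with hD
  -- On the segment from `1` to `x` the energy falls linearly in `t`, while `z log z ≤ z (z - 1)`
  -- bounds the entropy loss by `t² D`; a small `t` wins.
  obtain ⟨t, ht1, ht2, ht0⟩ : ∃ t : ℝ,
      x.energy - (FiniteState.one S).energy + t * (T * D) < 0 ∧ t < 1 ∧ 0 < t := by
    have h1 : ∀ᶠ t in 𝓝 (0 : ℝ), x.energy - (FiniteState.one S).energy + t * (T * D) < 0 :=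
      ContinuousAt.eventually_lt (by fun_prop) continuousAt_const (by linarith)
    have h2 : ∀ᶠ t in 𝓝 (0 : ℝ), t < 1 := gt_mem_nhds one_pos
    obtain ⟨t, h3, h4⟩ := (((h1.and h2).filter_mono nhdsWithin_le_nhds).and
      (self_mem_nhdsWithin (s := Ioi (0 : ℝ)))).exists
    exact ⟨t, h3.1, h3.2, h4⟩
  obtain ⟨z, hzE, hz⟩ := (FiniteState.one S).exists_segment x ⟨ht0, ht2⟩
  refine ⟨z, ?_⟩
  have hz' : ∀ᵐ a ∂S.μ, (z.1 a).toReal = 1 + t * ((x.1 a).toReal - 1) := by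
    filter_upwards [hz] with a ha
    rw [ha, FiniteState.one]
    simp only [ENNReal.toReal_one]
    ring
  have hS : -z.entropy ≤ t ^ 2 * D := by
    rw [FiniteState.entropy, entropyReal, neg_neg, hD, mul_div_assoc']
    refine div_le_div_of_nonneg_right ?_ S.vol_toReal_pos.le
    have hi1 : Integrable (fun a => (z.1 a).toReal - 1) S.μ :=
      z.2.1.integrable_toReal.sub (integrable_const 1)
    have h0 : ∫ a, ((z.1 a).toReal - 1) ∂S.μ = 0 := by
      have hv : S.μ.real univ = S.vol.toReal := S.real_univ
      rw [integral_sub z.2.1.integrable_toReal (integrable_const 1), z.2.1.integral_toReal,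
        integral_const, hv]
      simp
    calc _ ≤ ∫ a, ((z.1 a).toReal - 1 + t ^ 2 * ((x.1 a).toReal - 1) ^ 2) ∂S.μ := by
          refine integral_mono_ae z.integrable_mul_log (hi1.add (hint.const_mul _)) ?_
          filter_upwards [hz'] with a ha
          have h1 : (z.1 a).toReal * Real.log (z.1 a).toReal ≤
              (z.1 a).toReal * ((z.1 a).toReal - 1) :=
            Real.mul_log_le_mul_sub_one ENNReal.toReal_nonneg
          refine h1.trans_eq ?_
          rw [ha]
          ring
      _ = _ := by rw [integral_add hi1 (hint.const_mul _), h0, zero_add, integral_const_mul]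
  have h1 := mul_le_mul_of_nonneg_left hS hT
  have h2 := mul_neg_of_pos_of_neg ht0 ht1
  rw [hzE]
  nlinarith

end SimpleSystem

/-! ### Canonical energy and entropy of the minimizers. -/

namespace SimpleSystem

variable {V : Type*} [NormedAddCommGroup V] [NormedSpace ℝ V] [MeasurableSpace V]
  {S : SimpleSystem V}

theorem FiniteState.coe_energy (x : S.FiniteState) :
    (S.energy x.1 : EReal) = (x.energy : EReal) :=
  (EReal.coe_ennreal_toReal x.2.2).symm

variable [FiniteDimensional ℝ V] [BorelSpace V]

namespace FiniteState

theorem freeEnergy_eq (x : S.FiniteState) (T : ℝ) :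
    S.freeEnergy T x.1 = ((x.energy - T * x.entropy : ℝ) : EReal) := by
  have h : S.entropy x.1 = (x.entropy : EReal) := x.2.1.entropy_eq x.2.2
  rw [freeEnergy, h, if_neg (EReal.coe_ne_bot _), x.coe_energy, EReal.coe_sub, EReal.coe_mul]

/-- A state with a real energy value has finite energy, so passing to finite states omits nothing
from the supremum. -/
theorem supEntropy_eq : EnergyEntropySystem.supEntropy (energy (S := S)) entropy = S.eqEntropy := by
  funext E
  refine le_antisymm (iSup₂_le fun x hx => ?_) (iSup₂_le fun u hu => ?_)
  · refine le_iSup₂_of_le x.1 ⟨x.2.1, by rw [x.coe_energy, hx]⟩ ?_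
    exact (x.2.1.entropy_eq x.2.2).ge
  · have hfin : S.energy u ≠ ∞ := fun h => by simp [h] at hu
    have hx := coe_energy (S := S) ⟨u, hu.1, hfin⟩
    refine le_iSup₂_of_le ⟨u, hu.1, hfin⟩ ?_ (hu.1.entropy_eq hfin).le
    exact EReal.coe_eq_coe_iff.1 (hx.symm.trans hu.2)

theorem temperatures_eq (E : ℝ) :
    EnergyEntropySystem.temperatures (EnergyEntropySystem.supEntropy (energy (S := S)) entropy) E =
      S.eqTemperatures E := by
  rw [supEntropy_eq]
  rfl

theorem energyRange_eq {x : S.FiniteState} (hx : ∀ y : S.FiniteState, x.energy ≤ y.energy) :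
    S.energyRange = Ico x.energy (one S).energy := by
  have hinf : (⨅ (u : V → ℝ≥0∞) (_ : S.IsState u), (S.energy u : EReal)) = (x.energy : EReal) := by
    refine le_antisymm ((iInf₂_le x.1 x.2.1).trans_eq x.coe_energy) (le_iInf₂ fun u hu => ?_)
    by_cases hE : S.energy u = ∞
    · simp [hE]
    · have := coe_energy (S := S) ⟨u, hu, hE⟩
      rw [this]
      exact_mod_cast hx _
  have hone := coe_energy (one S)
  ext E
  rw [energyRange, mem_ofPred_eq, hinf, show S.energy (fun _ => 1) = S.energy (one S).1 from rfl,
    hone, EReal.coe_le_coe_iff, EReal.coe_lt_coe_iff, mem_Ico]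

theorem canFreeEnergy_eq {x : S.FiniteState} {T : ℝ}
    (hx : ∀ y : S.FiniteState, x.energy - T * x.entropy ≤ y.energy - T * y.entropy) :
    S.canFreeEnergy T = ((x.energy - T * x.entropy : ℝ) : EReal) := by
  refine le_antisymm ((iInf₂_le x.1 x.2.1).trans_eq (x.freeEnergy_eq T)) (le_iInf₂ fun u hu => ?_)
  by_cases hE : S.energy u = ∞
  · rw [freeEnergy]
    split_ifs with hS
    · exact le_top
    · have hS' : ∃ s : ℝ, S.entropy u = s := by
        rw [SimpleSystem.entropy] at hS ⊢
        split_ifs at hS ⊢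
        · exact ⟨_, rfl⟩
        · exact absurd rfl hS
      obtain ⟨s, hs⟩ := hS'
      rw [hE, hs, ← EReal.coe_mul, EReal.coe_ennreal_top, EReal.top_sub_coe]
      exact le_top
  · rw [freeEnergy_eq ⟨u, hu, hE⟩ T]
    exact_mod_cast hx _

end FiniteState

open EnergyEntropySystem in
/-- Along a family of minimizers of the free energy, the canonical energy and entropy are the energy
and the entropy of the minimizers. -/
theorem canEnergy_eq {C : ℝ} {c : ℝ} {M : ℝ → S.FiniteState}
    (h : EnergyEntropySystem (FiniteState.energy (S := S)) FiniteState.entropy FiniteState.sqrtLp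
      (FiniteState.one S) c C)
    (hM : IsMinimizerFamily FiniteState.energy FiniteState.entropy M) {T : ℝ} (hT : 0 ≤ T) :
    (S.IsKUnstable → ∃! U : ℝ, U ∈ S.energyRange ∧ T ∈ S.eqTemperatures U) ∧
      S.canEnergy T = (M T).energy := by
  have hmin : ∀ y : S.FiniteState, (M 0).energy ≤ y.energy := fun y => by simpa using hM.le 0 le_rfl y
  have huniq : ∀ E, E ∈ S.energyRange ∧ T ∈ S.eqTemperatures E → E = (M T).energy := by
    rintro E ⟨hE, hTE⟩
    rw [FiniteState.energyRange_eq hmin] at hE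
    rw [← FiniteState.temperatures_eq] at hTE
    exact hM.eq_of_mem_temperatures h hT hE hTE
  have hex : S.IsKUnstable → (M T).energy ∈ S.energyRange ∧ T ∈ S.eqTemperatures (M T).energy := by
    intro hK
    have hlt : (M T).energy < (FiniteState.one S).energy := by
      obtain ⟨x, hx⟩ := hK.exists_free_energy_lt hT
      have h1 := (hM.le T hT x).trans_lt hx
      have h2 := mul_nonpos_of_nonneg_of_nonpos hT (M T).entropy_nonpos
      linarith
    rw [FiniteState.energyRange_eq hmin, ← FiniteState.temperatures_eq]
    exact ⟨⟨hmin _, hlt⟩, hM.mem_temperatures h hT hlt⟩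
  refine ⟨fun hK => ⟨_, hex hK, huniq⟩, ?_⟩
  rw [canEnergy]
  split_ifs with hK
  · exact huniq _ (Classical.epsilon_spec (p := fun U : ℝ => U ∈ S.energyRange ∧
      T ∈ S.eqTemperatures U) ⟨_, hex hK⟩)
  -- In the K-semistable case the uniform state has minimal energy, while a minimizer of the free
  -- energy never exceeds it.
  · exact le_antisymm (FiniteState.energy_one_le hK _) (hM.energy_le h hT)

end SimpleSystem

end

theorem mainTheorem12 {V : Type*} [NormedAddCommGroup V] [NormedSpace ℝ V]
    [FiniteDimensional ℝ V] [MeasurableSpace V] [BorelSpace V] (S : SimpleSystem V) :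
    (∀ T : ℝ, 0 ≤ T →
      -- the minimum, `U^can` and `S^can` are well defined, and the values are finite
      (∃ u : V → ℝ≥0∞, S.IsState u ∧ S.freeEnergy T u = S.canFreeEnergy T) ∧
      (S.IsKUnstable → ∃! U : ℝ, U ∈ S.energyRange ∧ T ∈ S.eqTemperatures U) ∧
      S.canFreeEnergy T ≠ ⊤ ∧ S.canFreeEnergy T ≠ ⊥ ∧
      S.canEntropy T ≠ ⊤ ∧ S.canEntropy T ≠ ⊥ ∧
      -- the identity
      S.canFreeEnergy T = (S.canEnergy T : EReal) - (T : EReal) * S.canEntropy T) ∧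
    -- continuous differentiability on `[0, ∞)` (one-sided at `0`) and the derivative
    ContDiffOn ℝ 1 (fun T : ℝ => (S.canFreeEnergy T).toReal) (Set.Ici 0) ∧
    ∀ T : ℝ, 0 ≤ T →
      HasDerivWithinAt (fun T' : ℝ => (S.canFreeEnergy T').toReal)
        (-(S.canEntropy T).toReal) (Set.Ici 0) T := by
  obtain ⟨C, h⟩ := SimpleSystem.FiniteState.exists_energyEntropySystem S
  obtain ⟨M, hle, hent, hright⟩ := EnergyEntropySystem.exists_minimizers h
  have hM : EnergyEntropySystem.IsMinimizerFamily SimpleSystem.FiniteState.energy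
      SimpleSystem.FiniteState.entropy M := ⟨hle, hent, hright⟩
  have hF : ∀ T, 0 ≤ T → S.canFreeEnergy T = (((M T).energy - T * (M T).entropy : ℝ) : EReal) :=
    fun T hT => SimpleSystem.FiniteState.canFreeEnergy_eq (hle T hT)
  have hS : ∀ T, 0 ≤ T → S.canEntropy T = ((M T).entropy : EReal) := fun T hT => by
    rw [SimpleSystem.canEntropy, (SimpleSystem.canEnergy_eq h hM hT).2,
      ← SimpleSystem.FiniteState.supEntropy_eq, hM.supEntropy_eq hT]
  have hFreal : ∀ T ∈ Set.Ici (0 : ℝ),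
      (S.canFreeEnergy T).toReal = (M T).energy - T * (M T).entropy := fun T hT => by
    rw [hF T hT, EReal.toReal_coe]
  refine ⟨fun T hT => ⟨⟨(M T).1, (M T).2.1, ?_⟩, (SimpleSystem.canEnergy_eq h hM hT).1, ?_, ?_, ?_,
    ?_, ?_⟩, (hM.contDiffOn h).congr hFreal, fun T hT => ?_⟩
  · rw [hF T hT, (M T).freeEnergy_eq]
  · rw [hF T hT]
    exact EReal.coe_ne_top _
  · rw [hF T hT]
    exact EReal.coe_ne_bot _
  · rw [hS T hT]
    exact EReal.coe_ne_top _
  · rw [hS T hT]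
    exact EReal.coe_ne_bot _
  · rw [hF T hT, hS T hT, (SimpleSystem.canEnergy_eq h hM hT).2, EReal.coe_sub, EReal.coe_mul]
  · rw [hS T hT, EReal.toReal_coe]
    exact (hM.hasDerivWithinAt h hT).congr hFreal (hFreal T hT)
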